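/- An instance of Bin Packing is a finite stream $I$ of item sizes in $[0,1]$, and $\mathrm{OPT}(I)$ is the least number of unit-capacity bins into which its items can be packed. A deterministic streaming algorithm updates a memory state with each arriving item and, after the last one, computes a number of bins by an unrestricted computation. It is an asymptotic $(1+\varepsilon)$-approximation if there is a function $f(n)=o(n)$ such that its output $m$ satisfies $\mathrm{OPT}(I)\le m\le(1+\varepsilon)\,\mathrm{OPT}(I)+f(\mathrm{OPT}(I))$ for every $I$. For a stream $a=(a_1,\dots,a_N)$ of real numbers, $\mathrm{rank}(q)$ is the number of $i$ with $a_i>q$. A streaming algorithm for Bin Packing is comparison-based if its memory consists of an array of stored input items and a general memory, and if, while the stream is processed, the new general memory and the choice of the items to be stored (among the arriving item and those stored so far) depend only on the general memory and on the results of comparing the arriving item with the stored items and with finitely many fixed constants. In addition, one word may accumulate the total size of all items of size at most some fixed threshold $\theta$; it is used only in the final computation, which may be any function of the whole memory. 1. (Reduction.) Let $\varepsilon>0$ and let $A$ be any deterministic streaming asymptotic $(1+\varepsilon)$-approximation for Bin Packing. Let $l<u$ and let $s$ be the increasing affine map of $(l,u)$ onto $(\tfrac12,\tfrac23)$ (the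 identity if $l=\tfrac12$, $u=\tfrac23$). Given a stream $a_1,\dots,a_N\in(l,u)$, feed $A$ with two copies of each $s(a_i)$, in the order of the stream; keep the memory state of $A$ and the counter $N$. To answer a query $q\in(l,u)$, continue $A$ from this state with $2N$ items of size $1-s(q)$ and, if $A$ returns $m$, answer $m-2N$. This is a $4\varepsilon$-approximate summary for Estimating Rank: there is $N_0$ such that $|(m-2N)-\mathrm{rank}(q)|\le4\varepsilon N$ whenever $N\ge N_0$. Its memory is exactly that of $A$ after the $2N$ items, together with one counter. 2. (Lower bound.) There is an absolute constant $c>0$ such that for every $0<\varepsilon<\frac1{64}$ and every deterministic comparison-based streaming asymptotic $(1+\varepsilon)$-approximation for Bin Packing (with $\theta\le\frac12$, and with no restriction on the size of its general memory) the following holds: for all sufficiently large $n$ there is a stream $I$ with $\mathrm{OPT}(I)=n$ during which the algorithm stores, at some time, at least $c\cdot\frac1\varepsilon\log n$ items. In particular, no such algorithm stores $o(\frac1\varepsilon\log\mathrm{OPT})$ items. 3. (Optimality up to $O(\log\frac1\varepsilon)$.) There is an absolute constant $K$ such that for every $0<\varepsilon\le\frac12$ there is a deterministic comparison-based streaming asymptotic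 $(1+\varepsilon)$-approximation for Bin Packing, with $\theta\le\varepsilon$, which after every stream $I$ of $N$ items uses at most $K\cdot\frac1\varepsilon\cdot\log\frac1\varepsilon\cdot\log(\mathrm{OPT}(I)+2)$ words in total, counting its constants, its stored items, the accumulated sum and the words of its general memory; each word of the general memory is a natural number of at most $(N+1)^K$. -/

import Mathlib

open Filter Asymptotics

noncomputable section

/-! ### Bin Packing -/

/-- A stream of Bin Packing items: finitely many sizes between `0` and `1`, in order of arrival. -/
def IsBPInput (I : List ℝ) : Prop := ∀ x ∈ I, 0 ≤ x ∧ x ≤ 1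

/-- The items of `I` can be packed into `m` bins of unit capacity. -/
def Packable (I : List ℝ) (m : ℕ) : Prop :=
  ∃ bin : Fin I.length → Fin m, ∀ j : Fin m,
    ∑ i ∈ Finset.univ.filter (fun i => bin i = j), I.get i ≤ 1

/-- The optimal number of bins. -/
def binOPT (I : List ℝ) : ℕ := sInf {m : ℕ | Packable I m}

/-! ### Streaming algorithms -/

/-- A deterministic streaming algorithm with memory states `σ` that outputs a number of bins.
The final computation `output` is unrestricted. -/
structure StreamAlg (σ : Type) where
  init : σ
  step : σ → ℝ → σ
  output : σ → ℕ

/-- The memory state after the stream `I`. -/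
def StreamAlg.run {σ : Type} (A : StreamAlg σ) (I : List ℝ) : σ := I.foldl A.step A.init

/-- `A` is a streaming asymptotic `R`-approximation for Bin Packing: its output is at least `OPT`
and at most `R * OPT + o(OPT)`. -/
def StreamAlg.IsAsymptoticApprox {σ : Type} (A : StreamAlg σ) (R : ℝ) : Prop :=
  ∃ f : ℕ → ℝ, f =o[atTop] (fun n : ℕ => (n : ℝ)) ∧
    ∀ I : List ℝ, IsBPInput I →
      binOPT I ≤ A.output (A.run I) ∧
      (A.output (A.run I) : ℝ) ≤ R * (binOPT I : ℝ) + f (binOPT I)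

/-! ### Estimating Rank -/

/-- The rank of `q`: the number of entries of the stream that are larger than `q`. -/
def streamRank (a : List ℝ) (q : ℝ) : ℕ := (a.filter (fun x => q < x)).length

/-- A streaming summary with memory states `τ` that answers rank queries. -/
structure RankSummary (τ : Type) where
  init : τ
  step : τ → ℝ → τ
  query : τ → ℝ → ℤ

def RankSummary.run {τ : Type} (R : RankSummary τ) (a : List ℝ) : τ := a.foldl R.step R.init

/-- On every sufficiently long stream of numbers from `U`, every query from `U` is answered with
error at most `δ N`, where `N` is the length of the stream. -/
def RankSummary.IsApprox {τ : Type} (R : RankSummary τ) (U : Set ℝ) (δ : ℝ) : Prop :=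
  ∃ N₀ : ℕ, ∀ a : List ℝ, N₀ ≤ a.length → (∀ x ∈ a, x ∈ U) → ∀ q ∈ U,
    |(R.query (R.run a) q : ℝ) - (streamRank a q : ℝ)| ≤ δ * (a.length : ℝ)

/-- The increasing affine map of `(l, u)` onto `(1/2, 2/3)`; it is the identity for
`l = 1/2` and `u = 2/3`. -/
def scaleTo (l u x : ℝ) : ℝ := 1 / 2 + (x - l) / (6 * (u - l))

/-- The reduction. Each (scaled) number is given twice to the Bin Packing algorithm, and the number
`N` of entries is counted. For a query `q`, the algorithm is continued on `2 N` further items of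
size `1 - q` (with `q` scaled), and `2 N` is subtracted from the number of bins it returns. -/
def StreamAlg.rankSummary {σ : Type} (A : StreamAlg σ) (l u : ℝ) : RankSummary (σ × ℕ) where
  init := (A.init, 0)
  step s x := (A.step (A.step s.1 (scaleTo l u x)) (scaleTo l u x), s.2 + 1)
  query s q :=
    (A.output ((List.replicate (2 * s.2) (1 - scaleTo l u q)).foldl A.step s.1) : ℤ) - 2 * (s.2 : ℤ)

/-! ### Comparison-based algorithms -/

/-- The memory of a comparison-based algorithm: the array `items` of stored input items, the general
memory `gen`, and a word `smallSum` for the total size of the small items. -/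
structure Memory (G : Type) where
  items : List ℝ
  gen : G
  smallSum : ℝ

/-- A deterministic comparison-based streaming algorithm with general memory `G`.
While the stream is processed, an arriving item is accessed only by comparing it with the stored
items and with the fixed constants `consts`: the results of these comparisons (the first and the
second list of orderings) and the general memory determine the new general memory, and also which
items are stored next, as a list of positions in the list of the arriving item (position `0`)
followed by the items stored so far. The one exception is the word that sums up the sizes of all
items of size at most `small`; it is not available before the final computation, and it is
always `0` when `small` is negative. The final computation `output` is an arbitrary function of the
memory. -/
structure ComparisonAlg (G : Type) where
  consts : List ℝ
  small : ℝ
  init : G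
  select : G → List Ordering → List Ordering → List ℕ
  update : G → List Ordering → List Ordering → G
  output : Memory G → ℕ

/-- The underlying streaming algorithm; initially no item is stored. -/
def ComparisonAlg.toStreamAlg {G : Type} (A : ComparisonAlg G) : StreamAlg (Memory G) where
  init := ⟨[], A.init, 0⟩
  step M x :=
    { items := (A.select M.gen (M.items.map (cmp x)) (A.consts.map (cmp x))).filterMap
        (fun i => (x :: M.items)[i]?)
      gen := A.update M.gen (M.items.map (cmp x)) (A.consts.map (cmp x))
      smallSum := if x ≤ A.small then M.smallSum + x else M.smallSum }
  output := A.output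

end

/-! Reduction. Take two copies of each `a_i` in `(1/2, 2/3)` and `2N` items `1 - q`. Copies above
`q` need bins of their own, each copy up to `q` shares a bin with one `1 - q`, and the `2 * rank q`
items `1 - q` left over are packed in pairs. Weights `1` above `q` and `1/2` elsewhere show
optimality, so `OPT = 2N + rank q` (`binOPT_doubled`). As this is at most `3N`, a relative error of
`ε + ε/3` becomes `4εN`.

Lower bound. Two streams are built in parallel, as one stream of pairs, so that the algorithm sees
the same comparisons in both. A gap is a stretch without stored pairs across which the ranks in the
two streams drift apart by `g`. Queried there, the algorithm gives one answer for both streams, so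
accuracy forces `g ≤ 4εN` (`ComparisonAlg.gap_le`). The adversary recurses: it runs on a box, then
on a fresh box inside the largest gap, just above its lower end in one stream and just below its
upper end in the other, so that gaps add up (`Ready.adversaryRun_combine`). If the largest final gap
is `g`, the pairs kept from the first half cut it into pieces of at most `g`, so about `N / g` of
them are still stored while the second half runs. Averaging the two halves (`space_combine`) yields
about `1 / ε` stored items for each of about `log n` levels of recursion. Since the final
computation sees actual values, one stream is moved by an increasing function so that both memories
become literally equal.

Upper bound. The items above about `ε/4` are split into `k = O(log (1/ε))` dyadic size classes, each
with a deterministic rank summary of error `N / m`, `m` of order `1 / ε`. In a summary older records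
absorb newer neighbours. A record inserted at time `t` has rank error `t / m` forever and may absorb
`(N - t) / m` items on either side, so errors total `N / m`. A potential argument over arrival times
bounds the number of records by `O(m log (N / m))` (`SketchInv.length_le`). If two inputs lead to
the same memory, each class of one is dominated by that of the other apart from a few exceptions,
whose bins amount to an `ε/4` fraction of `OPT` and one per class; small items are added greedily
(`binOPT_le_of_similar`). The algorithm can thus output the largest optimum among all inputs with
its memory. -/

/-! ### Packings of multisets of items -/

/-- A multiset of sizes can be distributed over `m` bins of unit capacity. -/
def PackableMultiset (s : Multiset ℝ) (m : ℕ) : Prop :=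
  ∃ B : Fin m → Multiset ℝ, ∑ j, B j = s ∧ ∀ j, (B j).sum ≤ 1

theorem Packable.multiset {I : List ℝ} {m : ℕ} (h : Packable I m) :
    PackableMultiset (I : Multiset ℝ) m := by
  obtain ⟨bin, hbin⟩ := h
  refine ⟨fun j => (Finset.univ.filter (fun i => bin i = j)).val.map I.get, ?_, fun j => hbin j⟩
  have h1 : (Finset.univ.val.map I.get : Multiset ℝ) = (I : Multiset ℝ) := by
    rw [Fin.univ_val_map, List.ofFn_get]
  rw [← h1]
  ext x
  rw [Multiset.count_sum', Multiset.count_map]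
  simp only [Multiset.count_map]
  rw [← Finset.filter_val, Finset.card_val,
    Finset.card_eq_sum_card_fiberwise (f := bin) (t := Finset.univ) (by intro; simp)]
  refine Finset.sum_congr rfl fun j _ => ?_
  rw [← Finset.filter_val, Finset.card_val, Finset.filter_filter, Finset.filter_filter]
  congr 1
  ext i
  simp [and_comm]

/-- Multisets forget which copy of a repeated size lies in which bin. Peeling off the items of `I`
one at a time, each from some bin that contains its size, recovers an assignment of indices. -/
theorem exists_assignment_of_sum_eq {m : ℕ} : ∀ (I : List ℝ) (B : Fin m → Multiset ℝ),
    ∑ j, B j = (I : Multiset ℝ) → ∃ bin : Fin I.length → Fin m, ∀ j : Fin m,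
      ∑ i ∈ Finset.univ.filter (fun i => bin i = j), I.get i = (B j).sum := by
  intro I
  induction I with
  | nil =>
    intro B hB
    refine ⟨fun i => i.elim0, fun j => ?_⟩
    have : B j = 0 := by
      have := Finset.sum_eq_zero_iff.1 hB j (Finset.mem_univ j)
      exact this
    simp [this]
  | cons x I ih =>
    intro B hB
    have hx : x ∈ ∑ j, B j := by rw [hB]; simp
    obtain ⟨j₀, -, hj₀⟩ := Multiset.mem_sum.1 hx
    have hsplit : B j₀ = x ::ₘ (B j₀).erase x := (Multiset.cons_erase hj₀).symm
    have hI : ∑ j, Function.update B j₀ ((B j₀).erase x) j = (I : Multiset ℝ) := by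
      rw [Finset.sum_update_of_mem (Finset.mem_univ _)]
      have h2 := Finset.add_sum_erase Finset.univ B (Finset.mem_univ j₀)
      rw [hB, hsplit, Multiset.cons_add] at h2
      rw [Finset.sdiff_singleton_eq_erase]
      exact (Multiset.cons_inj_right x).1 h2
    obtain ⟨bin, hbin⟩ := ih _ hI
    refine ⟨Fin.cons j₀ bin, fun j => ?_⟩
    have h3 := hbin j
    rw [Finset.sum_filter] at h3 ⊢
    have h4 : ∀ f : Fin (I.length + 1) → ℝ, ∑ i, f i = f 0 + ∑ i : Fin I.length, f i.succ :=
      fun f => Fin.sum_univ_succ f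
    refine (h4 _).trans ?_
    simp only [Fin.cons_zero, Fin.cons_succ]
    refine (congrArg₂ (· + ·) rfl h3).trans ?_
    by_cases hj : j₀ = j
    · subst hj
      rw [hsplit]
      simp
    · rw [Function.update_of_ne (Ne.symm hj)]
      simp [hj]

theorem PackableMultiset.packable {I : List ℝ} {m : ℕ}
    (h : PackableMultiset (I : Multiset ℝ) m) : Packable I m := by
  obtain ⟨B, hB, hB1⟩ := h
  obtain ⟨bin, hbin⟩ := exists_assignment_of_sum_eq I B hB
  exact ⟨bin, fun j => (hbin j).trans_le (hB1 j)⟩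

theorem packable_iff {I : List ℝ} {m : ℕ} :
    Packable I m ↔ PackableMultiset (I : Multiset ℝ) m :=
  ⟨Packable.multiset, PackableMultiset.packable⟩

theorem exists_multiset_le_card_eq {α : Type*} {s : Multiset α} {n : ℕ} (h : n ≤ s.card) :
    ∃ t ≤ s, t.card = n := by
  induction s using Quotient.inductionOn with
  | h l => exact ⟨(l.take n : List α), (List.take_sublist n l).subperm, by simpa using h⟩

namespace PackableMultiset

theorem zero : PackableMultiset 0 0 := ⟨fun _ => 0, by simp, by simp⟩

theorem add {s t : Multiset ℝ} {m n : ℕ} (hs : PackableMultiset s m)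
    (ht : PackableMultiset t n) : PackableMultiset (s + t) (m + n) := by
  obtain ⟨B, hB, hB1⟩ := hs
  obtain ⟨C, hC, hC1⟩ := ht
  refine ⟨Fin.append B C, ?_, fun j => ?_⟩
  · rw [Fin.sum_univ_add]
    simp [hB, hC]
  · refine Fin.addCases (fun i => ?_) (fun i => ?_) j
    · simpa using hB1 i
    · simpa using hC1 i

theorem empty (m : ℕ) : PackableMultiset 0 m := ⟨fun _ => 0, by simp, by simp⟩

theorem mono {s : Multiset ℝ} {m n : ℕ} (hs : PackableMultiset s m) (h : m ≤ n) :
    PackableMultiset s n := by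
  obtain ⟨k, rfl⟩ := Nat.exists_eq_add_of_le h
  simpa using hs.add (empty k)

theorem single {s : Multiset ℝ} (h : s.sum ≤ 1) : PackableMultiset s 1 :=
  ⟨fun _ => s, by simp, fun _ => h⟩

theorem sum {ι : Type*} (J : Finset ι) (s : ι → Multiset ℝ) (m : ι → ℕ)
    (h : ∀ i ∈ J, PackableMultiset (s i) (m i)) :
    PackableMultiset (∑ i ∈ J, s i) (∑ i ∈ J, m i) := by
  classical
  induction J using Finset.induction_on with
  | empty => simpa using zero
  | insert i J hi ih =>
    rw [Finset.sum_insert hi, Finset.sum_insert hi]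
    exact (h i (by simp)).add (ih fun k hk => h k (by simp [hk]))

/-- Weak duality: a weight that is at most `1` on every feasible bin is at most the number of
bins. -/
theorem weight_le {s : Multiset ℝ} {m : ℕ} (hs : PackableMultiset s m) (w : ℝ → ℝ)
    (hw : ∀ t ≤ s, t.sum ≤ 1 → (t.map w).sum ≤ 1) : (s.map w).sum ≤ m := by
  obtain ⟨B, hB, hB1⟩ := hs
  have h1 : (s.map w).sum = ∑ j, ((B j).map w).sum := by
    rw [← hB]
    have := map_sum ((Multiset.sumAddMonoidHom (M := ℝ)).comp (Multiset.mapAddMonoidHom w)) B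
      Finset.univ
    exact this
  rw [h1]
  calc ∑ j, ((B j).map w).sum ≤ ∑ _j : Fin m, (1 : ℝ) := by
        refine Finset.sum_le_sum fun j _ => hw _ ?_ (hB1 j)
        rw [← hB]
        exact Finset.single_le_sum (f := B) (fun _ _ => Multiset.zero_le _) (Finset.mem_univ j)
    _ = m := by simp

theorem sum_le {s : Multiset ℝ} {m : ℕ} (hs : PackableMultiset s m) : s.sum ≤ m := by
  simpa using hs.weight_le id (fun t _ ht => by simpa using ht)

/-- Replacing items by smaller ones keeps a packing feasible. -/
theorem of_rel {s t : Multiset ℝ} {m : ℕ} (ht : PackableMultiset t m)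
    (h : Multiset.Rel (· ≤ ·) s t) : PackableMultiset s m := by
  obtain ⟨C, hC, hC1⟩ := ht
  have key : ∀ (J : Finset (Fin m)) (s : Multiset ℝ), Multiset.Rel (· ≤ ·) s (∑ j ∈ J, C j) →
      ∃ B : Fin m → Multiset ℝ, ∑ j ∈ J, B j = s ∧ ∀ j ∈ J, (B j).sum ≤ (C j).sum := by
    intro J
    induction J using Finset.induction_on with
    | empty =>
      intro s hs
      simp only [Finset.sum_empty, Multiset.rel_zero_right] at hs
      exact ⟨fun _ => 0, by simp [hs], by simp⟩
    | insert i J hi ih =>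
      intro s hs
      rw [Finset.sum_insert hi, Multiset.rel_add_right] at hs
      obtain ⟨s₁, s₂, h₁, h₂, rfl⟩ := hs
      obtain ⟨B, hB, hB'⟩ := ih s₂ h₂
      refine ⟨Function.update B i s₁, ?_, fun j hj => ?_⟩
      · rw [Finset.sum_insert hi, Function.update_self]
        congr 1
        rw [← hB]
        refine Finset.sum_congr rfl fun j hj => Function.update_of_ne ?_ _ _
        rintro rfl
        exact hi hj
      · by_cases hji : j = i
        · subst hji
          rw [Function.update_self]
          exact Multiset.sum_le_sum_of_rel_le h₁
        · rw [Function.update_of_ne hji]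
          exact hB' j ((Finset.mem_insert.1 hj).resolve_left hji)
  obtain ⟨B, hB, hB'⟩ := key Finset.univ s (by rwa [hC])
  exact ⟨B, hB, fun j => (hB' j (Finset.mem_univ j)).trans (hC1 j)⟩

/-- Deletion is not covered by `of_rel`, which keeps the number of items. Going through the bins,
each keeps the intersection of its contents with what is left of `s`; nonnegativity of the removed
items bounds the new load. -/
theorem of_le {s t : Multiset ℝ} {m : ℕ} (ht : PackableMultiset t m) (hst : s ≤ t)
    (h0 : ∀ x ∈ t, 0 ≤ x) : PackableMultiset s m := by
  obtain ⟨u, rfl⟩ := Multiset.le_iff_exists_add.1 hst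
  obtain ⟨C, hC, hC1⟩ := ht
  have key : ∀ (J : Finset (Fin m)) (s u : Multiset ℝ), (∀ x ∈ u, 0 ≤ x) → s + u = ∑ j ∈ J, C j →
      ∃ B : Fin m → Multiset ℝ, ∑ j ∈ J, B j = s ∧ ∀ j ∈ J, (B j).sum ≤ (C j).sum := by
    intro J
    induction J using Finset.induction_on with
    | empty =>
      intro s u _ hs
      simp only [Finset.sum_empty, add_eq_zero] at hs
      exact ⟨fun _ => 0, by simp [hs.1], by simp⟩
    | insert i J hi ih =>
      intro s u hu hs
      rw [Finset.sum_insert hi] at hs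
      have hd : (s - C i) + (u - (C i - s)) = ∑ j ∈ J, C j := by
        ext x
        have := congrArg (Multiset.count x) hs
        simp only [Multiset.count_add, Multiset.count_sub] at this ⊢
        omega
      obtain ⟨B, hB, hB'⟩ := ih (s - C i) (u - (C i - s))
        (fun x hx => hu x (Multiset.mem_of_le (Multiset.sub_le_self _ _) hx)) hd
      refine ⟨Function.update B i (s ∩ C i), ?_, fun j hj => ?_⟩
      · rw [Finset.sum_insert hi, Function.update_self]
        conv_rhs => rw [← Multiset.sub_add_inter s (C i), add_comm, ← hB]
        congr 1
        refine Finset.sum_congr rfl fun j hj => Function.update_of_ne ?_ _ _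
        rintro rfl
        exact hi hj
      · by_cases hji : j = i
        · subst hji
          rw [Function.update_self]
          have h5 : C j = s ∩ C j + (C j - s) := by
            rw [Multiset.inter_comm, add_comm, Multiset.sub_add_inter]
          have h6 : C j - s ≤ u := by
            rw [tsub_le_iff_left, hs]
            exact le_add_of_nonneg_right (Multiset.zero_le _)
          conv_rhs => rw [h5, Multiset.sum_add]
          have : 0 ≤ (C j - s).sum :=
            Multiset.sum_nonneg fun x hx => hu x (Multiset.mem_of_le h6 hx)
          linarith
        · rw [Function.update_of_ne hji]
          exact hB' j ((Finset.mem_insert.1 hj).resolve_left hji)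
  obtain ⟨B, hB, hB'⟩ := key Finset.univ s u (fun x hx => h0 x (by simp [hx])) hC.symm
  exact ⟨B, hB, fun j => (hB' j (Finset.mem_univ j)).trans (hC1 j)⟩

/-- Small items can be added greedily as long as the total size leaves room. -/
theorem add_small {θ : ℝ} {b : ℕ} (hb : 0 < b) {s : Multiset ℝ} (hs : PackableMultiset s b)
    (t : Multiset ℝ) (ht : ∀ x ∈ t, 0 ≤ x ∧ x ≤ θ) (hsum : (s + t).sum ≤ (1 - θ) * b) :
    PackableMultiset (s + t) b := by
  induction t using Multiset.induction_on with
  | empty => simpa using hs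
  | cons x t ih =>
    have hx := ht x (by simp)
    have hst : (s + x ::ₘ t).sum = (s + t).sum + x := by simp; ring
    rw [hst] at hsum
    obtain ⟨B, hB, hB1⟩ := ih (fun y hy => ht y (by simp [hy])) (by linarith)
    -- Averaging: if all bins were filled beyond `1 - θ`, the total size would exceed `(1 - θ) * b`.
    have : ∃ j, (B j).sum ≤ 1 - θ := by
      by_contra! hcon
      have h1 : ∑ j : Fin b, (1 - θ) < ∑ j, (B j).sum :=
        Finset.sum_lt_sum_of_nonempty ⟨⟨0, hb⟩, Finset.mem_univ _⟩ fun j _ => hcon j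
      have h2 : (s + t).sum = ∑ j, (B j).sum := by
        rw [← hB]
        exact map_sum (Multiset.sumAddMonoidHom (M := ℝ)) B Finset.univ
      simp only [Finset.sum_const, Finset.card_univ, Fintype.card_fin, nsmul_eq_mul] at h1
      linarith
    obtain ⟨j₀, hj₀⟩ := this
    refine ⟨Function.update B j₀ (x ::ₘ B j₀), ?_, fun j => ?_⟩
    · rw [Finset.sum_update_of_mem (Finset.mem_univ _), Finset.sdiff_singleton_eq_erase,
        Multiset.cons_add, Finset.add_sum_erase _ _ (Finset.mem_univ j₀), hB]
      simp
    · by_cases hj : j = j₀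
      · subst hj
        rw [Function.update_self, Multiset.sum_cons]
        linarith
      · rw [Function.update_of_ne hj]
        exact hB1 j

/-- Items of size at most `1 / p` are packed `p` to a bin. -/
theorem of_card_le {p c : ℕ} {s : Multiset ℝ} (hs : ∀ x ∈ s, x * p ≤ 1) (hp : 0 < p)
    (hc : s.card ≤ c * p) : PackableMultiset s c := by
  have hp' : (0 : ℝ) < p := by exact_mod_cast hp
  have hbin : ∀ t : Multiset ℝ, (∀ x ∈ t, x * p ≤ 1) → t.card ≤ p → t.sum ≤ 1 := by
    intro t ht htp
    have h1 : t.sum ≤ t.card • (1 / p : ℝ) :=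
      Multiset.sum_le_card_nsmul _ _ fun x hx => by rw [le_div_iff₀ hp']; exact ht x hx
    have h2 : (t.card : ℝ) ≤ p := by exact_mod_cast htp
    rw [nsmul_eq_mul, mul_one_div] at h1
    exact h1.trans ((div_le_one hp').2 h2)
  induction c generalizing s with
  | zero =>
    have : s = 0 := by simpa using hc
    rw [this]
    exact zero
  | succ c ih =>
    by_cases hsp : s.card ≤ p
    · exact (single (hbin s hs hsp)).mono (by omega)
    · obtain ⟨t, ht, htc⟩ := exists_multiset_le_card_eq (s := s) (n := p) (by omega)
      obtain ⟨u, rfl⟩ := Multiset.le_iff_exists_add.1 ht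
      rw [Multiset.card_add, htc, Nat.succ_mul] at hc
      rw [add_comm]
      exact (ih (fun x hx => hs x (by simp [hx])) (by omega)).add
        (single (hbin t (fun x hx => hs x (by simp [hx])) htc.le))

end PackableMultiset

theorem IsBPInput.packable_length {I : List ℝ} (h : IsBPInput I) : Packable I I.length := by
  rw [packable_iff]
  have := PackableMultiset.of_card_le (p := 1) (c := I.length) (s := (I : Multiset ℝ))
    (fun x hx => by simpa using (h x (by simpa using hx)).2) one_pos (by simp)
  exact this

theorem IsBPInput.packable_binOPT {I : List ℝ} (h : IsBPInput I) :
    PackableMultiset (I : Multiset ℝ) (binOPT I) :=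
  packable_iff.1 (Nat.sInf_mem (s := {m | Packable I m}) ⟨_, h.packable_length⟩)

theorem binOPT_le {I : List ℝ} {m : ℕ} (h : PackableMultiset (I : Multiset ℝ) m) :
    binOPT I ≤ m :=
  Nat.sInf_le (packable_iff.2 h)

theorem IsBPInput.sum_le_binOPT {I : List ℝ} (h : IsBPInput I) : I.sum ≤ binOPT I := by
  simpa using h.packable_binOPT.sum_le

/-- Items larger than `1 / 2` need a bin each. -/
theorem binOPT_of_half_lt {I : List ℝ} (h : ∀ x ∈ I, 1 / 2 < x ∧ x ≤ 1) :
    binOPT I = I.length := by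
  have hI : IsBPInput I := fun x hx => ⟨by linarith [(h x hx).1], (h x hx).2⟩
  refine le_antisymm (binOPT_le (packable_iff.1 hI.packable_length)) ?_
  -- Constant weight `1`: a feasible bin cannot hold two of these items.
  have := hI.packable_binOPT.weight_le (fun _ => 1) fun t ht hsum => ?_
  · have h2 : (I.length : ℝ) ≤ binOPT I := by simpa using this
    exact_mod_cast h2
  · have h1 : t.card • (1 / 2 : ℝ) ≤ t.sum :=
      Multiset.card_nsmul_le_sum fun x hx => (h x (by simpa using Multiset.mem_of_le ht hx)).1.le
    have hcard : t.card ≤ 1 := by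
      by_contra! h2
      obtain ⟨u, hu, huc⟩ := exists_multiset_le_card_eq (s := t) (n := 2) (by omega)
      obtain ⟨x, y, rfl⟩ := Multiset.card_eq_two.1 huc
      obtain ⟨v, rfl⟩ := Multiset.le_iff_exists_add.1 hu
      have hx := h x (by simpa using Multiset.mem_of_le ht (by simp))
      have hy := h y (by simpa using Multiset.mem_of_le ht (by simp))
      have hv : 0 ≤ v.sum := Multiset.sum_nonneg fun z hz => by
        have := h z (by simpa using Multiset.mem_of_le ht (by simp [hz])); linarith
      simp only [Multiset.sum_add, Multiset.insert_eq_cons, Multiset.sum_cons,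
        Multiset.sum_singleton] at hsum
      linarith
    have : (t.card : ℝ) ≤ 1 := by exact_mod_cast hcard
    simpa using this

/-! ### The rank of a query as an optimal number of bins -/

/-- The stream in which every entry is given twice. -/
def doubled (a : List ℝ) : List ℝ := a.flatMap fun x => [x, x]

theorem doubled_cons (x : ℝ) (a : List ℝ) : doubled (x :: a) = x :: x :: doubled a := rfl

theorem doubled_append (a b : List ℝ) : doubled (a ++ b) = doubled a ++ doubled b := by
  simp [doubled]

theorem length_doubled (a : List ℝ) : (doubled a).length = 2 * a.length := by
  induction a with
  | nil => rfl
  | cons x a ih => simp [doubled_cons, ih]; ring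

theorem mem_doubled {x : ℝ} {a : List ℝ} : x ∈ doubled a ↔ x ∈ a := by
  simp [doubled]

theorem streamRank_cons (x : ℝ) (a : List ℝ) (q : ℝ) :
    streamRank (x :: a) q = streamRank a q + if q < x then 1 else 0 := by
  unfold streamRank
  split_ifs with h <;> simp [h]

theorem streamRank_le_length (a : List ℝ) (q : ℝ) : streamRank a q ≤ a.length :=
  List.length_filter_le _ _

/-- Each entry brings two copies and two items `1 - q`. Up to `q` they form two bins of one copy and
one `1 - q`; above `q` the copies are alone and the two items `1 - q`, each below `1/2`, share a
third bin. Doubling ensures that left-over items come in pairs. -/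
theorem packableMultiset_doubled (a : List ℝ) (q : ℝ) (ha : ∀ x ∈ a, x ∈ Set.Ioo (1 / 2 : ℝ) (2 / 3))
    (hq : q ∈ Set.Ioo (1 / 2 : ℝ) (2 / 3)) :
    PackableMultiset ((doubled a ++ List.replicate (2 * a.length) (1 - q) : List ℝ) : Multiset ℝ)
      (2 * a.length + streamRank a q) := by
  obtain ⟨hq1, hq2⟩ := hq
  induction a with
  | nil => exact PackableMultiset.empty _
  | cons x a ih =>
    have hx := (ha x (by simp)).1
    have hx' := (ha x (by simp)).2
    have ih' := ih fun y hy => ha y (by simp [hy])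
    have hms : ((doubled (x :: a) ++ List.replicate (2 * (x :: a).length) (1 - q) : List ℝ) :
        Multiset ℝ) = ((doubled a ++ List.replicate (2 * a.length) (1 - q) : List ℝ) : Multiset ℝ)
          + {x, x, 1 - q, 1 - q} := by
      have : 2 * (x :: a).length = 2 * a.length + 1 + 1 := by simp; ring
      rw [this, List.replicate_succ, List.replicate_succ, doubled_cons]
      simp only [Multiset.insert_eq_cons, ← Multiset.coe_singleton, Multiset.cons_coe,
        Multiset.coe_add, Multiset.coe_eq_coe]
      rw [List.perm_iff_count]
      intro y
      simp only [List.count_append, List.count_cons, List.count_nil]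
      ring
    rw [hms, streamRank_cons]
    split_ifs with h
    · have h4 : PackableMultiset ({x} + {x} + {1 - q, 1 - q}) (1 + 1 + 1) := by
        refine ((PackableMultiset.single ?_).add (PackableMultiset.single ?_)).add
          (PackableMultiset.single ?_) <;> simp <;> linarith
      refine (ih'.add h4).mono ?_
      simp; omega
    · have h4 : PackableMultiset ({x, 1 - q} + {x, 1 - q}) (1 + 1) := by
        refine (PackableMultiset.single ?_).add (PackableMultiset.single ?_) <;> simp <;> linarith
      have h5 : ({x, x, 1 - q, 1 - q} : Multiset ℝ) = {x, 1 - q} + {x, 1 - q} := by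
        simp only [Multiset.insert_eq_cons, Multiset.cons_add, Multiset.singleton_add]
        rw [Multiset.cons_swap (1 - q) x]
      rw [h5]
      refine (ih'.add h4).mono ?_
      simp; omega

/-- The weights are the dual certificate for `binOPT_doubled`: with `1/2` for each of the `2N` items
`1 - q`, the total is `2N + rank`. -/
theorem weight_doubled (a : List ℝ) (q : ℝ) :
    ((doubled a).map fun x => if q < x then (1 : ℝ) else 1 / 2).sum
      = a.length + streamRank a q := by
  induction a with
  | nil => simp [doubled, streamRank]
  | cons x a ih =>
    rw [doubled_cons, streamRank_cons]
    simp only [List.map_cons, List.sum_cons, ih, List.length_cons]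
    split_ifs <;> push_cast <;> ring

/-- Two copies of each number of the stream `a`, followed by `2 N` items of size `1 - q`, need
exactly `2 N + rank q` bins. -/
theorem binOPT_doubled (a : List ℝ) (q : ℝ) (ha : ∀ x ∈ a, x ∈ Set.Ioo (1 / 2 : ℝ) (2 / 3))
    (hq : q ∈ Set.Ioo (1 / 2 : ℝ) (2 / 3)) :
    IsBPInput (doubled a ++ List.replicate (2 * a.length) (1 - q)) ∧
    binOPT (doubled a ++ List.replicate (2 * a.length) (1 - q))
      = 2 * a.length + streamRank a q := by
  have hpack := packableMultiset_doubled a q ha hq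
  obtain ⟨hq1, hq2⟩ := hq
  have hmem : ∀ x ∈ doubled a ++ List.replicate (2 * a.length) (1 - q), 1 - q ≤ x ∧ x ≤ 1 := by
    intro x hx
    rcases List.mem_append.1 hx with hx | hx
    · have := ha x (mem_doubled.1 hx)
      constructor <;> linarith [this.1, this.2]
    · rw [List.eq_of_mem_replicate hx]
      constructor <;> linarith
  have hI : IsBPInput (doubled a ++ List.replicate (2 * a.length) (1 - q)) :=
    fun x hx => ⟨by linarith [(hmem x hx).1], (hmem x hx).2⟩
  refine ⟨hI, le_antisymm (binOPT_le hpack) ?_⟩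
  have key := hI.packable_binOPT.weight_le (fun x => if q < x then (1 : ℝ) else 1 / 2) ?_
  · have h2 : (((2 * a.length + streamRank a q : ℕ)) : ℝ)
        ≤ binOPT (doubled a ++ List.replicate (2 * a.length) (1 - q)) := by
      refine le_trans (le_of_eq ?_) key
      rw [Multiset.map_coe, Multiset.sum_coe, List.map_append, List.sum_append, weight_doubled]
      rw [List.map_replicate, List.sum_replicate, if_neg (by linarith)]
      simp; ring
    exact_mod_cast h2
  · intro t ht hsum
    have ht' : ∀ x ∈ t, 1 - q ≤ x := fun x hx =>
      (hmem x (by simpa using Multiset.mem_of_le ht hx)).1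
    -- All items are at least `1 - q`. So an item above `q` is alone in its bin, and in any case
    -- three items need `3 * (1 - q) > 1`, because `q < 2/3`.
    by_cases hbig : ∃ x ∈ t, q < x
    · obtain ⟨x, hx, hqx⟩ := hbig
      obtain ⟨u, rfl⟩ := Multiset.exists_cons_of_mem hx
      have hu : u = 0 := by
        by_contra hu
        obtain ⟨y, hy⟩ := Multiset.exists_mem_of_ne_zero hu
        obtain ⟨v, rfl⟩ := Multiset.exists_cons_of_mem hy
        have := ht' y (by simp)
        have hv : 0 ≤ v.sum := Multiset.sum_nonneg fun z hz => by
          have := ht' z (by simp [hz]); linarith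
        simp only [Multiset.sum_cons] at hsum
        linarith
      subst hu
      simp [hqx]
    · push Not at hbig
      have h1 : t.card • (1 - q) ≤ t.sum := Multiset.card_nsmul_le_sum fun x hx => ht' x hx
      have hcard : (t.card : ℝ) < 3 := by
        rw [nsmul_eq_mul] at h1
        by_contra! h3
        nlinarith
      have hcard' : t.card ≤ 2 := by
        have : t.card < 3 := by exact_mod_cast hcard
        omega
      have h2 : t.map (fun x => if q < x then (1 : ℝ) else 1 / 2) = t.map fun _ => (1 / 2 : ℝ) :=
        Multiset.map_congr rfl fun x hx => by rw [if_neg (not_lt.2 (hbig x hx))]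
      rw [h2, Multiset.map_const', Multiset.sum_replicate, nsmul_eq_mul]
      have : (t.card : ℝ) ≤ 2 := by exact_mod_cast hcard'
      linarith

theorem scaleTo_mem {l u x : ℝ} (hx : x ∈ Set.Ioo l u) :
    scaleTo l u x ∈ Set.Ioo (1 / 2 : ℝ) (2 / 3) := by
  obtain ⟨h1, h2⟩ := hx
  have h3 : 0 < 6 * (u - l) := by linarith
  unfold scaleTo
  have h4 : 0 < (x - l) / (6 * (u - l)) := div_pos (by linarith) h3
  have h5 : (x - l) / (6 * (u - l)) < 1 / 6 := by
    rw [div_lt_iff₀ h3]; linarith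
  constructor <;> linarith

theorem scaleTo_lt {l u x y : ℝ} (h : l < u) : scaleTo l u x < scaleTo l u y ↔ x < y := by
  have h3 : 0 < 6 * (u - l) := by linarith
  unfold scaleTo
  rw [add_lt_add_iff_left, div_lt_div_iff_of_pos_right h3, sub_lt_sub_iff_right]

theorem streamRank_map {φ : ℝ → ℝ} {a : List ℝ} {q q' : ℝ}
    (h : ∀ x ∈ a, q' < φ x ↔ q < x) : streamRank (a.map φ) q' = streamRank a q := by
  induction a with
  | nil => rfl
  | cons x a ih =>
    rw [List.map_cons, streamRank_cons, streamRank_cons, ih fun y hy => h y (by simp [hy])]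
    simp [h x (by simp)]

theorem rankSummary_run {σ : Type} (A : StreamAlg σ) (l u : ℝ) (a : List ℝ) :
    (A.rankSummary l u).run a =
      (A.run (a.flatMap fun x => [scaleTo l u x, scaleTo l u x]), a.length) := by
  induction a using List.reverseRecOn with
  | nil => rfl
  | append_singleton a x ih =>
    unfold RankSummary.run at ih ⊢
    rw [List.foldl_append, ih]
    simp [StreamAlg.rankSummary, StreamAlg.run, List.foldl_append]

/-- The answers of the algorithm after the doubled stream and a query. -/
theorem StreamAlg.output_doubled_bounds {σ : Type} (A : StreamAlg σ) {ε : ℝ} {f : ℕ → ℝ}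
    (hA : ∀ I : List ℝ, IsBPInput I → binOPT I ≤ A.output (A.run I) ∧
      (A.output (A.run I) : ℝ) ≤ (1 + ε) * (binOPT I : ℝ) + f (binOPT I))
    (a : List ℝ) (q : ℝ) (ha : ∀ x ∈ a, x ∈ Set.Ioo (1 / 2 : ℝ) (2 / 3))
    (hq : q ∈ Set.Ioo (1 / 2 : ℝ) (2 / 3)) (hε : 0 < ε) {N₁ : ℕ} {δ : ℝ} (hδ : 0 ≤ δ)
    (hf : ∀ n ≥ N₁, |f n| ≤ δ * n) (hN : N₁ ≤ a.length) :
    (2 * a.length + streamRank a q : ℝ)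
        ≤ A.output (A.run (doubled a ++ List.replicate (2 * a.length) (1 - q))) ∧
      (A.output (A.run (doubled a ++ List.replicate (2 * a.length) (1 - q))) : ℝ)
        ≤ 2 * a.length + streamRank a q + 3 * (ε + δ) * a.length := by
  obtain ⟨hI, hopt⟩ := binOPT_doubled a q ha hq
  obtain ⟨h1, h2⟩ := hA _ hI
  rw [hopt] at h1 h2
  -- The optimum is between `2N` and `3N`: large enough for `hf`, and small enough for a relative
  -- error `ε + δ` to cost at most `3 * (ε + δ) * N`.
  have h3 := hf (2 * a.length + streamRank a q) (by omega)
  have h4 := (abs_le.1 h3).2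
  have h5 : (streamRank a q : ℝ) ≤ a.length := by exact_mod_cast streamRank_le_length a q
  constructor
  · exact_mod_cast h1
  · push_cast at h2 h4
    nlinarith

theorem exists_eventually_bound {f : ℕ → ℝ} (hf : f =o[atTop] (fun n : ℕ => (n : ℝ))) {δ : ℝ}
    (hδ : 0 < δ) : ∃ N₁ : ℕ, ∀ n ≥ N₁, |f n| ≤ δ * n := by
  have := (isLittleO_iff.1 hf) hδ
  rw [eventually_atTop] at this
  obtain ⟨N, hN⟩ := this
  refine ⟨N, fun n hn => ?_⟩
  have := hN n hn
  simpa [Real.norm_eq_abs] using this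

theorem StreamAlg.rankSummary_isApprox {σ : Type} (A : StreamAlg σ) {ε : ℝ} (hε : 0 < ε)
    (hA : A.IsAsymptoticApprox (1 + ε)) {l u : ℝ} (hlu : l < u) :
    (A.rankSummary l u).IsApprox (Set.Ioo l u) (4 * ε) := by
  obtain ⟨f, hf, hA⟩ := hA
  -- `δ = ε / 3` turns `3 * (ε + δ)` into `4 * ε`.
  obtain ⟨N₁, hN₁⟩ := exists_eventually_bound hf (δ := ε / 3) (by positivity)
  refine ⟨N₁, fun a hN ha q hq => ?_⟩
  have hb := A.output_doubled_bounds hA (a.map (scaleTo l u)) (scaleTo l u q)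
    (fun x hx => by
      obtain ⟨y, hy, rfl⟩ := List.mem_map.1 hx
      exact scaleTo_mem (ha y hy))
    (scaleTo_mem hq) hε (by positivity) hN₁ (by simpa using hN)
  rw [streamRank_map (q := q) (fun x _ => scaleTo_lt hlu), List.length_map] at hb
  have hrun : A.output (A.run (doubled (a.map (scaleTo l u)) ++
      List.replicate (2 * a.length) (1 - scaleTo l u q))) =
      A.output ((List.replicate (2 * a.length) (1 - scaleTo l u q)).foldl A.step
        (A.run (a.flatMap fun x => [scaleTo l u x, scaleTo l u x]))) := by
    have hd : doubled (a.map (scaleTo l u)) = a.flatMap fun x => [scaleTo l u x, scaleTo l u x] := by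
      simp [doubled, List.flatMap_map]
    rw [hd]
    unfold StreamAlg.run
    rw [List.foldl_append]
  rw [hrun] at hb
  rw [rankSummary_run]
  unfold StreamAlg.rankSummary
  dsimp only
  push_cast
  rw [abs_le]
  have : (0 : ℝ) ≤ ε * a.length := by positivity
  constructor <;> nlinarith [hb.1, hb.2]

/-! ### The adversary: two streams that look the same -/

/-- `p` is strictly below `q` in both coordinates. -/
def PairLT (p q : ℝ × ℝ) : Prop := p.1 < q.1 ∧ p.2 < q.2

theorem PairLT.le {p q : ℝ × ℝ} (h : PairLT p q) : p ≤ q := ⟨h.1.le, h.2.le⟩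

theorem PairLT.trans_le {p q r : ℝ × ℝ} (h : PairLT p q) (h' : q ≤ r) : PairLT p r :=
  ⟨h.1.trans_le h'.1, h.2.trans_le h'.2⟩

theorem PairLT.of_le {p q r : ℝ × ℝ} (h : p ≤ q) (h' : PairLT q r) : PairLT p r :=
  ⟨h.1.trans_lt h'.1, h.2.trans_lt h'.2⟩

theorem PairLT.irrefl {p : ℝ × ℝ} (h : PairLT p p) : False := lt_irrefl _ h.1

/-- Any two elements of `S` are ordered in the same way by both coordinates. -/
def IsPairChain (S : Finset (ℝ × ℝ)) : Prop :=
  ∀ m ∈ S, ∀ m' ∈ S, m = m' ∨ PairLT m m' ∨ PairLT m' m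

/-- A deterministic machine reading pairs and storing some of them: two streams that are processed
in parallel and have to look the same to the machine. -/
structure PairMachine (σ : Type) where
  step : σ → ℝ × ℝ → σ
  mem : σ → Finset (ℝ × ℝ)
  mem_step : ∀ s e, mem (step s e) ⊆ insert e (mem s)

/-- The number of first coordinates that are at most `p.1`. -/
noncomputable def rankLe (L : List (ℝ × ℝ)) (p : ℝ × ℝ) : ℕ := L.countP fun e => e.1 ≤ p.1

/-- The number of second coordinates that are less than `q.2`. -/
noncomputable def rankLt (L : List (ℝ × ℝ)) (q : ℝ × ℝ) : ℕ := L.countP fun e => e.2 < q.2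

theorem rankLe_append (L L' : List (ℝ × ℝ)) (p : ℝ × ℝ) :
    rankLe (L ++ L') p = rankLe L p + rankLe L' p := List.countP_append

theorem rankLt_append (L L' : List (ℝ × ℝ)) (p : ℝ × ℝ) :
    rankLt (L ++ L') p = rankLt L p + rankLt L' p := List.countP_append

theorem rankLe_le_length (L : List (ℝ × ℝ)) (p : ℝ × ℝ) : rankLe L p ≤ L.length :=
  List.countP_le_length

theorem rankLt_le_length (L : List (ℝ × ℝ)) (p : ℝ × ℝ) : rankLt L p ≤ L.length :=
  List.countP_le_length

theorem rankLe_mono {L : List (ℝ × ℝ)} {p q : ℝ × ℝ} (h : ∀ e ∈ L, e.1 ≤ p.1 → e.1 ≤ q.1) :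
    rankLe L p ≤ rankLe L q :=
  List.countP_mono_left fun e he => by simpa using h e he

theorem rankLt_mono {L : List (ℝ × ℝ)} {p q : ℝ × ℝ} (h : ∀ e ∈ L, e.2 < p.2 → e.2 < q.2) :
    rankLt L p ≤ rankLt L q :=
  List.countP_mono_left fun e he => by simpa using h e he

theorem rankLe_eq_zero {L : List (ℝ × ℝ)} {p : ℝ × ℝ} (h : ∀ e ∈ L, p.1 < e.1) :
    rankLe L p = 0 :=
  List.countP_eq_zero.2 fun e he => by simpa using h e he

theorem rankLt_eq_length {L : List (ℝ × ℝ)} {p : ℝ × ℝ} (h : ∀ e ∈ L, e.2 < p.2) :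
    rankLt L p = L.length :=
  List.countP_eq_length.2 fun e he => by simpa using h e he

/-- The points `p` and `q` separate the stored pairs `T`, and in between the first stream has at
least `g` more numbers than the second one. -/
def HasGap (T : Finset (ℝ × ℝ)) (L : List (ℝ × ℝ)) (a b : ℝ × ℝ) (g : ℕ) : Prop :=
  ∃ p q, a ≤ p ∧ q ≤ b ∧ PairLT p q ∧ (∀ w ∈ T, w ≤ p ∨ q ≤ w) ∧ rankLe L p + g ≤ rankLt L q

/-- The covering argument needs the largest gap: its maximality bounds the drift between all
neighbouring stored pairs at once. -/
theorem HasGap.exists_max {T : Finset (ℝ × ℝ)} {L : List (ℝ × ℝ)} {a b : ℝ × ℝ} {g : ℕ}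
    (h : HasGap T L a b g) : ∃ g', g ≤ g' ∧ HasGap T L a b g' ∧ ∀ i, HasGap T L a b i → i ≤ g' := by
  have hbdd : BddAbove {i | HasGap T L a b i} := by
    refine ⟨L.length, ?_⟩
    rintro i ⟨p, q, -, -, -, -, h⟩
    have := rankLt_le_length L q
    omega
  exact ⟨sSup {i | HasGap T L a b i}, le_csSup hbdd h, Nat.sSup_mem ⟨g, h⟩ hbdd,
    fun i hi => le_csSup hbdd hi⟩

-- The pairs in `T` cut the range from `a` to `b` into `T.card + 1` intervals. Each contributes at
-- most `g`, with another `g` where `β` jumps from `0` to `1`, and passing a pair costs one more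
-- since `B` may exceed `A` by one.
open Classical in
theorem chain_cover {T : Finset (ℝ × ℝ)} (hT : IsPairChain T) {a b : ℝ × ℝ} (hab : PairLT a b)
    (hin : ∀ w ∈ T, PairLT a w ∧ PairLT w b) (A B β : ℝ × ℝ → ℕ) (g : ℕ) (ha : B a = 0)
    (hβ : β a = 0) (hAB : ∀ w ∈ T, B w ≤ A w + 1)
    (hstep : ∀ P w, (P = a ∨ P ∈ T) → (w = b ∨ w ∈ T) → PairLT P w →
      (∀ w' ∈ T, w' ≤ P ∨ w ≤ w') → A w + g * β P ≤ B P + g + g * β w) :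
    A b ≤ (T.card + 1 + β b) * g + T.card := by
  have hcmp : ∀ w, (w = b ∨ w ∈ T) → ∀ w' ∈ T, PairLT w' w ∨ w ≤ w' := by
    rintro w (rfl | hw) w' hw'
    · exact Or.inl (hin w' hw').2
    · rcases hT w hw w' hw' with rfl | h | h
      · exact Or.inr le_rfl
      · exact Or.inr h.le
      · exact Or.inl h
  have key : ∀ n, ∀ w, (w = b ∨ w ∈ T) → (T.filter (PairLT · w)).card = n →
      A w ≤ (n + 1 + β w) * g + n := by
    intro n
    induction n using Nat.strong_induction_on with
    | _ n ih =>
      intro w hw hn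
      rcases (T.filter (PairLT · w)).eq_empty_or_nonempty with he | hne
      · have haw : PairLT a w := by
          rcases hw with rfl | hw
          · exact hab
          · exact (hin w hw).1
        have h1 := hstep a w (Or.inl rfl) hw haw fun w' hw' => by
          rcases hcmp w hw w' hw' with h | h
          · have : w' ∈ T.filter (PairLT · w) := by simp [hw', h]
            rw [he] at this
            simp at this
          · exact Or.inr h
        rw [ha, hβ] at h1
        nlinarith
      · obtain ⟨P, hP, hmax⟩ := Finset.exists_max_image _ Prod.fst hne
        rw [Finset.mem_filter] at hP
        have hlt : (T.filter (PairLT · P)).card < n := by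
          rw [← hn]
          refine Finset.card_lt_card ⟨fun x hx => ?_, fun hsub => ?_⟩
          · rw [Finset.mem_filter] at hx ⊢
            exact ⟨hx.1, hx.2.trans_le hP.2.le⟩
          · have := hsub (Finset.mem_filter.2 hP)
            exact (Finset.mem_filter.1 this).2.irrefl
        have h2 := ih _ hlt P (Or.inr hP.1) rfl
        have h1 := hstep P w (Or.inr hP.1) hw hP.2 fun w' hw' => by
          rcases hcmp w hw w' hw' with h | h
          · have h3 := hmax w' (by simp [hw', h])
            rcases hT w' hw' P hP.1 with rfl | h4 | h4
            · exact Or.inl le_rfl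
            · exact Or.inl h4.le
            · exact absurd h4.1 (not_lt.2 h3)
          · exact Or.inr h
        have h3 := hAB P hP.1
        set c := (T.filter (PairLT · P)).card
        have hc : c + 1 ≤ n := hlt
        have : A w ≤ (c + 2 + β w) * g + (c + 1) := by nlinarith
        nlinarith
  refine (key _ b (Or.inl rfl) rfl).trans ?_
  have : (T.filter (PairLT · b)).card ≤ T.card := Finset.card_filter_le _ _
  nlinarith

namespace PairMachine

variable {σ : Type} (M : PairMachine σ)

def run (s : σ) (L : List (ℝ × ℝ)) : σ := L.foldl M.step s

theorem run_append (s : σ) (L L' : List (ℝ × ℝ)) :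
    M.run s (L ++ L') = M.run (M.run s L) L' := List.foldl_append

/-- Every arriving pair is ordered with respect to the stored ones in the same way by both
coordinates. -/
def Consistent : σ → List (ℝ × ℝ) → Prop
  | _, [] => True
  | s, e :: L => (∀ m ∈ M.mem s, PairLT e m ∨ PairLT m e) ∧ Consistent (M.step s e) L

theorem consistent_append (s : σ) (L L' : List (ℝ × ℝ)) :
    M.Consistent s (L ++ L') ↔ M.Consistent s L ∧ M.Consistent (M.run s L) L' := by
  induction L generalizing s with
  | nil => simp [Consistent, run]
  | cons e L ih => simp [Consistent, run, ih, and_assoc]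

theorem mem_run {s : σ} {L : List (ℝ × ℝ)} {m : ℝ × ℝ} (h : m ∈ M.mem (M.run s L)) :
    m ∈ M.mem s ∨ m ∈ L := by
  induction L generalizing s with
  | nil => exact Or.inl h
  | cons e L ih =>
    rcases ih h with h | h
    · rcases Finset.mem_insert.1 (M.mem_step s e h) with rfl | h
      · simp
      · exact Or.inl h
    · simp [h]

theorem isPairChain_run {s : σ} {L : List (ℝ × ℝ)} (hs : IsPairChain (M.mem s))
    (hL : M.Consistent s L) : IsPairChain (M.mem (M.run s L)) := by
  induction L generalizing s with
  | nil => exact hs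
  | cons e L ih =>
    refine ih (s := M.step s e) ?_ hL.2
    intro m hm m' hm'
    rcases Finset.mem_insert.1 (M.mem_step s e hm) with rfl | h <;>
      rcases Finset.mem_insert.1 (M.mem_step s _ hm') with rfl | h'
    · exact Or.inl rfl
    · exact Or.inr (hL.1 m' h')
    · exact Or.inr (hL.1 m h).symm
    · exact hs m h m' h'

/-- The stored pairs that belong to `L`. -/
noncomputable def stored (s : σ) (L : List (ℝ × ℝ)) : Finset (ℝ × ℝ) :=
  (M.mem s).filter (· ∈ L)

theorem mem_stored {s : σ} {L : List (ℝ × ℝ)} {m : ℝ × ℝ} :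
    m ∈ M.stored s L ↔ m ∈ M.mem s ∧ m ∈ L := Finset.mem_filter

/-- What the adversary achieves with `n₀ * 2 ^ k` pairs in the box `(a, b)`. -/
structure AdversaryRun (n₀ k : ℕ) (s : σ) (a b : ℝ × ℝ) (L : List (ℝ × ℝ)) (g : ℕ) : Prop where
  length_eq : L.length = n₀ * 2 ^ k
  inside : ∀ e ∈ L, PairLT a e ∧ PairLT e b
  consistent : M.Consistent s L
  rank_le : ∀ w ∈ M.stored (M.run s L) L, rankLe L w ≤ rankLt L w + 1
  gap : HasGap (M.stored (M.run s L) L) L a b g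
  space : ∃ pre, pre <+: L ∧
    (k : ℝ) * ((n₀ * 2 ^ k : ℝ) / (4 * (g + 2 ^ k)) - 1) ≤ ((M.stored (M.run s pre) L).card : ℝ)

/-- The machine has stored nothing inside the box `(a, b)`. -/
structure Ready (s : σ) (a b : ℝ × ℝ) : Prop where
  lt : PairLT a b
  chain : IsPairChain (M.mem s)
  outside : ∀ m ∈ M.mem s, m ≤ a ∨ b ≤ m

end PairMachine

theorem exists_prev (S : List ℝ) {c d : ℝ} (h : c < d) :
    ∃ y, c ≤ y ∧ y < d ∧ ∀ z ∈ S, z < d → z ≤ y := by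
  induction S with
  | nil => exact ⟨c, le_rfl, h, by simp⟩
  | cons x S ih =>
    obtain ⟨y, h1, h2, h3⟩ := ih
    by_cases hx : x < d
    · refine ⟨max x y, le_max_of_le_right h1, max_lt hx h2, fun z hz hzd => ?_⟩
      rcases List.mem_cons.1 hz with rfl | hz
      · exact le_max_left _ _
      · exact le_max_of_le_right (h3 z hz hzd)
    · refine ⟨y, h1, h2, fun z hz hzd => ?_⟩
      rcases List.mem_cons.1 hz with rfl | hz
      · exact absurd hzd hx
      · exact h3 z hz hzd

theorem exists_next (S : List ℝ) {c d : ℝ} (h : c < d) :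
    ∃ x, c < x ∧ x ≤ d ∧ ∀ z ∈ S, c < z → x ≤ z := by
  induction S with
  | nil => exact ⟨d, h, le_rfl, by simp⟩
  | cons x S ih =>
    obtain ⟨y, h1, h2, h3⟩ := ih
    by_cases hx : c < x
    · refine ⟨min x y, lt_min hx h1, min_le_of_right_le h2, fun z hz hzd => ?_⟩
      rcases List.mem_cons.1 hz with rfl | hz
      · exact min_le_left _ _
      · exact min_le_of_right_le (h3 z hz hzd)
    · refine ⟨y, h1, h2, fun z hz hzd => ?_⟩
      rcases List.mem_cons.1 hz with rfl | hz
      · exact absurd hzd hx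
      · exact h3 z hz hzd

/-- The induction step of the space bound; `N` and `t` double. With `X = N / (g + 2 * t)`, convexity
of the reciprocal gives `N / (4 * (g₁ + t)) + N / (4 * (g₂ + t)) ≥ X`, and `hr` gives `r ≥ X - 2`.
Hence `c₁` and `c₂ + r` add up to at least `(k + 1) * (X - 2)`, and one of them reaches half of
that. -/
theorem space_combine {k N t g₁ g₂ g r c₁ c₂ : ℝ} (hk : 0 ≤ k) (hN : 0 ≤ N) (ht : 1 ≤ t)
    (hg₁ : 0 ≤ g₁) (hg₂ : 0 ≤ g₂) (hg : g₁ + g₂ ≤ g) (h₁ : k * (N / (4 * (g₁ + t)) - 1) ≤ c₁)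
    (h₂ : k * (N / (4 * (g₂ + t)) - 1) ≤ c₂) (hr : N ≤ (r + 2) * g + r) (hr0 : 0 ≤ r) :
    (k + 1) * (2 * N / (4 * (g + 2 * t)) - 1) ≤ c₁ ∨
      (k + 1) * (2 * N / (4 * (g + 2 * t)) - 1) ≤ c₂ + r := by
  have hG : 0 < g + 2 * t := by linarith
  have hA : 0 < g₁ + t := by linarith
  have hB : 0 < g₂ + t := by linarith
  have e1 : N / (4 * (g₁ + t)) + N / (4 * (g₂ + t)) ≥ N / (g + 2 * t) := by
    rw [ge_iff_le, div_add_div _ _ (by positivity) (by positivity),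
      div_le_div_iff₀ hG (by positivity)]
    have : 16 * (g₁ + t) * (g₂ + t) ≤ 4 * (g + 2 * t) * ((g₁ + t) + (g₂ + t)) := by
      have h5 : 4 * ((g₁ + t) + (g₂ + t)) * ((g₁ + t) + (g₂ + t))
          ≤ 4 * (g + 2 * t) * ((g₁ + t) + (g₂ + t)) :=
        mul_le_mul_of_nonneg_right (by linarith) (by linarith)
      nlinarith [sq_nonneg (g₁ - g₂)]
    nlinarith [mul_le_mul_of_nonneg_left this hN]
  have e2 : N / (g + 2 * t) - 2 ≤ r := by
    rw [sub_le_iff_le_add, div_le_iff₀ hG]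
    nlinarith
  have e3 : 2 * N / (4 * (g + 2 * t)) = (N / (g + 2 * t)) / 2 := by
    field_simp
    ring
  rw [e3]
  set X := N / (g + 2 * t)
  have e4 : k * X ≤ k * (N / (4 * (g₁ + t)) + N / (4 * (g₂ + t))) :=
    mul_le_mul_of_nonneg_left e1 hk
  by_contra! hcon
  nlinarith [hcon.1, hcon.2]

namespace PairMachine

variable {σ : Type} {M : PairMachine σ}

/-- The second box is put into the largest gap left by the first part of the stream. -/
theorem Ready.adversaryRun_combine {n₀ k : ℕ} {s : σ} {a b : ℝ × ℝ} (hs : M.Ready s a b)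
    {L₁ : List (ℝ × ℝ)} {g₁ : ℕ} (h₁ : M.AdversaryRun n₀ k s a b L₁ g₁)
    {p q : ℝ × ℝ} (hap : a ≤ p) (hqb : q ≤ b) (hpq : PairLT p q)
    (hsep : ∀ w ∈ M.stored (M.run s L₁) L₁, w ≤ p ∨ q ≤ w)
    (hgap : rankLe L₁ p + g₁ ≤ rankLt L₁ q)
    {x₀ y₀ : ℝ} (hx : p.1 < x₀) (hxq : x₀ ≤ q.1) (hx₀ : ∀ e ∈ L₁, p.1 < e.1 → x₀ ≤ e.1)
    (hy : p.2 ≤ y₀) (hyq : y₀ < q.2) (hy₀ : ∀ e ∈ L₁, e.2 < q.2 → e.2 ≤ y₀)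
    {L₂ : List (ℝ × ℝ)} {g₂ : ℕ}
    (h₂ : M.AdversaryRun n₀ k (M.run s L₁) (p.1, y₀) (x₀, q.2) L₂ g₂) :
    ∃ g, M.AdversaryRun n₀ (k + 1) s a b (L₁ ++ L₂) g := by
  have hpa : p ≤ (p.1, y₀) := ⟨le_rfl, hy⟩
  have hbq : ((x₀, q.2) : ℝ × ℝ) ≤ q := ⟨hxq, le_rfl⟩
  have hin₁ := h₁.inside
  have hin₂ := h₂.inside
  -- In the first stream the second part lies strictly between `p` and the next item of `L₁`.
  have hnot : ∀ e ∈ L₁, e ∉ L₂ := fun e he he' =>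
    absurd (hx₀ e he (hin₂ e he').1.1) (not_le.2 (hin₂ e he').2.1)
  -- the stored pairs of the first part after both parts
  have hT₁ : ∀ w ∈ M.mem (M.run (M.run s L₁) L₂), w ∈ L₁ → w ∈ M.stored (M.run s L₁) L₁ :=
    fun w hw hw₁ => M.mem_stored.2
      ⟨(M.mem_run hw).resolve_right (hnot w hw₁), hw₁⟩
  have hchain : IsPairChain (M.mem (M.run (M.run s L₁) L₂)) :=
    M.isPairChain_run (M.isPairChain_run hs.chain h₁.consistent) h₂.consistent
  -- ranks with respect to the two parts
  have hLt₁ : ∀ v : ℝ × ℝ, y₀ < v.2 → rankLt L₁ q ≤ rankLt L₁ v := fun v hv =>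
    rankLt_mono fun e he h => (hy₀ e he h).trans_lt hv
  have hLe₁ : ∀ v : ℝ × ℝ, v.1 < x₀ → rankLe L₁ v ≤ rankLe L₁ p := fun v hv =>
    rankLe_mono fun e he h => by
      by_contra! h'
      exact absurd (hx₀ e he h') (not_le.2 (h.trans_lt hv))
  have hLe₂ : ∀ v : ℝ × ℝ, v ≤ p → rankLe L₂ v = 0 := fun v hv =>
    rankLe_eq_zero fun e he => hv.1.trans_lt (hin₂ e he).1.1
  have hLt₂ : ∀ v : ℝ × ℝ, q ≤ v → rankLt L₂ v = L₂.length := fun v hv =>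
    rankLt_eq_length fun e he => (hin₂ e he).2.2.trans_le hv.2
  -- Seen from the second box, the first stream has no items of `L₁` below beyond those up to `p`,
  -- while the second has all those below `q`. So `g₁` adds to the gap of the second part.
  have hgap₁₂ : ∃ g, g₁ + g₂ ≤ g ∧
      HasGap (M.stored (M.run (M.run s L₁) L₂) (L₁ ++ L₂)) (L₁ ++ L₂) a b g ∧
      ∀ i, HasGap (M.stored (M.run (M.run s L₁) L₂) (L₁ ++ L₂)) (L₁ ++ L₂) a b i → i ≤ g := by
    refine HasGap.exists_max ?_
    obtain ⟨p₂, q₂, hap₂, hqb₂, hpq₂, hsep₂, hgap₂⟩ := h₂.gap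
    refine ⟨p₂, q₂, hap.trans (hpa.trans hap₂), hqb₂.trans (hbq.trans hqb), hpq₂,
      fun w hw => ?_, ?_⟩
    · obtain ⟨hw, hw'⟩ := M.mem_stored.1 hw
      rcases List.mem_append.1 hw' with hw₁ | hw₂
      · rcases hsep w (hT₁ w hw hw₁) with h | h
        · exact Or.inl (h.trans (hpa.trans hap₂))
        · exact Or.inr (hqb₂.trans (hbq.trans h))
      · exact hsep₂ w (M.mem_stored.2 ⟨hw, hw₂⟩)
    · have e1 := hLt₁ q₂ (hap₂.2.trans_lt hpq₂.2)
      have e2 := hLe₁ p₂ (hpq₂.1.trans_le hqb₂.1)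
      rw [rankLe_append, rankLt_append]
      omega
  obtain ⟨g, hg, hgapg, hmaxg⟩ := hgap₁₂
  have hrank : ∀ w ∈ M.stored (M.run (M.run s L₁) L₂) (L₁ ++ L₂),
      rankLe (L₁ ++ L₂) w ≤ rankLt (L₁ ++ L₂) w + 1 := by
    intro w hw
    obtain ⟨hw, hw'⟩ := M.mem_stored.1 hw
    rw [rankLe_append, rankLt_append]
    rcases List.mem_append.1 hw' with hw₁ | hw₂
    · have e1 := h₁.rank_le w (hT₁ w hw hw₁)
      rcases hsep w (hT₁ w hw hw₁) with h | h
      · rw [hLe₂ w h]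
        omega
      · rw [hLt₂ w h]
        have := rankLe_le_length L₂ w
        omega
    · have e1 := h₂.rank_le w (M.mem_stored.2 ⟨hw, hw₂⟩)
      have e2 := hLt₁ w (hin₂ w hw₂).1.2
      have e3 := hLe₁ w (hin₂ w hw₂).2.1
      omega
  -- how many pairs of the first part are stored to the end
  have hcover : L₁.length ≤ ((M.stored (M.run (M.run s L₁) L₂) L₁).card + 2) * g
      + (M.stored (M.run (M.run s L₁) L₂) L₁).card := by
    classical
    set T := M.stored (M.run (M.run s L₁) L₂) L₁ with hTdef
    have hT : ∀ w ∈ T, w ∈ M.stored (M.run s L₁) L₁ := fun w hw =>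
      hT₁ w (M.mem_stored.1 hw).1 (M.mem_stored.1 hw).2
    have hTin : ∀ w ∈ T, PairLT a w ∧ PairLT w b := fun w hw => hin₁ w (M.mem_stored.1 hw).2
    have hnotqa : ¬ q ≤ a := fun h => (hpq.trans_le (h.trans hap)).irrefl
    have hcase : ∀ w, (w = a ∨ w ∈ T) → w ≤ p ∨ q ≤ w := by
      rintro w (rfl | hw)
      · exact Or.inl hap
      · exact hsep w (hT w hw)
    have hcase' : ∀ w, (w = b ∨ w ∈ T) → w ≤ p ∨ q ≤ w := by
      rintro w (rfl | hw)
      · exact Or.inr hqb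
      · exact hsep w (hT w hw)
    have hale : ∀ w, (w = a ∨ w ∈ T) → a ≤ w := by
      rintro w (rfl | hw)
      · exact le_rfl
      · exact (hTin w hw).1.le
    have hleb : ∀ w, (w = b ∨ w ∈ T) → w ≤ b := by
      rintro w (rfl | hw)
      · exact le_rfl
      · exact (hTin w hw).2.le
    have hsepT : ∀ u v, (∀ w ∈ T, w ≤ u ∨ v ≤ w) → (∀ e ∈ L₂, e ≤ u ∨ v ≤ e) →
        ∀ w ∈ M.stored (M.run (M.run s L₁) L₂) (L₁ ++ L₂), w ≤ u ∨ v ≤ w := by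
      intro u v h h' w hw
      obtain ⟨hw, hw'⟩ := M.mem_stored.1 hw
      rcases List.mem_append.1 hw' with hw₁ | hw₂
      · exact h w (M.mem_stored.2 ⟨hw, hw₁⟩)
      · exact h' w hw₂
    -- Maximality of `g`, for endpoints with nothing of `T` or `L₂` in between.
    have hbound : ∀ u v, a ≤ u → v ≤ b → PairLT u v → (∀ w ∈ T, w ≤ u ∨ v ≤ w) →
        (∀ e ∈ L₂, e ≤ u ∨ v ≤ e) →
        rankLt L₁ v + rankLt L₂ v ≤ rankLe L₁ u + rankLe L₂ u + g := by
      intro u v hu hv huv h h'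
      rw [← rankLe_append, ← rankLt_append]
      by_contra! hcon
      have := hmaxg (rankLt (L₁ ++ L₂) v - rankLe (L₁ ++ L₂) u)
        ⟨u, v, hu, hv, huv, hsepT u v h h', by omega⟩
      omega
    -- `β` marks the pairs from `q` on. It jumps only across the interval that contains the second
    -- part, hence the `2` in `card + 2`.
    have hmain := chain_cover (T := T) (a := a) (b := b)
      (fun m hm m' hm' => hchain m (M.mem_stored.1 hm).1 m' (M.mem_stored.1 hm').1) hs.lt hTin
      (rankLt L₁) (rankLe L₁) (fun w => if q ≤ w then 1 else 0) g
      (rankLe_eq_zero fun e he => (hin₁ e he).1.1) (if_neg hnotqa)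
      (fun w hw => h₁.rank_le w (hT w hw)) ?_
    · rw [rankLt_eq_length fun e he => (hin₁ e he).2.2, if_pos hqb] at hmain
      exact hmain
    · intro P w hP hw hPw hPsep
      have haP := hale P hP
      have hwb := hleb w hw
      rcases hcase' w hw with hwp | hqw
      · have h3 : ¬ q ≤ P := fun h => (hpq.trans_le (h.trans (hPw.le.trans hwp))).irrefl
        have h4 : ¬ q ≤ w := fun h => (hpq.trans_le (h.trans hwp)).irrefl
        have h5 := hbound P w haP hwb hPw hPsep fun e he =>
          Or.inr (hwp.trans (hpa.trans (hin₂ e he).1.le))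
        have h6 := hLe₂ P (hPw.le.trans hwp)
        simp only [h3, h4, if_false]
        omega
      · simp only [hqw, if_true]
        rcases hcase P hP with hPp | hqP
        · have h3 : ¬ q ≤ P := fun h => (hpq.trans_le (h.trans hPp)).irrefl
          simp only [h3, if_false]
          -- The interval from `P` to `w` contains all of `L₂`, some of which may be stored. It is
          -- replaced by two gaps, from `P` up to `(u₁, u₂)` below `L₂` and from `(v₁, v₂)` above
          -- `L₂` up to `w`; `hgap` links them, since the rank at `p` is at most the rank at `q`.
          obtain ⟨u₁, hu₁, hu₁', hu₁L⟩ := exists_next (L₂.map Prod.fst) hx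
          obtain ⟨u₂, hu₂, hu₂', hu₂L⟩ := exists_next (L₂.map Prod.snd) hyq
          obtain ⟨v₁, hv₁, hv₁', hv₁L⟩ := exists_prev (L₂.map Prod.fst) hx
          obtain ⟨v₂, hv₂, hv₂', hv₂L⟩ := exists_prev (L₂.map Prod.snd) hyq
          have hu : ((u₁, u₂) : ℝ × ℝ) ≤ q := ⟨hu₁'.trans hxq, hu₂'⟩
          have hv : p ≤ ((v₁, v₂) : ℝ × ℝ) := ⟨hv₁, hy.trans hv₂⟩
          have b1 := hbound P (u₁, u₂) haP (hu.trans hqb)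
            ⟨hPp.1.trans_lt hu₁, hPp.2.trans_lt (hy.trans_lt hu₂)⟩
            (fun w' hw' => (hPsep w' hw').imp id fun h => hu.trans (hqw.trans h))
            (fun e he => Or.inr ⟨hu₁L _ (List.mem_map_of_mem he) (hin₂ e he).1.1,
              hu₂L _ (List.mem_map_of_mem he) (hin₂ e he).1.2⟩)
          have b2 := hbound (v₁, v₂) w (hap.trans hv) hwb
            ⟨hv₁'.trans_le (hxq.trans hqw.1), hv₂'.trans_le hqw.2⟩
            (fun w' hw' => (hPsep w' hw').imp (fun h => h.trans (hPp.trans hv)) id)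
            (fun e he => Or.inl ⟨hv₁L _ (List.mem_map_of_mem he) (hin₂ e he).2.1,
              hv₂L _ (List.mem_map_of_mem he) (hin₂ e he).2.2⟩)
          have c1 := hLt₁ (u₁, u₂) hu₂
          have c2 := hLe₂ P hPp
          have c3 := hLt₂ w hqw
          have c4 := hLe₁ (v₁, v₂) hv₁'
          have c5 := rankLe_le_length L₂ (v₁, v₂)
          omega
        · have h5 := hbound P w haP hwb hPw hPsep fun e he =>
            Or.inl ((hin₂ e he).2.le.trans (hbq.trans hqP))
          have c3 := hLt₂ w hqw
          have c5 := rankLe_le_length L₂ P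
          simp only [hqP, if_true]
          omega
  have hrun : M.run s (L₁ ++ L₂) = M.run (M.run s L₁) L₂ := M.run_append s L₁ L₂
  refine ⟨g, ?_, ?_, ?_, ?_, ?_, ?_⟩
  · rw [List.length_append, h₁.length_eq, h₂.length_eq, pow_succ]
    ring
  · intro e he
    rcases List.mem_append.1 he with he | he
    · exact hin₁ e he
    · exact ⟨(hin₂ e he).1.of_le (hap.trans hpa), (hin₂ e he).2.trans_le (hbq.trans hqb)⟩
  · exact (M.consistent_append s L₁ L₂).2 ⟨h₁.consistent, h₂.consistent⟩
  · rw [hrun]; exact hrank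
  · rw [hrun]; exact hgapg
  · obtain ⟨pre₁, hpre₁, hc₁⟩ := h₁.space
    obtain ⟨pre₂, hpre₂, hc₂⟩ := h₂.space
    have hcov : (n₀ * 2 ^ k : ℝ) ≤ ((M.stored (M.run (M.run s L₁) L₂) L₁).card + 2) * g
      + (M.stored (M.run (M.run s L₁) L₂) L₁).card := by
      rw [h₁.length_eq] at hcover
      exact_mod_cast hcover
    have hcomb := space_combine (k := k) (N := n₀ * 2 ^ k) (t := 2 ^ k) (g := g)
      (Nat.cast_nonneg k) (by positivity) (one_le_pow₀ (by norm_num))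
      (Nat.cast_nonneg g₁) (Nat.cast_nonneg g₂) (by exact_mod_cast hg) hc₁ hc₂ hcov
      (Nat.cast_nonneg _)
    have hrew : ((k + 1 : ℕ) : ℝ) * ((n₀ * 2 ^ (k + 1) : ℝ) / (4 * (g + 2 ^ (k + 1))) - 1)
        = ((k : ℝ) + 1) * (2 * (n₀ * 2 ^ k) / (4 * (g + 2 * 2 ^ k)) - 1) := by
      push_cast
      ring_nf
    rw [hrew]
    -- The peak occurs either in the first part, or in the second part together with the pairs of
    -- `L₁` that survive to the end. The latter are in memory throughout, as a discarded pair cannot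
    -- return.
    rcases hcomb with h | h
    · refine ⟨pre₁, hpre₁.trans (List.prefix_append _ _), h.trans ?_⟩
      exact_mod_cast Finset.card_le_card fun w hw => by
        rw [M.mem_stored] at hw ⊢
        exact ⟨hw.1, List.mem_append_left _ hw.2⟩
    · refine ⟨L₁ ++ pre₂, (List.prefix_append_right_inj L₁).2 hpre₂, h.trans ?_⟩
      rw [M.run_append]
      classical
      have hdisj : Disjoint (M.stored (M.run (M.run s L₁) pre₂) L₂)
          (M.stored (M.run (M.run s L₁) L₂) L₁) := by
        rw [Finset.disjoint_left]
        intro w hw hw'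
        exact hnot w (M.mem_stored.1 hw').2 (M.mem_stored.1 hw).2
      have hsub : M.stored (M.run (M.run s L₁) pre₂) L₂ ∪ M.stored (M.run (M.run s L₁) L₂) L₁ ⊆
          M.stored (M.run (M.run s L₁) pre₂) (L₁ ++ L₂) := by
        intro w hw
        rw [M.mem_stored]
        rcases Finset.mem_union.1 hw with hw | hw
        · obtain ⟨h1, h2⟩ := M.mem_stored.1 hw
          exact ⟨h1, List.mem_append_right _ h2⟩
        · obtain ⟨h1, h2⟩ := M.mem_stored.1 hw
          refine ⟨?_, List.mem_append_left _ h2⟩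
          obtain ⟨rest, rfl⟩ := hpre₂
          rw [M.run_append] at h1
          refine (M.mem_run h1).resolve_right fun h => hnot w h2 (List.mem_append_right _ h)
      have := Finset.card_le_card hsub
      rw [Finset.card_union_of_disjoint hdisj] at this
      exact_mod_cast this

/-- An increasing sequence of pairs in a box on which nothing is stored. -/
theorem exists_increasing (n : ℕ) {a b : ℝ × ℝ} (hab : PairLT a b) :
    ∃ L : List (ℝ × ℝ), L.length = n ∧ (∀ e ∈ L, PairLT a e ∧ PairLT e b) ∧
      L.Pairwise PairLT := by
  induction n generalizing a with
  | zero => exact ⟨[], rfl, by simp, List.Pairwise.nil⟩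
  | succ n ih =>
    obtain ⟨x, hx, hx'⟩ := exists_between hab.1
    obtain ⟨y, hy, hy'⟩ := exists_between hab.2
    obtain ⟨L, h1, h2, h3⟩ := ih (a := (x, y)) ⟨hx', hy'⟩
    refine ⟨(x, y) :: L, by simp [h1], fun e he => ?_, List.pairwise_cons.2
      ⟨fun e he => (h2 e he).1, h3⟩⟩
    rcases List.mem_cons.1 he with rfl | he
    · exact ⟨⟨hx, hy⟩, ⟨hx', hy'⟩⟩
    · exact ⟨(h2 e he).1.of_le ⟨hx.le, hy.le⟩, (h2 e he).2⟩

theorem consistent_of_pairwise {s : σ} {L : List (ℝ × ℝ)} (hL : L.Pairwise PairLT)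
    (hs : ∀ e ∈ L, ∀ m ∈ M.mem s, PairLT e m ∨ PairLT m e) : M.Consistent s L := by
  induction L generalizing s with
  | nil => trivial
  | cons e L ih =>
    rw [List.pairwise_cons] at hL
    refine ⟨hs e (by simp), ih hL.2 fun e' he' m hm => ?_⟩
    rcases Finset.mem_insert.1 (M.mem_step s e hm) with rfl | hm
    · exact Or.inr (hL.1 e' he')
    · exact hs e' (by simp [he']) m hm

theorem rankLe_le_rankLt_of_pairwise {L : List (ℝ × ℝ)} (hL : L.Pairwise PairLT) {w : ℝ × ℝ}
    (hw : w ∈ L) : rankLe L w ≤ rankLt L w + 1 := by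
  induction L with
  | nil => simp at hw
  | cons e L ih =>
    rw [List.pairwise_cons] at hL
    have h1 : ∀ v, rankLe (e :: L) v = rankLe L v + if e.1 ≤ v.1 then 1 else 0 := by
      intro v; simp [rankLe, List.countP_cons]
    have h2 : ∀ v, rankLt (e :: L) v = rankLt L v + if e.2 < v.2 then 1 else 0 := by
      intro v; simp [rankLt, List.countP_cons]
    rw [h1, h2]
    rcases List.mem_cons.1 hw with rfl | hw
    · rw [rankLe_eq_zero fun e he => (hL.1 e he).1]
      simp
    · have h3 := hL.1 w hw
      rw [if_pos h3.1.le, if_pos h3.2]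
      have := ih hL.2 hw
      omega

theorem Ready.exists_adversaryRun (n₀ k : ℕ) {s : σ} {a b : ℝ × ℝ} (hs : M.Ready s a b) :
    ∃ L g, M.AdversaryRun n₀ k s a b L g := by
  induction k generalizing s a b with
  | zero =>
    obtain ⟨x, hx, hx'⟩ := exists_between hs.lt.1
    obtain ⟨y, hy, hy'⟩ := exists_between hs.lt.2
    -- The point `(x, y)` stays below the whole sequence, so the interval from `a` to it is a gap of
    -- size `0`. The space bound is void for `k = 0`.
    obtain ⟨L, h1, h2, h3⟩ := exists_increasing n₀ (a := (x, y)) (b := b) ⟨hx', hy'⟩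
    have hax : PairLT a (x, y) := ⟨hx, hy⟩
    have hin : ∀ e ∈ L, PairLT a e ∧ PairLT e b := fun e he =>
      ⟨(h2 e he).1.of_le hax.le, (h2 e he).2⟩
    have hgap : HasGap (M.stored (M.run s L) L) L a b 0 := by
      refine ⟨a, (x, y), le_rfl, ⟨hx'.le, hy'.le⟩, hax, fun w hw => Or.inr ?_, ?_⟩
      · exact (h2 w (M.mem_stored.1 hw).2).1.le
      · rw [rankLe_eq_zero fun e he => (hin e he).1.1]
        omega
    refine ⟨L, 0, by simp [h1], hin, ?_, ?_, hgap, [], List.nil_prefix, by simp⟩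
    · refine consistent_of_pairwise h3 fun e he m hm => ?_
      rcases hs.outside m hm with h | h
      · exact Or.inr ((hin e he).1.of_le h)
      · exact Or.inl ((hin e he).2.trans_le h)
    · exact fun w hw => rankLe_le_rankLt_of_pairwise h3 (M.mem_stored.1 hw).2
  | succ k ih =>
    obtain ⟨L₁, g₁, h₁⟩ := ih hs
    obtain ⟨p, q, hap, hqb, hpq, hsep, hgap⟩ := h₁.gap
    -- The new box uses the free space right above `p` in the first stream and right below `q` in
    -- the second. It lies between `p` and `q`, so no stored pair is inside.
    obtain ⟨x₀, hx, hxq, hx₀⟩ := exists_next (L₁.map Prod.fst) hpq.1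
    obtain ⟨y₀, hy, hyq, hy₀⟩ := exists_prev (L₁.map Prod.snd) hpq.2
    have hready : M.Ready (M.run s L₁) (p.1, y₀) (x₀, q.2) := by
      refine ⟨⟨hx, hyq⟩, M.isPairChain_run hs.chain h₁.consistent, fun m hm => ?_⟩
      have hpa : p ≤ (p.1, y₀) := ⟨le_rfl, hy⟩
      have hbq : ((x₀, q.2) : ℝ × ℝ) ≤ q := ⟨hxq, le_rfl⟩
      rcases M.mem_run hm with h | h
      · exact (hs.outside m h).imp (fun h => h.trans (hap.trans hpa))
          fun h => hbq.trans (hqb.trans h)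
      · exact (hsep m (M.mem_stored.2 ⟨hm, h⟩)).imp (fun h => h.trans hpa) fun h => hbq.trans h
    obtain ⟨L₂, g₂, h₂⟩ := ih hready
    obtain ⟨g, hg⟩ := hs.adversaryRun_combine h₁ hap hqb hpq hsep hgap hx hxq
      (fun e he => hx₀ _ (List.mem_map_of_mem he)) hy hyq
      (fun e he => hy₀ _ (List.mem_map_of_mem he)) h₂
    exact ⟨_, g, hg⟩

end PairMachine

/-! ### From pairs to two streams for a comparison-based algorithm -/

/-- A finite chain of pairs extends to an increasing function on a finite set. -/
theorem IsPairChain.exists_strictMonoOn {T : Finset (ℝ × ℝ)} (hT : IsPairChain T) {a b : ℝ × ℝ}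
    (hab : PairLT a b) (hin : ∀ w ∈ T, PairLT a w ∧ PairLT w b) (X : Finset ℝ)
    (hX : ∀ x ∈ X, a.1 < x ∧ x < b.1) :
    ∃ φ : ℝ → ℝ, (∀ m ∈ T, φ m.1 = m.2) ∧ (∀ x ∈ X, a.2 < φ x ∧ φ x < b.2) ∧
      StrictMonoOn φ ({x | x ∈ X} ∪ {x | ∃ m ∈ T, m.1 = x}) := by
  classical
  -- The graph of `φ` is a larger chain. A missing first coordinate gets a second one between those
  -- of the pairs to its left and those to its right.
  have key : ∃ T' : Finset (ℝ × ℝ), T ⊆ T' ∧ IsPairChain T' ∧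
      (∀ w ∈ T', PairLT a w ∧ PairLT w b) ∧ ∀ x ∈ X, ∃ m ∈ T', m.1 = x := by
    induction X using Finset.induction_on with
    | empty => exact ⟨T, subset_rfl, hT, hin, by simp⟩
    | insert x X hx ih =>
      obtain ⟨T', h1, h2, h3, h4⟩ := ih fun y hy => hX y (by simp [hy])
      by_cases hex : ∃ m ∈ T', m.1 = x
      · refine ⟨T', h1, h2, h3, fun y hy => ?_⟩
        rcases Finset.mem_insert.1 hy with rfl | hy
        · exact hex
        · exact h4 y hy
      · push Not at hex
        obtain ⟨y, hlo, hhi⟩ := Order.exists_between_finsets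
          (insert a.2 ((T'.filter fun m => m.1 < x).image Prod.snd))
          (insert b.2 ((T'.filter fun m => x < m.1).image Prod.snd)) (by
            intro s hs t ht
            simp only [Finset.mem_insert, Finset.mem_image, Finset.mem_filter] at hs ht
            rcases hs with rfl | ⟨m, ⟨hm, hmx⟩, rfl⟩ <;>
              rcases ht with rfl | ⟨m', ⟨hm', hmx'⟩, rfl⟩
            · exact hab.2
            · exact (h3 m' hm').1.2
            · exact (h3 m hm).2.2
            · rcases h2 m hm m' hm' with rfl | h | h
              · exact absurd (hmx.trans hmx') (lt_irrefl _)
              · exact h.2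
              · exact absurd ((hmx.trans hmx').trans h.1) (lt_irrefl _))
        have hlo' : ∀ m ∈ T', m.1 < x → m.2 < y := fun m hm h => hlo _
          (Finset.mem_insert_of_mem (Finset.mem_image_of_mem _ (Finset.mem_filter.2 ⟨hm, h⟩)))
        have hhi' : ∀ m ∈ T', x < m.1 → y < m.2 := fun m hm h => hhi _
          (Finset.mem_insert_of_mem (Finset.mem_image_of_mem _ (Finset.mem_filter.2 ⟨hm, h⟩)))
        have hcmp : ∀ m ∈ T', PairLT (x, y) m ∨ PairLT m (x, y) := fun m hm => by
          rcases lt_trichotomy m.1 x with h | h | h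
          · exact Or.inr ⟨h, hlo' m hm h⟩
          · exact absurd h (hex m hm)
          · exact Or.inl ⟨h, hhi' m hm h⟩
        have hxX := hX x (by simp)
        refine ⟨insert (x, y) T', h1.trans (Finset.subset_insert _ _), ?_, ?_, ?_⟩
        · intro m hm m' hm'
          rcases Finset.mem_insert.1 hm with rfl | hm <;>
            rcases Finset.mem_insert.1 hm' with rfl | hm'
          · exact Or.inl rfl
          · exact Or.inr (hcmp m' hm')
          · exact Or.inr (hcmp m hm).symm
          · exact h2 m hm m' hm'
        · intro w hw
          rcases Finset.mem_insert.1 hw with rfl | hw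
          · exact ⟨⟨hxX.1, hlo _ (by simp)⟩, ⟨hxX.2, hhi _ (by simp)⟩⟩
          · exact h3 w hw
        · intro z hz
          rcases Finset.mem_insert.1 hz with rfl | hz
          · exact ⟨(z, y), by simp, rfl⟩
          · obtain ⟨m, hm, hm'⟩ := h4 z hz
            exact ⟨m, by simp [hm], hm'⟩
  obtain ⟨T', h1, h2, h3, h4⟩ := key
  let φ : ℝ → ℝ := fun x => if h : ∃ m ∈ T', m.1 = x then h.choose.2 else 0
  have hφ : ∀ m ∈ T', φ m.1 = m.2 := by
    intro m hm
    have hex : ∃ m' ∈ T', m'.1 = m.1 := ⟨m, hm, rfl⟩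
    have hval : φ m.1 = hex.choose.2 := dif_pos hex
    obtain ⟨hc, hc'⟩ := hex.choose_spec
    rw [hval]
    rcases h2 _ hc m hm with h | h | h
    · rw [h]
    · exact absurd h.1 (by rw [hc']; exact lt_irrefl _)
    · exact absurd h.1 (by rw [hc']; exact lt_irrefl _)
  refine ⟨φ, fun m hm => hφ m (h1 hm), fun x hx => ?_, ?_⟩
  · obtain ⟨m, hm, rfl⟩ := h4 x hx
    rw [hφ m hm]
    exact ⟨(h3 m hm).1.2, (h3 m hm).2.2⟩
  · have hex : ∀ x ∈ ({x | x ∈ X} ∪ {x | ∃ m ∈ T, m.1 = x} : Set ℝ), ∃ m ∈ T', m.1 = x := by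
      rintro x (hx | ⟨m, hm, rfl⟩)
      · exact h4 x hx
      · exact ⟨m, h1 hm, rfl⟩
    intro x hx y hy hxy
    obtain ⟨m, hm, rfl⟩ := hex x hx
    obtain ⟨m', hm', rfl⟩ := hex y hy
    rw [hφ m hm, hφ m' hm']
    rcases h2 m hm m' hm' with rfl | h | h
    · exact absurd hxy (lt_irrefl _)
    · exact h.2
    · exact absurd (hxy.trans h.1) (lt_irrefl _)

namespace ComparisonAlg

variable {G : Type} (A : ComparisonAlg G)

/-- One step of the algorithm on a pair, with the comparisons of the first coordinates. -/
noncomputable def pairStep (s : List (ℝ × ℝ) × G) (e : ℝ × ℝ) : List (ℝ × ℝ) × G :=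
  ((A.select s.2 (s.1.map fun m => cmp e.1 m.1) (A.consts.map (cmp e.1))).filterMap
      (fun i => (e :: s.1)[i]?),
    A.update s.2 (s.1.map fun m => cmp e.1 m.1) (A.consts.map (cmp e.1)))

theorem mem_pairStep {s : List (ℝ × ℝ) × G} {e m : ℝ × ℝ} (h : m ∈ (A.pairStep s e).1) :
    m = e ∨ m ∈ s.1 := by
  obtain ⟨i, -, hi⟩ := List.mem_filterMap.1 h
  exact List.mem_cons.1 (List.mem_of_getElem? hi)

open Classical in
/-- The machine that gives every item twice to the algorithm. -/
noncomputable def pairMachine : PairMachine (List (ℝ × ℝ) × G) where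
  step s e := A.pairStep (A.pairStep s e) e
  mem s := s.1.toFinset
  mem_step s e := by
    intro m hm
    rw [List.mem_toFinset] at hm
    rw [Finset.mem_insert, List.mem_toFinset]
    rcases A.mem_pairStep hm with h | h
    · exact Or.inl h
    · exact A.mem_pairStep h

theorem mem_pairMachine {s : List (ℝ × ℝ) × G} {m : ℝ × ℝ} :
    m ∈ A.pairMachine.mem s ↔ m ∈ s.1 := by
  classical
  exact List.mem_toFinset

theorem step_map (h : ℝ × ℝ → ℝ) {s : List (ℝ × ℝ) × G} {e : ℝ × ℝ} {w : ℝ}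
    (hs : ∀ m ∈ s.1, cmp (h e) (h m) = cmp e.1 m.1)
    (hc : ∀ c ∈ A.consts, cmp (h e) c = cmp e.1 c) (hsmall : A.small < h e) :
    A.toStreamAlg.step ⟨s.1.map h, s.2, w⟩ (h e)
      = ⟨(A.pairStep s e).1.map h, (A.pairStep s e).2, w⟩ := by
  have h1 : (s.1.map h).map (cmp (h e)) = s.1.map fun m => cmp e.1 m.1 := by
    rw [List.map_map]
    exact List.map_congr_left hs
  have h2 : A.consts.map (cmp (h e)) = A.consts.map (cmp e.1) := List.map_congr_left hc
  have h3 : ∀ i : ℕ, (h e :: s.1.map h)[i]? = ((e :: s.1)[i]?).map h := fun i => by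
    rw [← List.map_cons, List.getElem?_map]
  simp only [toStreamAlg, pairStep, h1, h2, h3, if_neg (not_le.2 hsmall), List.map_filterMap]

/-- The arriving items `h e` compare with the stored items `h m` as `e.1` does with `m.1`. -/
def Simulates (h : ℝ × ℝ → ℝ) : List (ℝ × ℝ) × G → List (ℝ × ℝ) → Prop
  | _, [] => True
  | s, e :: L => (∀ m ∈ s.1, cmp (h e) (h m) = cmp e.1 m.1) ∧
      Simulates h (A.pairMachine.step s e) L

/-- As long as all comparisons agree, the memory of the algorithm is the image under `h` of the
memory of the pair machine; the accumulated sum stays fixed because every item exceeds the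
threshold. -/
theorem Simulates.foldl_doubled {A : ComparisonAlg G} {h : ℝ × ℝ → ℝ} {s : List (ℝ × ℝ) × G}
    {L : List (ℝ × ℝ)} (hL : A.Simulates h s L) {w : ℝ}
    (hc : ∀ e ∈ L, ∀ c ∈ A.consts, cmp (h e) c = cmp e.1 c) (hsmall : ∀ e ∈ L, A.small < h e) :
    (doubled (L.map h)).foldl A.toStreamAlg.step ⟨s.1.map h, s.2, w⟩
      = ⟨(A.pairMachine.run s L).1.map h, (A.pairMachine.run s L).2, w⟩ := by
  induction L generalizing s with
  | nil => rfl
  | cons e L ih =>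
    rw [List.map_cons, doubled_cons, List.foldl_cons, List.foldl_cons,
      A.step_map h hL.1 (hc e (by simp)) (hsmall e (by simp)),
      A.step_map h (fun m hm => ?_) (hc e (by simp)) (hsmall e (by simp))]
    · exact ih hL.2 (fun e' he' => hc e' (by simp [he'])) fun e' he' => hsmall e' (by simp [he'])
    -- The second copy may meet the first one in memory; then both comparisons give equality.
    · rcases A.mem_pairStep hm with rfl | hm
      · simp
      · exact hL.1 m hm

theorem simulates_of_strictMonoOn {φ : ℝ → ℝ} {X : Set ℝ} (hφ : StrictMonoOn φ X)
    {s : List (ℝ × ℝ) × G} {L : List (ℝ × ℝ)} (hs : ∀ m ∈ s.1, m.1 ∈ X) (hL : ∀ e ∈ L, e.1 ∈ X) :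
    A.Simulates (fun e => φ e.1) s L := by
  induction L generalizing s with
  | nil => trivial
  | cons e L ih =>
    refine ⟨fun m hm => hφ.cmp_map_eq (hL e (by simp)) (hs m hm),
      ih (fun m hm => ?_) fun e' he' => hL e' (by simp [he'])⟩
    rcases Finset.mem_insert.1 (A.pairMachine.mem_step s e (A.mem_pairMachine.2 hm)) with rfl | h
    · exact hL m (by simp)
    · exact hs m (A.mem_pairMachine.1 h)

theorem simulates_snd {s : List (ℝ × ℝ) × G} {L : List (ℝ × ℝ)}
    (h : A.pairMachine.Consistent s L) : A.Simulates Prod.snd s L := by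
  induction L generalizing s with
  | nil => trivial
  | cons e L ih =>
    refine ⟨fun m hm => ?_, ih h.2⟩
    rcases h.1 m (A.mem_pairMachine.2 hm) with h | h
    · rw [h.1.cmp_eq_lt, h.2.cmp_eq_lt]
    · rw [h.1.cmp_eq_gt, h.2.cmp_eq_gt]

end ComparisonAlg

theorem streamRank_add_countP {α : Type*} (L : List α) (h : α → ℝ) (q : ℝ) (P : α → Prop)
    [DecidablePred P] (hP : ∀ e ∈ L, q < h e ↔ ¬ P e) :
    streamRank (L.map h) q + L.countP (fun e => P e) = L.length := by
  induction L with
  | nil => rfl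
  | cons e L ih =>
    have h1 := hP e (by simp)
    have h2 := ih fun e he => hP e (by simp [he])
    rw [List.map_cons, streamRank_cons, List.countP_cons, List.length_cons]
    by_cases hp : P e
    · have : ¬ q < h e := fun hq => h1.1 hq hp
      simp only [this, hp, if_false, decide_true, if_true]
      omega
    · have : q < h e := h1.2 hp
      simp only [this, hp, if_true, decide_false]
      simp only [Bool.false_eq_true, if_false]
      omega

/-- No constant lies in `(1/2, u)`, so constants cannot distinguish items from that interval. -/
theorem cmp_eq_of_no_const {C : List ℝ} {u : ℝ} (hu : ∀ z ∈ C, 1 / 2 < z → u ≤ z) {x y : ℝ}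
    (hx : 1 / 2 < x ∧ x < u) (hy : 1 / 2 < y ∧ y < u) {c : ℝ} (hc : c ∈ C) :
    cmp x c = cmp y c := by
  by_cases h : 1 / 2 < c
  · have := hu c hc h
    rw [(hx.2.trans_le this).cmp_eq_lt, (hy.2.trans_le this).cmp_eq_lt]
  · push Not at h
    rw [(h.trans_lt hx.1).cmp_eq_gt, (h.trans_lt hy.1).cmp_eq_gt]

namespace ComparisonAlg

variable {G : Type} {A : ComparisonAlg G}

/-- An accurate algorithm leaves only small gaps between the stored items. -/
theorem gap_le {ε : ℝ} (hε : 0 < ε) (hsmall : A.small ≤ 1 / 2) {f : ℕ → ℝ}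
    (hA : ∀ I : List ℝ, IsBPInput I → binOPT I ≤ A.toStreamAlg.output (A.toStreamAlg.run I) ∧
      (A.toStreamAlg.output (A.toStreamAlg.run I) : ℝ) ≤ (1 + ε) * (binOPT I : ℝ) + f (binOPT I))
    {N₁ : ℕ} (hf : ∀ n ≥ N₁, |f n| ≤ ε / 3 * n) {u : ℝ} (hu2 : u ≤ 2 / 3)
    (hu : ∀ z ∈ A.consts, 1 / 2 < z → u ≤ z) {n₀ k : ℕ} {L : List (ℝ × ℝ)} {g : ℕ}
    (h : A.pairMachine.AdversaryRun n₀ k ([], A.init) (1 / 2, 1 / 2) (u, u) L g)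
    (hN : N₁ ≤ L.length) : (g : ℝ) ≤ 4 * ε * L.length := by
  classical
  obtain ⟨p, q, hap, hqb, hpq, hsep, hgap⟩ := h.gap
  -- The query sits right below `q.2` in the second stream, as `z`, and right above `p.1` in the
  -- first, as `x`. The pair `(x, z)` extends the chain of stored pairs.
  obtain ⟨y₀, hy, hyq, hy₀⟩ := exists_prev (L.map Prod.snd) hpq.2
  obtain ⟨x₀, hx, hxq, hx₀⟩ := exists_next (L.map Prod.fst) hpq.1
  obtain ⟨z, hyz, hzq⟩ := exists_between hyq
  obtain ⟨x, hpx, hxx⟩ := exists_between hx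
  set M := A.pairMachine with hM
  set s₀ : List (ℝ × ℝ) × G := ([], A.init) with hs₀
  have hmemL : ∀ m ∈ (M.run s₀ L).1, m ∈ L := fun m hm =>
    (M.mem_run (A.mem_pairMachine.2 hm)).resolve_left fun h => by
      have := A.mem_pairMachine.1 h
      simp [hs₀] at this
  have hstored : ∀ m, m ∈ M.stored (M.run s₀ L) L ↔ m ∈ (M.run s₀ L).1 := fun m =>
    M.mem_stored.trans ⟨fun h => A.mem_pairMachine.1 h.1,
      fun h => ⟨A.mem_pairMachine.2 h, hmemL m h⟩⟩
  have hchain : IsPairChain (M.mem (M.run s₀ L)) := M.isPairChain_run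
    (fun m hm => by
      have := A.mem_pairMachine.1 hm
      simp [hs₀] at this) h.consistent
  have hab : PairLT ((1 / 2, 1 / 2) : ℝ × ℝ) (u, u) :=
    ⟨(hap.1.trans_lt hpq.1).trans_le hqb.1, (hap.1.trans_lt hpq.1).trans_le hqb.1⟩
  have hxz : ∀ w ∈ M.mem (M.run s₀ L), PairLT (x, z) w ∨ PairLT w (x, z) := by
    intro w hw
    rcases hsep w ((hstored w).2 (A.mem_pairMachine.1 hw)) with h | h
    · exact Or.inr ⟨h.1.trans_lt hpx, (h.2.trans hy).trans_lt hyz⟩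
    · exact Or.inl ⟨hxx.trans_le (hxq.trans h.1), hzq.trans_le h.2⟩
  have hchain' : IsPairChain (insert (x, z) (M.mem (M.run s₀ L))) := by
    intro m hm m' hm'
    rcases Finset.mem_insert.1 hm with rfl | hm <;> rcases Finset.mem_insert.1 hm' with rfl | hm'
    · exact Or.inl rfl
    · exact Or.inr (hxz m' hm')
    · exact Or.inr (hxz m hm).symm
    · exact hchain m hm m' hm'
  have hz : 1 / 2 < z ∧ z < u :=
    ⟨(hap.2.trans hy).trans_lt hyz, hzq.trans_le hqb.2⟩
  -- Equal comparisons are not enough, since the final computation sees the stored values. `φ` moves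
  -- the first stream so that its stored items become those of the second, and `x` becomes the
  -- common query `z`.
  obtain ⟨φ, hφ, hφb, hφmono⟩ := hchain'.exists_strictMonoOn hab (fun w hw => by
      rcases Finset.mem_insert.1 hw with rfl | hw
      · exact ⟨⟨hap.1.trans_lt hpx, hz.1⟩, ⟨hxx.trans_le (hxq.trans hqb.1), hz.2⟩⟩
      · exact h.inside w (hmemL w (A.mem_pairMachine.1 hw))) (L.map Prod.fst).toFinset (by
      intro y hy
      obtain ⟨e, he, rfl⟩ := List.mem_map.1 (List.mem_toFinset.1 hy)
      exact ⟨(h.inside e he).1.1, (h.inside e he).2.1⟩)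
  have hLX : ∀ e ∈ L, e.1 ∈ ({y | y ∈ (L.map Prod.fst).toFinset} ∪
      {y | ∃ m ∈ insert (x, z) (M.mem (M.run s₀ L)), m.1 = y} : Set ℝ) := fun e he =>
    Or.inl (List.mem_toFinset.2 (List.mem_map_of_mem he))
  have hφL : ∀ e ∈ L, 1 / 2 < φ e.1 ∧ φ e.1 < u := fun e he =>
    hφb _ (List.mem_toFinset.2 (List.mem_map_of_mem he))
  have hin₁ : ∀ e ∈ L, 1 / 2 < e.1 ∧ e.1 < u := fun e he =>
    ⟨(h.inside e he).1.1, (h.inside e he).2.1⟩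
  have hin₂ : ∀ e ∈ L, 1 / 2 < e.2 ∧ e.2 < u := fun e he =>
    ⟨(h.inside e he).1.2, (h.inside e he).2.2⟩
  have run₁ : A.toStreamAlg.run (doubled (L.map fun e => φ e.1)) =
      ⟨(M.run s₀ L).1.map Prod.snd, (M.run s₀ L).2, 0⟩ := by
    have hmap : (M.run s₀ L).1.map Prod.snd = (M.run s₀ L).1.map fun e => φ e.1 :=
      List.map_congr_left fun m hm =>
        (hφ m (Finset.mem_insert_of_mem (A.mem_pairMachine.2 hm))).symm
    rw [hmap]
    exact (A.simulates_of_strictMonoOn hφmono (s := s₀) (by simp [hs₀]) hLX).foldl_doubled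
      (fun e he c hc => cmp_eq_of_no_const hu (hφL e he) (hin₁ e he) hc)
      fun e he => hsmall.trans_lt (hφL e he).1
  have run₂ : A.toStreamAlg.run (doubled (L.map Prod.snd)) =
      ⟨(M.run s₀ L).1.map Prod.snd, (M.run s₀ L).2, 0⟩ :=
    (A.simulates_snd h.consistent).foldl_doubled
      (fun e he c hc => cmp_eq_of_no_const hu (hin₂ e he) (hin₁ e he) hc)
      fun e he => hsmall.trans_lt (hin₂ e he).1
  have hzmem : z ∈ Set.Ioo (1 / 2 : ℝ) (2 / 3) := ⟨hz.1, hz.2.trans_le hu2⟩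
  have hb₁ := A.toStreamAlg.output_doubled_bounds hA (L.map fun e => φ e.1) z
    (fun y hy => by
      obtain ⟨e, he, rfl⟩ := List.mem_map.1 hy
      exact ⟨(hφL e he).1, (hφL e he).2.trans_le hu2⟩) hzmem hε (by positivity) hf (by simpa)
  have hb₂ := A.toStreamAlg.output_doubled_bounds hA (L.map Prod.snd) z
    (fun y hy => by
      obtain ⟨e, he, rfl⟩ := List.mem_map.1 hy
      exact ⟨(hin₂ e he).1, (hin₂ e he).2.trans_le hu2⟩) hzmem hε (by positivity) hf (by simpa)
  -- Equal memories followed by the same `2N` query items give equal outputs, although the ranks of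
  -- `z` differ by at least `g`.
  have hrun_append : ∀ I J : List ℝ, A.toStreamAlg.run (I ++ J) =
      J.foldl A.toStreamAlg.step (A.toStreamAlg.run I) := fun I J => List.foldl_append
  rw [hrun_append, run₁, List.length_map] at hb₁
  rw [hrun_append, run₂, List.length_map] at hb₂
  have hr₁ : streamRank (L.map fun e => φ e.1) z + rankLe L p = L.length := by
    refine streamRank_add_countP L _ z (fun e => e.1 ≤ p.1) fun e he => ?_
    have hφx : φ x = z := hφ (x, z) (by simp)
    have hxX : x ∈ ({y | y ∈ (L.map Prod.fst).toFinset} ∪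
      {y | ∃ m ∈ insert (x, z) (M.mem (M.run s₀ L)), m.1 = y} : Set ℝ) :=
      Or.inr ⟨(x, z), by simp, rfl⟩
    rw [← hφx, hφmono.lt_iff_lt hxX (hLX e he), not_le]
    exact ⟨fun h => hpx.trans h, fun h => hxx.trans_le (hx₀ _ (List.mem_map_of_mem he) h)⟩
  have hr₂ : streamRank (L.map Prod.snd) z + rankLt L q = L.length := by
    refine streamRank_add_countP L _ z (fun e => e.2 < q.2) fun e he => ?_
    rw [not_lt]
    refine ⟨fun h => ?_, fun h => hzq.trans_le h⟩
    by_contra! h'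
    exact absurd (h.trans_le (hy₀ _ (List.mem_map_of_mem he) h')) (not_lt.2 hyz.le)
  have hgr : (g : ℝ) + streamRank (L.map Prod.snd) z ≤ streamRank (L.map fun e => φ e.1) z := by
    have : g + streamRank (L.map Prod.snd) z ≤ streamRank (L.map fun e => φ e.1) z := by omega
    exact_mod_cast this
  linarith [hb₁.1, hb₂.2]

/-- With `N = n₀ * 2 ^ k` pairs, `gap_le` gives `g ≤ 4 * ε * N`, and `n₀ ≥ 1 / ε` gives `2 ^ k ≤ ε *
N`. The space bound of the adversary then becomes `k * (1 / (20 * ε) - 1)`, where `k` is at least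
half of `log n`. -/
theorem exists_large_memory {ε : ℝ} (hε : 0 < ε) (hε' : ε < 1 / 64) (hsmall : A.small ≤ 1 / 2)
    (hA : A.toStreamAlg.IsAsymptoticApprox (1 + ε)) :
    ∀ᶠ n : ℕ in atTop, ∃ I : List ℝ, IsBPInput I ∧ binOPT I = n ∧
      ∃ p : List ℝ, p <+: I ∧
        1 / 64 * (1 / ε) * Real.log (n : ℝ) ≤ ((A.toStreamAlg.run p).items.length : ℝ) := by
  classical
  obtain ⟨f, hf, hA⟩ := hA
  obtain ⟨N₁, hN₁⟩ := exists_eventually_bound hf (δ := ε / 3) (by positivity)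
  obtain ⟨u, hu1, hu2, hu⟩ := exists_next A.consts (c := 1 / 2) (d := 2 / 3) (by norm_num)
  set n₀ := ⌈1 / ε⌉₊ with hn₀
  have hn₀ε : 1 / ε ≤ n₀ := Nat.le_ceil _
  have hn₀pos : 0 < n₀ := Nat.ceil_pos.2 (by positivity)
  have hlog : Tendsto (fun n : ℕ => Real.log (n : ℝ)) atTop atTop :=
    Real.tendsto_log_atTop.comp tendsto_natCast_atTop_atTop
  filter_upwards [eventually_ge_atTop (4 * N₁), eventually_ge_atTop (2 * n₀),
    hlog.eventually_ge_atTop (2 * Real.log (4 * n₀)), eventually_ge_atTop 1] with n hn1 hn2 hn3 hn4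
  -- This choice gives `2 * N ≤ n < 4 * N`: the doubled stream fits, and items of size `1` raise the
  -- optimum to exactly `n`.
  set k := Nat.log 2 (n / (2 * n₀)) with hk
  have hdiv : n / (2 * n₀) ≠ 0 := (Nat.div_pos hn2 (by omega)).ne'
  have hk1 : 2 ^ k ≤ n / (2 * n₀) := Nat.pow_log_le_self 2 hdiv
  have hk2 : n / (2 * n₀) < 2 ^ (k + 1) := Nat.lt_pow_succ_log_self (by norm_num) _
  have hkn1 : 2 * (n₀ * 2 ^ k) ≤ n := by
    have := (Nat.le_div_iff_mul_le (by omega)).1 hk1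
    linarith
  have hkn2 : n < 4 * (n₀ * 2 ^ k) := by
    have := (Nat.div_lt_iff_lt_mul (by omega)).1 hk2
    rw [pow_succ] at this
    linarith
  have hready : A.pairMachine.Ready ([], A.init) (1 / 2, 1 / 2) (u, u) :=
    ⟨⟨hu1, hu1⟩, fun m hm => by simpa using A.mem_pairMachine.1 hm,
      fun m hm => by simpa using A.mem_pairMachine.1 hm⟩
  obtain ⟨L, g, h⟩ := hready.exists_adversaryRun n₀ k
  have hlen := h.length_eq
  have hg := gap_le hε hsmall hA hN₁ hu2 hu h (by omega)
  obtain ⟨pre, ⟨rest, hpre⟩, hspace⟩ := h.space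
  have hmem : ∀ x ∈ doubled (L.map Prod.fst) ++ List.replicate (n - 2 * L.length) (1 : ℝ),
      1 / 2 < x ∧ x ≤ 1 := by
    intro x hx
    rcases List.mem_append.1 hx with hx | hx
    · obtain ⟨e, he, rfl⟩ := List.mem_map.1 (mem_doubled.1 hx)
      have := h.inside e he
      exact ⟨this.1.1, by linarith [this.2.1]⟩
    · rw [List.eq_of_mem_replicate hx]
      norm_num
  refine ⟨doubled (L.map Prod.fst) ++ List.replicate (n - 2 * L.length) 1,
    fun x hx => ⟨by linarith [(hmem x hx).1], (hmem x hx).2⟩, ?_, doubled (pre.map Prod.fst), ?_, ?_⟩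
  · rw [binOPT_of_half_lt hmem, List.length_append, length_doubled, List.length_map,
      List.length_replicate]
    omega
  · rw [← hpre, List.map_append, doubled_append, List.append_assoc]
    exact List.prefix_append _ _
  · have hpreL : ∀ e ∈ pre, e ∈ L := fun e he => by rw [← hpre]; simp [he]
    have hrun : A.toStreamAlg.run (doubled (pre.map Prod.fst)) =
        ⟨(A.pairMachine.run ([], A.init) pre).1.map Prod.fst,
          (A.pairMachine.run ([], A.init) pre).2, 0⟩ :=
      (A.simulates_of_strictMonoOn (φ := id) (strictMono_id.strictMonoOn Set.univ)
        (s := ([], A.init)) (by simp) (by simp)).foldl_doubled (fun e he c hc => rfl)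
        fun e he => hsmall.trans_lt (h.inside e (hpreL e he)).1.1
    rw [hrun, List.length_map]
    have hcard : (A.pairMachine.stored (A.pairMachine.run ([], A.init) pre) L).card
        ≤ (A.pairMachine.run ([], A.init) pre).1.length :=
      (Finset.card_filter_le _ _).trans (List.toFinset_card_le _)
    have hcard' : ((A.pairMachine.stored (A.pairMachine.run ([], A.init) pre) L).card : ℝ)
        ≤ (A.pairMachine.run ([], A.init) pre).1.length := by exact_mod_cast hcard
    refine le_trans ?_ (hspace.trans hcard')
    have hpow : (0 : ℝ) < 2 ^ k := by positivity
    have hn₀r : (0 : ℝ) < n₀ := by exact_mod_cast hn₀pos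
    have hN : (L.length : ℝ) = n₀ * 2 ^ k := by rw [hlen]; push_cast; ring
    rw [hN] at hg
    have h1 : (2 : ℝ) ^ k ≤ ε * (n₀ * 2 ^ k) := by
      rw [div_le_iff₀ hε] at hn₀ε
      nlinarith
    have h2 : 1 / (20 * ε) ≤ (n₀ * 2 ^ k : ℝ) / (4 * (g + 2 ^ k)) := by
      rw [div_le_div_iff₀ (by positivity) (by positivity)]
      linarith
    -- Here `ε < 1 / 64` absorbs the `-1`, as `1/20 - 1/64 ≥ 1/32`.
    have h3 : 1 / 32 * (1 / ε) ≤ (n₀ * 2 ^ k : ℝ) / (4 * (g + 2 ^ k)) - 1 := by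
      have h4 : 64 ≤ 1 / ε := by
        rw [le_div_iff₀ hε]; linarith
      have h5 : 1 / (20 * ε) = 1 / 20 * (1 / ε) := by field_simp
      linarith
    have h6 : Real.log n ≤ Real.log (4 * n₀) + k := by
      have h7 : (n : ℝ) ≤ (4 * n₀) * 2 ^ k := by
        have : (n : ℝ) < ((4 * (n₀ * 2 ^ k) : ℕ) : ℝ) := by exact_mod_cast hkn2
        push_cast at this
        linarith
      have h8 := Real.log_le_log (by exact_mod_cast hn4) h7
      rw [Real.log_mul (by positivity) (by positivity), Real.log_pow] at h8
      have h9 : Real.log 2 ≤ 1 := by linarith [Real.log_two_lt_d9]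
      have : (k : ℝ) * Real.log 2 ≤ k := mul_le_of_le_one_right (Nat.cast_nonneg k) h9
      linarith
    have h10 : 1 / 2 * Real.log n ≤ k := by linarith
    calc 1 / 64 * (1 / ε) * Real.log n = (1 / 2 * Real.log n) * (1 / 32 * (1 / ε)) := by ring
      _ ≤ k * ((n₀ * 2 ^ k : ℝ) / (4 * (g + 2 ^ k)) - 1) := by
        refine mul_le_mul h10 h3 (by positivity) (Nat.cast_nonneg k)

end ComparisonAlg

/-! ### A deterministic summary for ranks -/

/-- The record of a stored item: its time of arrival, and the numbers of items that have been
merged into it from the left and from the right. -/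
structure SketchRec where
  time : ℕ
  left : ℕ
  right : ℕ

namespace SketchRec

def mass (x : SketchRec) : ℕ := x.left + 1 + x.right

/-- The neighbour `v` to the right of `w` can be merged into the older `w` at time `t`. -/
def CanMergeRight (m t : ℕ) (w v : SketchRec) : Prop :=
  w.time ≤ v.time ∧ m * (w.right + v.mass) + w.time ≤ t

/-- The neighbour `v` to the left of `w` can be merged into the older `w` at time `t`. -/
def CanMergeLeft (m t : ℕ) (v w : SketchRec) : Prop :=
  w.time ≤ v.time ∧ m * (w.left + v.mass) + w.time ≤ t

/-- Two neighbours that cannot be merged. -/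
def Unmergeable (m t : ℕ) (a b : SketchRec) : Prop :=
  ¬ CanMergeRight m t a b ∧ ¬ CanMergeLeft m t a b

end SketchRec

open SketchRec

/-- One merging step. -/
inductive MergeStep {α : Type} (m t : ℕ) : List (α × SketchRec) → List (α × SketchRec) → Prop
  | right (L₁ L₂ : List (α × SketchRec)) (w v : α × SketchRec) (h : CanMergeRight m t w.2 v.2) :
      MergeStep m t (L₁ ++ w :: v :: L₂)
        (L₁ ++ (w.1, ⟨w.2.time, w.2.left, w.2.right + v.2.mass⟩) :: L₂)
  | left (L₁ L₂ : List (α × SketchRec)) (v w : α × SketchRec) (h : CanMergeLeft m t v.2 w.2) :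
      MergeStep m t (L₁ ++ v :: w :: L₂)
        (L₁ ++ (w.1, ⟨w.2.time, w.2.left + v.2.mass, w.2.right⟩) :: L₂)

/-- Merging looks only at records, never at values. So it can be performed on positions in the array
and transferred to the items stored there. -/
theorem MergeStep.map {α β : Type} (f : α → β) {m t : ℕ} {L L' : List (α × SketchRec)}
    (h : MergeStep m t L L') :
    MergeStep m t (L.map fun x => (f x.1, x.2)) (L'.map fun x => (f x.1, x.2)) := by
  cases h with
  | right L₁ L₂ w v h => simpa using MergeStep.right _ _ (f w.1, w.2) (f v.1, v.2) h
  | left L₁ L₂ v w h => simpa using MergeStep.left _ _ (f v.1, v.2) (f w.1, w.2) h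

theorem exists_split_of_not_isChain {α : Type*} {R : α → α → Prop} {L : List α}
    (h : ¬ L.IsChain R) : ∃ L₁ a b L₂, L = L₁ ++ a :: b :: L₂ ∧ ¬ R a b := by
  induction L with
  | nil => simp at h
  | cons a L ih =>
    cases L with
    | nil => simp at h
    | cons b L =>
      by_cases hab : R a b
      · obtain ⟨L₁, c, d, L₂, h1, h2⟩ := ih fun h' => h (List.isChain_cons_cons.2 ⟨hab, h'⟩)
        exact ⟨a :: L₁, c, d, L₂, by rw [h1]; rfl, h2⟩
      · exact ⟨[], a, b, L, rfl, hab⟩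

/-- Merging until no two neighbours can be merged. -/
theorem exists_merged {α : Type} (m t : ℕ) (L : List (α × SketchRec)) :
    ∃ L', Relation.ReflTransGen (MergeStep m t) L L' ∧
      (L'.map Prod.snd).IsChain (Unmergeable m t) := by
  induction hn : L.length using Nat.strong_induction_on generalizing L with
  | _ n ih =>
    by_cases hL : (L.map Prod.snd).IsChain (Unmergeable m t)
    · exact ⟨L, Relation.ReflTransGen.refl, hL⟩
    · rw [List.isChain_map] at hL
      obtain ⟨L₁, a, b, L₂, rfl, hab⟩ := exists_split_of_not_isChain hL
      have hstep : ∃ L', MergeStep m t (L₁ ++ a :: b :: L₂) L' ∧ L'.length < n := by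
        by_cases h : CanMergeRight m t a.2 b.2
        · exact ⟨_, MergeStep.right L₁ L₂ a b h, by rw [← hn]; simp⟩
        · have h' : CanMergeLeft m t a.2 b.2 := by
            by_contra h'
            exact hab ⟨h, h'⟩
          exact ⟨_, MergeStep.left L₁ L₂ a b h', by rw [← hn]; simp⟩
      obtain ⟨L', h1, h2⟩ := hstep
      obtain ⟨L'', h3, h4⟩ := ih _ h2 L' rfl
      exact ⟨L'', Relation.ReflTransGen.head h1 h3, h4⟩

/-- The total number of items represented by the records. -/
def totalMass {α : Type} (L : List (α × SketchRec)) : ℕ := (L.map fun x => x.2.mass).sum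

theorem totalMass_cons {α : Type} (x : α × SketchRec) (L : List (α × SketchRec)) :
    totalMass (x :: L) = x.2.mass + totalMass L := rfl

theorem totalMass_append {α : Type} (L L' : List (α × SketchRec)) :
    totalMass (L ++ L') = totalMass L + totalMass L' := by
  simp [totalMass]

theorem totalMass_map {α β : Type} (f : α → β) (L : List (α × SketchRec)) :
    totalMass (L.map fun x => (f x.1, x.2)) = totalMass L := by
  simp [totalMass, Function.comp_def]

/-- The number of entries of `a` that are at most `x`. -/
noncomputable def countLe (a : List ℝ) (x : ℝ) : ℕ := a.countP fun y => y ≤ x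

/-- The number of entries of `a` that are less than `x`. -/
noncomputable def countLt (a : List ℝ) (x : ℝ) : ℕ := a.countP fun y => y < x

theorem countLe_mono (a : List ℝ) {x y : ℝ} (h : x ≤ y) : countLe a x ≤ countLe a y :=
  List.countP_mono_left fun z _ hz => by
    rw [decide_eq_true_eq] at hz ⊢
    exact hz.trans h

theorem countLt_mono (a : List ℝ) {x y : ℝ} (h : x ≤ y) : countLt a x ≤ countLt a y :=
  List.countP_mono_left fun z _ hz => by
    rw [decide_eq_true_eq] at hz ⊢
    exact hz.trans_le h

theorem countLe_le_countLt (a : List ℝ) {x y : ℝ} (h : x < y) : countLe a x ≤ countLt a y :=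
  List.countP_mono_left fun z _ hz => by
    rw [decide_eq_true_eq] at hz ⊢
    exact hz.trans_lt h

theorem countLe_append_singleton (a : List ℝ) (v x : ℝ) :
    countLe (a ++ [v]) x = countLe a x + if v ≤ x then 1 else 0 := by
  simp [countLe, List.countP_append, List.countP_cons]

theorem countLt_append_singleton (a : List ℝ) (v x : ℝ) :
    countLt (a ++ [v]) x = countLt a x + if v < x then 1 else 0 := by
  simp [countLt, List.countP_append, List.countP_cons]

/-- The records determine the ranks of the stored items up to the error `time / m`;
`P` is the number of items represented to the left of the list. -/
def RanksOK (m : ℕ) (a : List ℝ) : ℕ → List (ℝ × SketchRec) → Prop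
  | _, [] => True
  | P, x :: L =>
    (m * (P + x.2.left + 1) ≤ m * countLe a x.1 + x.2.time ∧
      m * countLt a x.1 ≤ m * (P + x.2.left) + x.2.time) ∧ RanksOK m a (P + x.2.mass) L

theorem ranksOK_append (m : ℕ) (a : List ℝ) (P : ℕ) (L L' : List (ℝ × SketchRec)) :
    RanksOK m a P (L ++ L') ↔ RanksOK m a P L ∧ RanksOK m a (P + totalMass L) L' := by
  induction L generalizing P with
  | nil => simp [RanksOK, totalMass]
  | cons x L ih =>
    simp only [List.cons_append, RanksOK, ih, totalMass_cons, and_assoc, add_assoc]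

/-- `L` is a summary of the stream `a`, with error at most `1 / m` of its length. -/
structure SketchInv (m : ℕ) (a : List ℝ) (L : List (ℝ × SketchRec)) : Prop where
  mass_eq : totalMass L = a.length
  sorted : L.Pairwise fun x y => x.1 ≤ y.1
  left_le : ∀ x ∈ L, m * x.2.left + x.2.time ≤ a.length
  right_le : ∀ x ∈ L, m * x.2.right + x.2.time ≤ a.length
  ranks : RanksOK m a 0 L
  potential : ∀ φ : ℕ → ℝ, Monotone φ →
    (L.map fun x => (x.2.mass : ℝ) * φ x.2.time).sum ≤ ∑ s ∈ Finset.range a.length, φ s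

theorem SketchInv.nil (m : ℕ) : SketchInv m [] [] :=
  ⟨rfl, List.Pairwise.nil, by simp, by simp, trivial, by simp⟩

/-- For the surviving record the mass to its left, `P + left`, does not change, and neither does it
for records further on. Mass moves to an older record, so sums weighted by a monotone function of
time can only decrease. -/
theorem SketchInv.mergeStep {m : ℕ} {a : List ℝ} {L L' : List (ℝ × SketchRec)}
    (h : SketchInv m a L) (hL : MergeStep m a.length L L') : SketchInv m a L' := by
  obtain ⟨h1, h2, h3, h4, h5, h6⟩ := h
  cases hL with
  | right L₁ L₂ w v hm =>
    obtain ⟨hm1, hm2⟩ := hm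
    refine ⟨?_, ?_, ?_, ?_, ?_, ?_⟩
    · rw [← h1]
      simp only [totalMass_append, totalMass_cons, mass]
      ring
    · rw [List.pairwise_append, List.pairwise_cons, List.pairwise_cons] at h2
      rw [List.pairwise_append, List.pairwise_cons]
      refine ⟨h2.1, ⟨fun x hx => h2.2.1.1 x (by simp [hx]), h2.2.1.2.2⟩, fun x hx y hy => ?_⟩
      rcases List.mem_cons.1 hy with rfl | hy
      · exact h2.2.2 x hx w (by simp)
      · exact h2.2.2 x hx y (by simp [hy])
    · intro x hx
      rcases List.mem_append.1 hx with hx | hx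
      · exact h3 x (by simp [hx])
      · rcases List.mem_cons.1 hx with rfl | hx
        · exact h3 w (by simp)
        · exact h3 x (by simp [hx])
    · intro x hx
      rcases List.mem_append.1 hx with hx | hx
      · exact h4 x (by simp [hx])
      · rcases List.mem_cons.1 hx with rfl | hx
        · exact hm2
        · exact h4 x (by simp [hx])
    · rw [ranksOK_append] at h5 ⊢
      refine ⟨h5.1, h5.2.1, ?_⟩
      have := h5.2.2.2
      convert this using 1
      simp only [mass]
      ring
    · intro φ hφ
      refine le_trans ?_ (h6 φ hφ)
      simp only [List.map_append, List.map_cons, List.sum_append, List.sum_cons, mass]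
      have := mul_le_mul_of_nonneg_left (hφ hm1) (Nat.cast_nonneg (α := ℝ) v.2.mass)
      simp only [mass] at this
      push_cast at this ⊢
      linarith
  | left L₁ L₂ v w hm =>
    obtain ⟨hm1, hm2⟩ := hm
    refine ⟨?_, ?_, ?_, ?_, ?_, ?_⟩
    · rw [← h1]
      simp only [totalMass_append, totalMass_cons, mass]
      ring
    · rw [List.pairwise_append, List.pairwise_cons, List.pairwise_cons] at h2
      rw [List.pairwise_append, List.pairwise_cons]
      refine ⟨h2.1, ⟨fun x hx => h2.2.1.2.1 x hx, h2.2.1.2.2⟩, fun x hx y hy => ?_⟩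
      rcases List.mem_cons.1 hy with rfl | hy
      · exact h2.2.2 x hx w (by simp)
      · exact h2.2.2 x hx y (by simp [hy])
    · intro x hx
      rcases List.mem_append.1 hx with hx | hx
      · exact h3 x (by simp [hx])
      · rcases List.mem_cons.1 hx with rfl | hx
        · exact hm2
        · exact h3 x (by simp [hx])
    · intro x hx
      rcases List.mem_append.1 hx with hx | hx
      · exact h4 x (by simp [hx])
      · rcases List.mem_cons.1 hx with rfl | hx
        · exact h4 w (by simp)
        · exact h4 x (by simp [hx])
    · rw [ranksOK_append] at h5 ⊢
      refine ⟨h5.1, ?_, ?_⟩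
      · have := h5.2.2.1
        convert this using 4 <;> simp only [mass] <;> ring
      · have := h5.2.2.2
        convert this using 1
        simp only [mass]
        ring
    · intro φ hφ
      refine le_trans ?_ (h6 φ hφ)
      simp only [List.map_append, List.map_cons, List.sum_append, List.sum_cons, mass]
      have := mul_le_mul_of_nonneg_left (hφ hm1) (Nat.cast_nonneg (α := ℝ) v.2.mass)
      simp only [mass] at this
      push_cast at this ⊢
      linarith

theorem SketchInv.merge {m : ℕ} {a : List ℝ} {L L' : List (ℝ × SketchRec)}
    (h : SketchInv m a L) (hL : Relation.ReflTransGen (MergeStep m a.length) L L') :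
    SketchInv m a L' := by
  induction hL with
  | refl => exact h
  | tail _ hstep ih => exact ih.mergeStep hstep

/-- The last record of `K₁` has rank error `time / m` and has absorbed at most `(N - time) / m`
items from its right. The two errors add up to `N / m`; this is why `time` is charged to the merging
budget. -/
theorem SketchInv.mul_totalMass_le {m : ℕ} {a : List ℝ} {K₁ K₂ : List (ℝ × SketchRec)}
    (h : SketchInv m a (K₁ ++ K₂)) {c : ℕ} (hc : ∀ x ∈ K₁, countLe a x.1 ≤ c) :
    m * totalMass K₁ ≤ m * c + a.length := by
  rcases List.eq_nil_or_concat K₁ with rfl | ⟨K, x, rfl⟩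
  · simp [totalMass]
  · have h5 := h.ranks
    rw [List.concat_eq_append, List.append_assoc, ranksOK_append] at h5
    have h6 := h5.2.1.1
    have h7 := h.right_le x (by simp)
    have h8 := Nat.mul_le_mul_left m (hc x (by simp))
    rw [List.concat_eq_append, totalMass_append, totalMass_cons]
    simp only [totalMass, mass, List.map_nil, List.sum_nil] at h6 ⊢
    nlinarith

/-- Symmetric to `SketchInv.mul_totalMass_le`, with the first record of `K₂` and the items absorbed
from its left. -/
theorem SketchInv.le_mul_totalMass {m : ℕ} {a : List ℝ} {K₁ K₂ : List (ℝ × SketchRec)}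
    (h : SketchInv m a (K₁ ++ K₂)) {c : ℕ} (hca : c ≤ a.length)
    (hc : ∀ x ∈ K₂, c ≤ countLt a x.1) :
    m * c ≤ m * totalMass K₁ + a.length := by
  cases K₂ with
  | nil =>
    have h1 := h.mass_eq
    rw [List.append_nil] at h1
    rw [h1]
    have := Nat.mul_le_mul_left m hca
    omega
  | cons x K₂ =>
    have h5 := h.ranks
    rw [ranksOK_append] at h5
    have h6 := h5.2.1.2
    have h7 := h.left_le x (by simp)
    have h8 := Nat.mul_le_mul_left m (hc x (by simp))
    rw [zero_add] at h6
    nlinarith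

theorem filter_append_filter_not {L : List (ℝ × SketchRec)}
    (hL : L.Pairwise fun x y => x.1 ≤ y.1) (p : ℝ → Prop) [DecidablePred p]
    (hp : ∀ x y, x ≤ y → p y → p x) :
    L.filter (fun x => p x.1) ++ L.filter (fun x => ¬ p x.1) = L := by
  induction L with
  | nil => rfl
  | cons x L ih =>
    rw [List.pairwise_cons] at hL
    by_cases hx : p x.1
    · simpa [hx] using ih hL.2
    · have h1 : L.filter (fun x => p x.1) = [] := by
        rw [List.filter_eq_nil_iff]
        intro y hy hpy
        exact hx (hp _ _ (hL.1 y hy) (by simpa using hpy))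
      have h2 := ih hL.2
      rw [h1, List.nil_append] at h2
      simp only [List.filter_cons, hx, h1]
      simp only [decide_false, Bool.false_eq_true, if_false, List.nil_append, not_false_eq_true,
        decide_true, if_true, h2]

/-- The rank of any number is known up to the error `N / m`. -/
theorem SketchInv.rank_bounds {m : ℕ} {a : List ℝ} {L : List (ℝ × SketchRec)}
    (h : SketchInv m a L) (q : ℝ) :
    m * totalMass (L.filter fun x => x.1 ≤ q) ≤ m * countLe a q + a.length ∧
      m * countLe a q ≤ m * totalMass (L.filter fun x => x.1 ≤ q) + a.length := by
  have hsplit := filter_append_filter_not h.sorted (· ≤ q) fun x y hxy hy => hxy.trans hy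
  rw [← hsplit] at h
  constructor
  · refine h.mul_totalMass_le fun x hx => countLe_mono a ?_
    simpa using (List.mem_filter.1 hx).2
  · refine h.le_mul_totalMass List.countP_le_length fun x hx => countLe_le_countLt a ?_
    simpa using (List.mem_filter.1 hx).2

/-- An arrival above a record changes neither its rank nor the estimate; one at or below it raises
the estimate and `countLe` together (`RanksOK.append_ge`). So the error never exceeds its value at
insertion. -/
theorem RanksOK.append_lt {m : ℕ} {a : List ℝ} {P : ℕ} {L : List (ℝ × SketchRec)} {v : ℝ}
    (h : RanksOK m a P L) (hL : ∀ x ∈ L, x.1 < v) : RanksOK m (a ++ [v]) P L := by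
  induction L generalizing P with
  | nil => trivial
  | cons x L ih =>
    have hx := hL x (by simp)
    refine ⟨?_, ih h.2 fun y hy => hL y (by simp [hy])⟩
    rw [countLe_append_singleton, countLt_append_singleton, if_neg (not_le.2 hx),
      if_neg (not_lt.2 hx.le)]
    exact h.1

theorem RanksOK.append_ge {m : ℕ} {a : List ℝ} {P : ℕ} {L : List (ℝ × SketchRec)} {v : ℝ}
    (h : RanksOK m a P L) (hL : ∀ x ∈ L, v ≤ x.1) : RanksOK m (a ++ [v]) (P + 1) L := by
  induction L generalizing P with
  | nil => trivial
  | cons x L ih =>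
    have hx := hL x (by simp)
    refine ⟨?_, ?_⟩
    · rw [countLe_append_singleton, countLt_append_singleton, if_pos hx]
      obtain ⟨⟨h1, h2⟩, -⟩ := h
      constructor
      · nlinarith
      · split_ifs <;> nlinarith
    · have := ih h.2 fun y hy => hL y (by simp [hy])
      rwa [add_right_comm] at this

/-- The list of records after the arrival of `v`, before merging. -/
noncomputable def sketchInsert (v : ℝ) (t : ℕ) (L : List (ℝ × SketchRec)) :
    List (ℝ × SketchRec) :=
  L.filter (fun x => x.1 < v) ++ (v, ⟨t, 0, 0⟩) :: L.filter (fun x => ¬ x.1 < v)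

/-- The mass of the records below `v` estimates the rank of `v` up to `N / m`. This error is what
the new record is granted by its time `N`. -/
theorem SketchInv.insert {m : ℕ} {a : List ℝ} {L : List (ℝ × SketchRec)}
    (h : SketchInv m a L) (v : ℝ) : SketchInv m (a ++ [v]) (sketchInsert v a.length L) := by
  have hsplit := filter_append_filter_not h.sorted (· < v) fun x y hxy hy => hxy.trans_lt hy
  unfold sketchInsert
  have hK₁ : ∀ x ∈ L.filter (fun x => x.1 < v), x.1 < v := fun x hx => by
    simpa using (List.mem_filter.1 hx).2
  have hK₂ : ∀ x ∈ L.filter (fun x => ¬ x.1 < v), v ≤ x.1 := fun x hx => by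
    simpa using (List.mem_filter.1 hx).2
  rw [← hsplit] at h
  set K₁ := L.filter (fun x => x.1 < v)
  set K₂ := L.filter (fun x => ¬ x.1 < v)
  have hlow := h.mul_totalMass_le (c := countLe a v) fun x hx => countLe_mono a (hK₁ x hx).le
  have hupp := h.le_mul_totalMass (c := countLt a v) List.countP_le_length
    fun x hx => countLt_mono a (hK₂ x hx)
  obtain ⟨h1, h2, h3, h4, h5, h6⟩ := h
  have hmem : ∀ x ∈ K₁ ++ (v, ⟨a.length, 0, 0⟩) :: K₂,
      x = (v, ⟨a.length, 0, 0⟩) ∨ x ∈ K₁ ++ K₂ := by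
    intro x hx
    simp only [List.mem_append, List.mem_cons] at hx ⊢
    tauto
  refine ⟨?_, ?_, ?_, ?_, ?_, ?_⟩
  · rw [totalMass_append] at h1 ⊢
    rw [totalMass_cons, List.length_append, ← h1]
    simp [mass]
    ring
  · rw [List.pairwise_append] at h2 ⊢
    refine ⟨h2.1, List.pairwise_cons.2 ⟨hK₂, h2.2.1⟩, fun x hx y hy => ?_⟩
    rcases List.mem_cons.1 hy with rfl | hy
    · exact (hK₁ x hx).le
    · exact h2.2.2 x hx y hy
  · intro x hx
    rw [List.length_append]
    rcases hmem x hx with rfl | hx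
    · simp
    · have := h3 x hx
      omega
  · intro x hx
    rw [List.length_append]
    rcases hmem x hx with rfl | hx
    · simp
    · have := h4 x hx
      omega
  · rw [ranksOK_append] at h5 ⊢
    refine ⟨h5.1.append_lt hK₁, ⟨?_, ?_⟩, ?_⟩
    · rw [countLe_append_singleton, if_pos le_rfl]
      simp only [zero_add, add_zero]
      nlinarith
    · rw [countLt_append_singleton, if_neg (lt_irrefl v)]
      simpa using hupp
    · have := h5.2.append_ge hK₂
      simpa [mass] using this
  · intro φ hφ
    have h7 := h6 φ hφ
    rw [List.length_append, List.length_singleton, Finset.sum_range_succ]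
    simp only [List.map_append, List.map_cons, List.sum_append, List.sum_cons] at h7 ⊢
    simp only [mass, zero_add, add_zero, Nat.cast_one, one_mul] at h7 ⊢
    linarith

/-- Sum the inequality over all neighbours: every element occurs in at most two of them. -/
theorem length_le_of_isChain {α : Type*} {R : α → α → Prop} {f : α → ℝ} (hf : ∀ a, 0 ≤ f a)
    (hR : ∀ a b, R a b → 1 ≤ f a + f b) {L : List α} (hL : L.IsChain R) :
    (L.length : ℝ) ≤ 1 + 2 * (L.map f).sum := by
  have key : ∀ (L : List α) (a : α), (a :: L).IsChain R →
      ((a :: L).length : ℝ) ≤ 1 + f a + 2 * (L.map f).sum := by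
    intro L
    induction L with
    | nil =>
      intro a _
      simp [hf a]
    | cons b L ih =>
      intro a h
      rw [List.isChain_cons_cons] at h
      have h1 := ih b h.2
      have h2 := hR a b h.1
      simp only [List.length_cons, List.map_cons, List.sum_cons] at h1 ⊢
      push_cast at h1 ⊢
      linarith
  cases L with
  | nil => simp
  | cons a L =>
    have := key L a hL
    have h1 := hf a
    simp only [List.map_cons, List.sum_cons]
    linarith

/-- The first `m` terms are `1 / m` and sum to at most `1`; the rest is a harmonic sum of size `log
(t / m)`. Cutting off at `m` makes the bound depend on `t / m` alone, which gives `log OPT` for a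
class of at most `m * OPT` items. -/
theorem sum_inv_max_le {m : ℕ} (hm : 0 < m) (t : ℕ) {X : ℝ} (hX : 1 ≤ X) (ht : (t : ℝ) ≤ m * X) :
    ∑ j ∈ Finset.range t, (1 / max ((j : ℝ) + 1) m) ≤ 1 + Real.log X := by
  have hm' : (0 : ℝ) < m := by exact_mod_cast hm
  have h1 : ∀ t : ℕ, t ≤ m → ∑ j ∈ Finset.range t, (1 / max ((j : ℝ) + 1) m) ≤ 1 := by
    intro t ht
    calc ∑ j ∈ Finset.range t, (1 / max ((j : ℝ) + 1) m)
        ≤ ∑ _j ∈ Finset.range t, (1 / (m : ℝ)) := by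
          refine Finset.sum_le_sum fun j _ => ?_
          exact one_div_le_one_div_of_le hm' (le_max_right _ _)
      _ = t / m := by simp [div_eq_mul_inv]
      _ ≤ 1 := by
          rw [div_le_one hm']
          exact_mod_cast ht
  have h2 : ∀ t : ℕ, m ≤ t →
      ∑ j ∈ Finset.range t, (1 / max ((j : ℝ) + 1) m) ≤ 1 + Real.log (t / m) := by
    intro t ht
    induction t, ht using Nat.le_induction with
    | base => rw [div_self hm'.ne', Real.log_one, add_zero]; exact h1 m le_rfl
    | succ t ht ih =>
      have ht0 : (0 : ℝ) < t := hm'.trans_le (by exact_mod_cast ht)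
      rw [Finset.sum_range_succ]
      have h3 : 1 / max ((t : ℝ) + 1) m ≤ 1 / ((t : ℝ) + 1) :=
        one_div_le_one_div_of_le (by linarith) (le_max_left _ _)
      have h4 : Real.log (((t + 1 : ℕ) : ℝ) / m) = Real.log (t / m) + Real.log ((t + 1) / t) := by
        rw [← Real.log_mul (by positivity) (by positivity)]
        congr 1
        push_cast
        field_simp
      have h5 := Real.one_sub_inv_le_log_of_pos (x := ((t : ℝ) + 1) / t) (by positivity)
      have h6 : 1 - (((t : ℝ) + 1) / t)⁻¹ = 1 / ((t : ℝ) + 1) := by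
        field_simp
        ring
      rw [h4]
      linarith
  rcases le_total t m with h | h
  · exact (h1 t h).trans (by linarith [Real.log_nonneg hX])
  · refine (h2 t h).trans ?_
    have ht0 : (0 : ℝ) < t := hm'.trans_le (by exact_mod_cast h)
    have : Real.log (t / m) ≤ Real.log X :=
      Real.log_le_log (by positivity) (by rw [div_le_iff₀ hm']; linarith)
    linarith

/-- A summary in which no neighbours can be merged is short. -/
theorem SketchInv.length_le {m : ℕ} (hm : 0 < m) {a : List ℝ} {L : List (ℝ × SketchRec)}
    (h : SketchInv m a L) (hL : (L.map Prod.snd).IsChain (Unmergeable m a.length)) {X : ℝ}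
    (hX : 1 ≤ X) (ha : (a.length : ℝ) ≤ m * X) :
    (L.length : ℝ) ≤ 1 + 2 * m * (1 + Real.log X) := by
  have hm' : (0 : ℝ) < m := by exact_mod_cast hm
  set t := a.length with ht
  -- If `w` is the older of two unmergeable neighbours, their joint mass exceeds `(t - w.time) / m`.
  -- With this weight each such pair counts at least `1`, while the potential bounds the total
  -- weight by a sum over arrival times.
  let φ : ℕ → ℝ := fun s => 1 / max ((t : ℝ) - s) m
  have hpos : ∀ s : ℕ, 0 < max ((t : ℝ) - s) m := fun s => lt_max_of_lt_right hm'
  have hφ : Monotone φ := fun s s' hs => by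
    refine one_div_le_one_div_of_le (hpos s') (max_le_max ?_ le_rfl)
    have : (s : ℝ) ≤ s' := by exact_mod_cast hs
    linarith
  have hφ0 : ∀ s, 0 ≤ φ s := fun s => (one_div_pos.2 (hpos s)).le
  have key : ∀ w v : SketchRec, w.time ≤ v.time → t < m * (w.mass + v.mass) + w.time →
      1 ≤ m * (w.mass * φ w.time) + m * (v.mass * φ v.time) := by
    intro w v hwv hlt
    have h1 : max ((t : ℝ) - w.time) m ≤ m * (w.mass + v.mass) := by
      refine max_le ?_ ?_
      · have : (t : ℝ) < ((m * (w.mass + v.mass) + w.time : ℕ) : ℝ) := by exact_mod_cast hlt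
        push_cast at this
        linarith
      · refine le_mul_of_one_le_right hm'.le ?_
        have : 1 ≤ w.mass + v.mass := by unfold mass; omega
        exact_mod_cast this
    have h2 : 1 ≤ m * (w.mass + v.mass) * φ w.time := by
      have : (m * (w.mass + v.mass) : ℝ) * φ w.time
          = m * (w.mass + v.mass) / max ((t : ℝ) - w.time) m := by
        simp only [φ]
        ring
      rw [this, le_div_iff₀ (hpos _)]
      linarith
    have h3 := mul_le_mul_of_nonneg_left (hφ hwv)
      (by positivity : (0 : ℝ) ≤ m * v.mass)
    linarith
  have h1 := length_le_of_isChain (R := Unmergeable m t)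
    (f := fun x : SketchRec => m * (x.mass * φ x.time))
    (fun x => mul_nonneg hm'.le (mul_nonneg (Nat.cast_nonneg _) (hφ0 _))) (fun a b hab => by
      obtain ⟨h1, h2⟩ := hab
      rcases le_total a.time b.time with h | h
      · refine key a b h ?_
        by_contra! hcon
        refine h1 ⟨h, le_trans ?_ hcon⟩
        unfold mass
        gcongr
        omega
      · rw [add_comm]
        refine key b a h ?_
        by_contra! hcon
        refine h2 ⟨h, le_trans ?_ hcon⟩
        unfold mass
        gcongr
        omega) hL
  have h2 := h.potential φ hφ
  have h3 : ∑ s ∈ Finset.range t, φ s = ∑ j ∈ Finset.range t, (1 / max ((j : ℝ) + 1) m) := by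
    rw [← Finset.sum_range_reflect]
    refine Finset.sum_congr rfl fun j hj => ?_
    have hj' := Finset.mem_range.1 hj
    have : ((t - 1 - j : ℕ) : ℝ) = t - 1 - j := by
      rw [Nat.cast_sub (by omega), Nat.cast_sub (by omega)]
      simp
    simp only [φ, this]
    ring_nf
  rw [h3] at h2
  have h4 := h2.trans (sum_inv_max_le hm t hX ha)
  rw [List.length_map, List.map_map] at h1
  have h5 : (L.map ((fun x : SketchRec => (m : ℝ) * (x.mass * φ x.time)) ∘ Prod.snd)).sum
      = m * (L.map fun x => (x.2.mass : ℝ) * φ x.2.time).sum := by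
    rw [← List.sum_map_mul_left]
    rfl
  rw [h5] at h1
  have h6 := mul_le_mul_of_nonneg_left h4 hm'.le
  linarith

/-! ### Inputs with similar ranks need similar numbers of bins -/

theorem countLe_add_streamRank (a : List ℝ) (q : ℝ) : countLe a q + streamRank a q = a.length := by
  have := streamRank_add_countP a id q (fun x => x ≤ q) fun e _ => not_le.symm
  rw [List.map_id] at this
  rw [add_comm]
  exact this

theorem streamRank_eq_zero {a : List ℝ} {q : ℝ} (h : ∀ x ∈ a, x ≤ q) : streamRank a q = 0 := by
  unfold streamRank
  rw [List.length_eq_zero_iff, List.filter_eq_nil_iff]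
  intro x hx
  simpa using h x hx

theorem List.Perm.streamRank_eq {a b : List ℝ} (h : a.Perm b) (q : ℝ) :
    streamRank a q = streamRank b q := (h.filter _).length_eq

/-- If `a'` has at most `D` more entries above any number than `a`, then up to `D` entries
it is dominated by `a`. -/
theorem exists_dominated_of_sorted {a' a : List ℝ} (ha' : a'.Pairwise (· ≥ ·))
    (ha : a.Pairwise (· ≥ ·)) {D : ℕ} (h : ∀ q, streamRank a' q ≤ streamRank a q + D) :
    ∃ b e c : Multiset ℝ, (a' : Multiset ℝ) = b + e ∧ c ≤ (a : Multiset ℝ) ∧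
      Multiset.Rel (· ≤ ·) b c ∧ e.card ≤ D := by
  induction a' generalizing a D with
  | nil => exact ⟨0, 0, 0, by simp, by simp, Multiset.Rel.zero, by simp⟩
  | cons x a' ih =>
    rw [List.pairwise_cons] at ha'
    have hzero : ∀ q, x ≤ q → streamRank a' q = 0 := fun q hq =>
      streamRank_eq_zero fun y hy => (ha'.1 y hy).trans hq
    -- `x` is the largest entry of `a'`. If no entry of `a` reaches it, it becomes an exception and
    -- uses up one unit of `D`; otherwise it is matched with the largest entry of `a`.
    have hexc : ∀ q₀ : ℝ, q₀ < x → streamRank a q₀ = 0 → ∃ b e c : Multiset ℝ,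
        ((x :: a' : List ℝ) : Multiset ℝ) = b + e ∧ c ≤ (a : Multiset ℝ) ∧
        Multiset.Rel (· ≤ ·) b c ∧ e.card ≤ D := by
      intro q₀ hq₀ hq₀'
      have hD := h q₀
      rw [streamRank_cons, if_pos hq₀, hq₀'] at hD
      obtain ⟨b, e, c, h1, h2, h3, h4⟩ := ih ha'.2 ha (D := D - 1) fun q => by
        by_cases hq : q < x
        · have := h q
          rw [streamRank_cons, if_pos hq] at this
          omega
        · rw [hzero q (not_lt.1 hq)]
          omega
      refine ⟨b, x ::ₘ e, c, ?_, h2, h3, ?_⟩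
      · rw [← Multiset.cons_coe, h1, Multiset.add_cons]
      · rw [Multiset.card_cons]
        omega
    cases a with
    | nil => exact hexc (x - 1) (by linarith) rfl
    | cons y a =>
      rw [List.pairwise_cons] at ha
      by_cases hxy : x ≤ y
      · obtain ⟨b, e, c, h1, h2, h3, h4⟩ := ih ha'.2 ha.2 (D := D) fun q => by
          by_cases hq : q < x
          · have := h q
            rw [streamRank_cons, if_pos hq, streamRank_cons, if_pos (hq.trans_le hxy)] at this
            omega
          · rw [hzero q (not_lt.1 hq)]
            omega
        refine ⟨x ::ₘ b, e, y ::ₘ c, ?_, ?_, Multiset.Rel.cons hxy h3, h4⟩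
        · rw [← Multiset.cons_coe, h1, Multiset.cons_add]
        · rw [← Multiset.cons_coe]
          exact Multiset.cons_le_cons y h2
      · push Not at hxy
        refine hexc y hxy ?_
        refine streamRank_eq_zero fun z hz => ?_
        rcases List.mem_cons.1 hz with rfl | hz
        · exact le_rfl
        · exact ha.1 z hz

theorem exists_dominated {a' a : List ℝ} {D : ℕ}
    (h : ∀ q, streamRank a' q ≤ streamRank a q + D) :
    ∃ b e c : Multiset ℝ, (a' : Multiset ℝ) = b + e ∧ c ≤ (a : Multiset ℝ) ∧
      Multiset.Rel (· ≤ ·) b c ∧ e.card ≤ D := by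
  have hsort : ∀ l : List ℝ, ∃ l' : List ℝ, l'.Perm l ∧ l'.Pairwise (· ≥ ·) := fun l =>
    ⟨l.insertionSort (· ≥ ·), List.perm_insertionSort _ _, List.pairwise_insertionSort _ _⟩
  obtain ⟨s', hs', hs'1⟩ := hsort a'
  obtain ⟨s, hs, hs1⟩ := hsort a
  have := exists_dominated_of_sorted hs'1 hs1 (D := D) fun q => by
    rw [hs'.streamRank_eq, hs.streamRank_eq]
    exact h q
  rwa [Multiset.coe_eq_coe.2 hs', Multiset.coe_eq_coe.2 hs] at this

/-- The items of `I` with sizes between `2 ^ (-(j + 1))` and `2 ^ (-j)`. -/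
noncomputable def sizeClass (j : ℕ) (I : List ℝ) : List ℝ :=
  I.filter fun x => (1 / 2 : ℝ) ^ (j + 1) < x ∧ x ≤ (1 / 2 : ℝ) ^ j

/-- The items of `I` of size at most `2 ^ (-k)`. -/
noncomputable def smallItems (k : ℕ) (I : List ℝ) : List ℝ :=
  I.filter fun x => x ≤ (1 / 2 : ℝ) ^ k

theorem mem_sizeClass {j : ℕ} {I : List ℝ} {x : ℝ} :
    x ∈ sizeClass j I ↔ x ∈ I ∧ (1 / 2 : ℝ) ^ (j + 1) < x ∧ x ≤ (1 / 2 : ℝ) ^ j := by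
  simp [sizeClass]

theorem half_pow_succ_le (k : ℕ) : (1 / 2 : ℝ) ^ (k + 1) ≤ (1 / 2 : ℝ) ^ k :=
  pow_le_pow_of_le_one (by norm_num) (by norm_num) (Nat.le_succ k)

theorem IsBPInput.smallItems_add_sum {I : List ℝ} (hI : IsBPInput I) (k : ℕ) :
    (smallItems k I : Multiset ℝ) + ∑ j ∈ Finset.range k, (sizeClass j I : Multiset ℝ) = I := by
  induction k with
  | zero =>
    simp only [Finset.range_zero, Finset.sum_empty, add_zero, smallItems, pow_zero]
    rw [List.filter_eq_self.2 fun x hx => by simpa using (hI x hx).2]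
  | succ k ih =>
    rw [Finset.sum_range_succ, ← add_assoc, add_right_comm]
    refine Eq.trans ?_ ih
    congr 1
    rw [Multiset.coe_add, Multiset.coe_eq_coe]
    unfold smallItems sizeClass
    clear ih hI
    induction I with
    | nil => simp
    | cons x I ih =>
      simp only [List.filter_cons, decide_eq_true_eq]
      have hk := half_pow_succ_le k
      by_cases h1 : x ≤ (1 / 2 : ℝ) ^ (k + 1)
      · have h2 : x ≤ (1 / 2 : ℝ) ^ k := h1.trans hk
        have h3 : ¬ ((1 / 2 : ℝ) ^ (k + 1) < x ∧ x ≤ (1 / 2 : ℝ) ^ k) :=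
          fun h => absurd h1 (not_le.2 h.1)
        rw [if_pos h1, if_neg h3, if_pos h2]
        exact ih.cons x
      · by_cases h2 : x ≤ (1 / 2 : ℝ) ^ k
        · have h3 : ((1 / 2 : ℝ) ^ (k + 1) < x ∧ x ≤ (1 / 2 : ℝ) ^ k) := ⟨not_le.1 h1, h2⟩
          rw [if_neg h1, if_pos h3, if_pos h2]
          exact List.perm_middle.trans (ih.cons x)
        · have h3 : ¬ ((1 / 2 : ℝ) ^ (k + 1) < x ∧ x ≤ (1 / 2 : ℝ) ^ k) := fun h => h2 h.2
          rw [if_neg h1, if_neg h3, if_neg h2]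
          exact ih

theorem multiset_sum_finset_sum {ι : Type*} (J : Finset ι) (s : ι → Multiset ℝ) :
    (∑ j ∈ J, s j).sum = ∑ j ∈ J, (s j).sum :=
  map_sum (Multiset.sumAddMonoidHom (M := ℝ)) s J

theorem multiset_rel_sum {ι : Type*} (J : Finset ι) {b c : ι → Multiset ℝ}
    (h : ∀ j ∈ J, Multiset.Rel (· ≤ ·) (b j) (c j)) :
    Multiset.Rel (· ≤ ·) (∑ j ∈ J, b j) (∑ j ∈ J, c j) := by
  classical
  induction J using Finset.induction_on with
  | empty => simp
  | insert i J hi ih =>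
    rw [Finset.sum_insert hi, Finset.sum_insert hi]
    exact (h i (by simp)).add (ih fun j hj => h j (by simp [hj]))

theorem IsBPInput.sum_eq {I : List ℝ} (hI : IsBPInput I) (k : ℕ) :
    I.sum = (smallItems k I).sum + ∑ j ∈ Finset.range k, (sizeClass j I).sum := by
  have := congrArg Multiset.sum (hI.smallItems_add_sum k)
  rw [Multiset.sum_add, multiset_sum_finset_sum] at this
  simpa using this.symm

theorem IsBPInput.smallItems_sum_nonneg {I : List ℝ} (hI : IsBPInput I) (k : ℕ) :
    0 ≤ (smallItems k I).sum :=
  List.sum_nonneg fun x hx => (hI x (List.mem_of_mem_filter hx)).1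

theorem IsBPInput.sizeClass_sum_nonneg {I : List ℝ} (hI : IsBPInput I) (j : ℕ) :
    0 ≤ (sizeClass j I).sum :=
  List.sum_nonneg fun x hx => (hI x (List.mem_of_mem_filter hx)).1

theorem length_sizeClass_mul_le (j : ℕ) (I : List ℝ) :
    ((sizeClass j I).length : ℝ) * (1 / 2) ^ (j + 1) ≤ (sizeClass j I).sum := by
  have := List.card_nsmul_le_sum (sizeClass j I) ((1 / 2 : ℝ) ^ (j + 1))
    fun x hx => (mem_sizeClass.1 hx).2.1.le
  rwa [nsmul_eq_mul] at this

theorem IsBPInput.length_sizeClass_le {I : List ℝ} (hI : IsBPInput I) {j k : ℕ} (hj : j < k) :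
    ((sizeClass j I).length : ℝ) ≤ 2 ^ k * binOPT I := by
  have h1 := length_sizeClass_mul_le j I
  have h2 := hI.sum_le_binOPT
  rw [hI.sum_eq k] at h2
  have h3 : (sizeClass j I).sum ≤ ∑ j ∈ Finset.range k, (sizeClass j I).sum :=
    Finset.single_le_sum (f := fun j => (sizeClass j I).sum)
      (fun i _ => hI.sizeClass_sum_nonneg i) (Finset.mem_range.2 hj)
  have h4 := hI.smallItems_sum_nonneg k
  have h5 : ((sizeClass j I).length : ℝ) * (1 / 2) ^ (j + 1) ≤ binOPT I := by linarith
  have h6 : ((sizeClass j I).length : ℝ) ≤ 2 ^ (j + 1) * binOPT I := by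
    rw [one_div, inv_pow, ← div_eq_mul_inv, div_le_iff₀ (by positivity)] at h5
    linarith
  refine h6.trans ?_
  gcongr
  · norm_num
  · omega

/-- Two inputs that a summary of error `1 / m` for each size class cannot tell apart need about
the same number of bins. -/
theorem binOPT_le_of_similar {I I' : List ℝ} (hI : IsBPInput I) (hI' : IsBPInput I') {k m : ℕ}
    {ε : ℝ} (hε : 0 < ε) (hε1 : ε ≤ 1 / 2) (hk : (1 / 2 : ℝ) ^ k ≤ ε / 4) (hm : 16 ≤ ε * m)
    (hsmall : (smallItems k I').sum = (smallItems k I).sum)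
    (hrank : ∀ j < k, ∀ q, m * streamRank (sizeClass j I') q
      ≤ m * streamRank (sizeClass j I) q + 2 * (sizeClass j I).length) :
    (binOPT I' : ℝ) ≤ (1 + ε) * binOPT I + (k + 3) := by
  have hm0 : (0 : ℝ) < m := by
    by_contra! h
    nlinarith
  have hm0' : 0 < m := by exact_mod_cast hm0
  set O := binOPT I with hO
  let N : ℕ → ℕ := fun j => (sizeClass j I).length
  -- The number of exceptions in class `j` allowed by `hrank`.
  let D : ℕ → ℕ := fun j => 2 * N j / m
  have hex : ∀ j, ∃ b e c : Multiset ℝ, j < k → (sizeClass j I' : Multiset ℝ) = b + e ∧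
      c ≤ (sizeClass j I : Multiset ℝ) ∧ Multiset.Rel (· ≤ ·) b c ∧ e.card ≤ D j := by
    intro j
    by_cases hj : j < k
    · obtain ⟨b, e, c, h⟩ := exists_dominated (a' := sizeClass j I') (a := sizeClass j I)
        (D := D j) fun q => by
          have h1 := hrank j hj q
          by_cases h2 : streamRank (sizeClass j I') q ≤ streamRank (sizeClass j I) q
          · omega
          · have h3 : streamRank (sizeClass j I') q - streamRank (sizeClass j I) q ≤ D j := by
              rw [Nat.le_div_iff_mul_le hm0', Nat.sub_mul, mul_comm _ m, mul_comm _ m]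
              simp only [N]
              omega
            omega
      exact ⟨b, e, c, fun _ => h⟩
    · exact ⟨0, 0, 0, fun h => absurd h hj⟩
  choose b e c hbec using hex
  have hmemk : ∀ j ∈ Finset.range k, j < k := fun j hj => Finset.mem_range.1 hj
  have hI0 : ∀ x ∈ (I : Multiset ℝ), 0 ≤ x := fun x hx => (hI x (by simpa using hx)).1
  have hcI : (smallItems k I : Multiset ℝ) + ∑ j ∈ Finset.range k, c j ≤ I := by
    conv_rhs => rw [← hI.smallItems_add_sum k]
    gcongr with j hj
    exact (hbec j (hmemk j hj)).2.1
  have hcI' : ∑ j ∈ Finset.range k, c j ≤ (I : Multiset ℝ) :=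
    (Multiset.le_add_left _ _).trans hcI
  have hpb : PackableMultiset (∑ j ∈ Finset.range k, b j) O :=
    (hI.packable_binOPT.of_le hcI' hI0).of_rel
      (multiset_rel_sum _ fun j hj => (hbec j (hmemk j hj)).2.2.1)
  have heItem : ∀ j < k, ∀ x ∈ e j, x ≤ (1 / 2 : ℝ) ^ j := fun j hj x hx => by
    have h1 : x ∈ (sizeClass j I' : Multiset ℝ) := by
      rw [(hbec j hj).1]
      exact Multiset.mem_add.2 (Or.inr hx)
    exact (mem_sizeClass.1 (Multiset.mem_coe.1 h1)).2.2
  have hpe : PackableMultiset (∑ j ∈ Finset.range k, e j)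
      (∑ j ∈ Finset.range k, (D j / 2 ^ j + 1)) := by
    refine PackableMultiset.sum _ _ _ fun j hj => ?_
    refine PackableMultiset.of_card_le (p := 2 ^ j) (fun x hx => ?_) (by positivity) ?_
    · have h1 := heItem j (hmemk j hj) x hx
      have h2 : (1 / 2 : ℝ) ^ j * 2 ^ j = 1 := by
        rw [← mul_pow]; norm_num
      push_cast
      rw [← h2]
      exact mul_le_mul_of_nonneg_right h1 (by positivity)
    · refine (hbec j (hmemk j hj)).2.2.2.trans ?_
      rw [add_mul, one_mul]
      exact (Nat.lt_div_mul_add (by positivity)).le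
  -- An exception takes at most `2 ^ (-j)` of a bin. All items of the class exceed half of that, so
  -- the exceptions cost at most `4 / m ≤ ε / 4` times the size of the class.
  have hD : ∀ j, (D j : ℝ) * (1 / 2) ^ j ≤ ε / 4 * (sizeClass j I).sum := by
    intro j
    have h1 : (D j : ℝ) ≤ 2 * N j / m := by
      have := Nat.cast_div_le (α := ℝ) (m := 2 * N j) (n := m)
      push_cast at this
      exact this
    have h2 := length_sizeClass_mul_le j I
    have h3 : (2 : ℝ) / m ≤ ε / 8 := by
      rw [div_le_div_iff₀ hm0 (by norm_num)]
      linarith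
    have h4 : (2 * N j / m : ℝ) = N j * (2 / m) := by ring
    have h5 : (N j : ℝ) * (2 / m) ≤ N j * (ε / 8) :=
      mul_le_mul_of_nonneg_left h3 (Nat.cast_nonneg _)
    have h6 : (D j : ℝ) ≤ N j * (ε / 8) := by linarith
    have h7 := mul_le_mul_of_nonneg_right h6 (by positivity : (0 : ℝ) ≤ (1 / 2) ^ j)
    have h8 := mul_le_mul_of_nonneg_left h2 (by positivity : 0 ≤ ε / 4)
    rw [pow_succ] at h8
    simp only [N] at h7 ⊢
    linarith
  have hsumI := hI.sum_eq k
  have hsumO := hI.sum_le_binOPT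
  have hclass : ∑ j ∈ Finset.range k, (sizeClass j I).sum ≤ O := by
    have := hI.smallItems_sum_nonneg k
    linarith
  have hDsum : ∑ j ∈ Finset.range k, (D j : ℝ) * (1 / 2) ^ j ≤ ε / 4 * O := by
    refine (Finset.sum_le_sum fun j _ => hD j).trans ?_
    rw [← Finset.mul_sum]
    exact mul_le_mul_of_nonneg_left hclass (by positivity)
  have hbins : ((∑ j ∈ Finset.range k, (D j / 2 ^ j + 1) : ℕ) : ℝ) ≤ ε / 4 * O + k := by
    push_cast
    rw [Finset.sum_add_distrib]
    simp only [Finset.sum_const, Finset.card_range, nsmul_eq_mul, mul_one]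
    refine add_le_add (le_trans (Finset.sum_le_sum fun j _ => ?_) hDsum) le_rfl
    have := Nat.cast_div_le (α := ℝ) (m := D j) (n := 2 ^ j)
    push_cast at this
    rw [one_div, inv_pow, ← div_eq_mul_inv]
    exact this
  have hpack := hpb.add hpe
  have hbig : ∑ j ∈ Finset.range k, b j + ∑ j ∈ Finset.range k, e j
      = ∑ j ∈ Finset.range k, (sizeClass j I' : Multiset ℝ) := by
    rw [← Finset.sum_add_distrib]
    exact Finset.sum_congr rfl fun j hj => (hbec j (hmemk j hj)).1.symm
  -- Dominated items are no larger than their partners, the exceptions add at most `ε / 4 * O`, and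
  -- the small items have equal totals.
  have hsize : I'.sum ≤ (1 + ε / 4) * O := by
    have h1 := hI'.sum_eq k
    have h2 : ∑ j ∈ Finset.range k, (sizeClass j I').sum
        = (∑ j ∈ Finset.range k, b j).sum + (∑ j ∈ Finset.range k, e j).sum := by
      rw [← Multiset.sum_add, hbig, multiset_sum_finset_sum]
      simp
    have h3 : (∑ j ∈ Finset.range k, b j).sum ≤ (∑ j ∈ Finset.range k, c j).sum :=
      Multiset.sum_le_sum_of_rel_le
        (multiset_rel_sum _ fun j hj => (hbec j (hmemk j hj)).2.2.1)
    have h4 : (smallItems k I).sum + (∑ j ∈ Finset.range k, c j).sum ≤ I.sum := by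
      obtain ⟨u, hu⟩ := Multiset.le_iff_exists_add.1 hcI
      have h5 := congrArg Multiset.sum hu
      have h6 : 0 ≤ u.sum := Multiset.sum_nonneg fun x hx => hI0 x (by rw [hu]; simp [hx])
      rw [Multiset.sum_add, Multiset.sum_add, Multiset.sum_coe, Multiset.sum_coe] at h5
      linarith
    have h5 : (∑ j ∈ Finset.range k, e j).sum ≤ ε / 4 * O := by
      rw [multiset_sum_finset_sum]
      refine le_trans (Finset.sum_le_sum fun j hj => ?_) hDsum
      have h6 := Multiset.sum_le_card_nsmul (e j) _ (heItem j (hmemk j hj))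
      rw [nsmul_eq_mul] at h6
      refine h6.trans (mul_le_mul_of_nonneg_right ?_ (by positivity))
      exact_mod_cast (hbec j (hmemk j hj)).2.2.2
    linarith
  set θ : ℝ := (1 / 2) ^ k with hθ
  have hθ1 : 0 < 1 - θ := by linarith
  -- Enough bins for the large items, and enough capacity at load `1 - θ` for everything. The final
  -- `+ 1` makes `B` positive, as `add_small` requires.
  set B := max (O + ∑ j ∈ Finset.range k, (D j / 2 ^ j + 1)) ⌈(1 + ε / 4) * O / (1 - θ)⌉₊ + 1
    with hB
  have hB1 : (1 + ε / 4) * O / (1 - θ) ≤ B := by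
    refine (Nat.le_ceil _).trans ?_
    have : ⌈(1 + ε / 4) * O / (1 - θ)⌉₊ ≤ B := (le_max_right _ _).trans (Nat.le_succ _)
    exact_mod_cast this
  rw [hbig] at hpack
  have hfin := (hpack.mono ((le_max_left _ ⌈(1 + ε / 4) * O / (1 - θ)⌉₊).trans
    (Nat.le_succ _))).add_small (θ := θ) (Nat.succ_pos _) (smallItems k I' : Multiset ℝ)
    (fun x hx => by
      have hx' := List.mem_filter.1 (Multiset.mem_coe.1 hx)
      exact ⟨(hI' x hx'.1).1, of_decide_eq_true hx'.2⟩) (by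
      rw [add_comm, hI'.smallItems_add_sum, Multiset.sum_coe]
      rw [div_le_iff₀ hθ1] at hB1
      rw [mul_comm]
      exact hsize.trans hB1)
  rw [add_comm, hI'.smallItems_add_sum] at hfin
  have h1 : (binOPT I' : ℝ) ≤ B := by exact_mod_cast binOPT_le hfin
  refine h1.trans ?_
  have h2 : (1 + ε / 4) * O / (1 - θ) ≤ (1 + ε) * O := by
    rw [div_le_iff₀ hθ1]
    have h3 : (1 + ε / 4) ≤ (1 + ε) * (1 - θ) := by nlinarith
    have := mul_le_mul_of_nonneg_right h3 (Nat.cast_nonneg (α := ℝ) O)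
    linarith
  have h4 : (⌈(1 + ε / 4) * O / (1 - θ)⌉₊ : ℝ) ≤ (1 + ε) * O + 1 := by
    have := (Nat.ceil_lt_add_one (a := (1 + ε / 4) * O / (1 - θ)) (by positivity)).le
    linarith
  have h5 : (0 : ℝ) ≤ ε * O := by positivity
  rw [hB]
  push_cast
  have h6 : ((O : ℝ) + ∑ j ∈ Finset.range k, (((D j / 2 ^ j : ℕ) : ℝ) + 1)) ≤
      (1 + ε) * O + k + 1 := by
    push_cast at hbins
    linarith
  have h7 : max ((O : ℝ) + ∑ j ∈ Finset.range k, (((D j / 2 ^ j : ℕ) : ℝ) + 1))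
      (⌈(1 + ε / 4) * O / (1 - θ)⌉₊ : ℝ) ≤ (1 + ε) * O + k + 1 :=
    max_le h6 (by linarith [Nat.cast_nonneg (α := ℝ) k])
  linarith

open SketchRec

/-! ### Records as lists of numbers -/

namespace SketchRec

def toWords (x : SketchRec) : List ℕ := [x.time, x.left, x.right]

theorem flatMap_toWords_injective :
    Function.Injective fun l : List SketchRec => l.flatMap toWords := by
  intro l
  induction l with
  | nil =>
    intro l' h
    cases l' with
    | nil => rfl
    | cons y l' => simp [toWords] at h
  | cons x l ih =>
    intro l' h
    cases l' with
    | nil => simp [toWords] at h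
    | cons y l' =>
      simp only [List.flatMap_cons, toWords, List.cons_append, List.nil_append,
        List.cons.injEq] at h
      obtain ⟨h1, h2, h3, h4⟩ := h
      rw [ih h4]
      cases x; cases y
      simp_all

theorem length_flatMap_toWords (l : List SketchRec) : (l.flatMap toWords).length = 3 * l.length := by
  induction l with
  | nil => rfl
  | cons x l ih => simp [toWords, ih]; ring

end SketchRec

/-- A list of lists of records as a list of numbers: each list is preceded by its length. -/
def encodeRecs (S : List (List SketchRec)) : List ℕ :=
  S.flatMap fun l => l.length :: l.flatMap toWords

/-- The length in front of each block tells where the block ends. -/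
theorem encodeRecs_injective : Function.Injective encodeRecs := by
  intro S
  induction S with
  | nil =>
    intro S' h
    cases S' with
    | nil => rfl
    | cons l S' => simp [encodeRecs] at h
  | cons l S ih =>
    intro S' h
    cases S' with
    | nil => simp [encodeRecs] at h
    | cons l' S' =>
      simp only [encodeRecs, List.flatMap_cons, List.cons_append, List.cons.injEq] at h
      obtain ⟨h1, h2⟩ := h
      obtain ⟨h3, h4⟩ := List.append_inj h2 (by simp only [length_flatMap_toWords, h1])
      rw [flatMap_toWords_injective h3, ih h4]

theorem length_encodeRecs (S : List (List SketchRec)) :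
    (encodeRecs S).length = S.length + 3 * (S.map List.length).sum := by
  induction S with
  | nil => rfl
  | cons l S ih =>
    have : encodeRecs (l :: S) = (l.length :: l.flatMap toWords) ++ encodeRecs S := rfl
    rw [this, List.length_append, ih]
    simp only [List.length_cons, List.map_cons, List.sum_cons, length_flatMap_toWords]
    ring

theorem mem_encodeRecs {S : List (List SketchRec)} {w : ℕ} (h : w ∈ encodeRecs S) :
    ∃ l ∈ S, w = l.length ∨ ∃ x ∈ l, w = x.time ∨ w = x.left ∨ w = x.right := by
  obtain ⟨l, hl, hw⟩ := List.mem_flatMap.1 h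
  refine ⟨l, hl, ?_⟩
  rcases List.mem_cons.1 hw with hw | hw
  · exact Or.inl hw
  · obtain ⟨x, hx, hw⟩ := List.mem_flatMap.1 hw
    exact Or.inr ⟨x, hx, by simpa [toWords] using hw⟩

/-! ### Positions of the stored items -/

/-- The stored items of class `j`, as positions in the array of stored items (counted from `1`)
with their records. -/
def positions (S : ℕ → List SketchRec) (j : ℕ) : List (ℕ × SketchRec) :=
  ((S j).zipIdx (1 + ∑ i ∈ Finset.range j, (S i).length)).map Prod.swap

theorem length_flatMap_range (V : ℕ → List ℝ) (k : ℕ) :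
    ((List.range k).flatMap V).length = ∑ i ∈ Finset.range k, (V i).length := by
  induction k with
  | zero => rfl
  | succ k ih => simp [List.range_succ, List.flatMap_append, Finset.sum_range_succ, ih]

theorem getElem?_flatMap_range (V : ℕ → List ℝ) {k j i : ℕ} (hj : j < k) (hi : i < (V j).length) :
    ((List.range k).flatMap V)[∑ i ∈ Finset.range j, (V i).length + i]? = (V j)[i]? := by
  induction k with
  | zero => omega
  | succ k ih =>
    rw [List.range_succ, List.flatMap_append, List.flatMap_singleton]
    rcases Nat.lt_succ_iff_lt_or_eq.1 hj with hj | rfl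
    · rw [List.getElem?_append_left]
      · exact ih hj
      · rw [length_flatMap_range]
        calc ∑ i ∈ Finset.range j, (V i).length + i
            < ∑ i ∈ Finset.range (j + 1), (V i).length := by
              rw [Finset.sum_range_succ]; omega
          _ ≤ _ := Finset.sum_le_sum_of_subset (Finset.range_subset_range.2 hj)
    · rw [List.getElem?_append_right]
      · rw [length_flatMap_range]
        simp
      · rw [length_flatMap_range]
        omega

/-- Position `i + 1` is the `i`-th stored item once the arriving item stands in front at position
`0`. The comparison results have no such shift, hence `p.1 - 1` in `insertPosition`. -/
theorem mem_positions {V : ℕ → List (ℝ × SketchRec)} {k j : ℕ} (hj : j < k)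
    {p : ℕ × SketchRec} (hp : p ∈ positions (fun j => (V j).map Prod.snd) j) (x : ℝ) :
    ∃ i, p.1 = i + 1 ∧ ((List.range k).flatMap fun j => (V j).map Prod.fst)[i]?
      = some (((x :: (List.range k).flatMap fun j => (V j).map Prod.fst)[p.1]?).getD 0) := by
  unfold positions at hp
  obtain ⟨⟨r, n⟩, hr, rfl⟩ := List.mem_map.1 hp
  rw [List.mk_mem_zipIdx_iff_le_and_getElem?_sub] at hr
  obtain ⟨hle, hget⟩ := hr
  set off := ∑ i ∈ Finset.range j, ((V i).map Prod.snd).length with hoff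
  have hoff' : off = ∑ i ∈ Finset.range j, ((V i).map Prod.fst).length := by
    simp [hoff]
  obtain ⟨i, rfl⟩ := Nat.exists_eq_add_of_le hle
  rw [Nat.add_sub_cancel_left] at hget
  have hi : i < ((V j).map Prod.fst).length := by
    have := (List.getElem?_eq_some_iff.1 hget).1
    simpa using this
  have h1 := getElem?_flatMap_range (fun j => (V j).map Prod.fst) hj hi
  rw [← hoff'] at h1
  refine ⟨off + i, by simp [Prod.swap]; ring, ?_⟩
  have h2 : 1 + off + i = (off + i) + 1 := by ring
  simp only [Prod.swap_prod_mk, h2, List.getElem?_cons_succ]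
  rw [h1, List.getElem?_eq_getElem hi]
  rfl

/-- The array and the records together determine the summaries of real items. -/
theorem positions_map {V : ℕ → List (ℝ × SketchRec)} {k j : ℕ} (hj : j < k) (x : ℝ) :
    (positions (fun j => (V j).map Prod.snd) j).map (fun p =>
      (((x :: (List.range k).flatMap fun j => (V j).map Prod.fst)[p.1]?).getD 0, p.2)) = V j := by
  unfold positions
  refine List.ext_getElem (by simp) fun i h1 h2 => ?_
  have hi : i < ((V j).map Prod.fst).length := by simpa using h2
  have h3 := getElem?_flatMap_range (fun j => (V j).map Prod.fst) hj hi
  simp only [List.length_map] at h3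
  rw [List.getElem_map, List.getElem_map, List.getElem_zipIdx]
  have h4 : 1 + ∑ i ∈ Finset.range j, ((V i).map Prod.snd).length + i
      = (∑ i ∈ Finset.range j, (V i).length + i) + 1 := by
    simp only [List.length_map]
    ring
  simp only [Prod.swap_prod_mk, h4, List.getElem?_cons_succ, h3]
  simp [h2]

theorem MergeStep.exists_fst {α : Type} {m t : ℕ} {L L' : List (α × SketchRec)}
    (h : MergeStep m t L L') {p : α × SketchRec} (hp : p ∈ L') : ∃ p' ∈ L, p'.1 = p.1 := by
  cases h with
  | right L₁ L₂ w v h =>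
    rcases List.mem_append.1 hp with hp | hp
    · exact ⟨p, by simp [hp], rfl⟩
    · rcases List.mem_cons.1 hp with rfl | hp
      · exact ⟨w, by simp, rfl⟩
      · exact ⟨p, by simp [hp], rfl⟩
  | left L₁ L₂ v w h =>
    rcases List.mem_append.1 hp with hp | hp
    · exact ⟨p, by simp [hp], rfl⟩
    · rcases List.mem_cons.1 hp with rfl | hp
      · exact ⟨w, by simp, rfl⟩
      · exact ⟨p, by simp [hp], rfl⟩

theorem exists_fst_of_merged {α : Type} {m t : ℕ} {L L' : List (α × SketchRec)}
    (h : Relation.ReflTransGen (MergeStep m t) L L') {p : α × SketchRec} (hp : p ∈ L') :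
    ∃ p' ∈ L, p'.1 = p.1 := by
  induction h generalizing p with
  | refl => exact ⟨p, hp, rfl⟩
  | tail _ hstep ih =>
    obtain ⟨p', hp', h1⟩ := hstep.exists_fst hp
    obtain ⟨p'', hp'', h2⟩ := ih hp'
    exact ⟨p'', hp'', h2.trans h1⟩

/-! ### The algorithm -/

/-- Merging until no two neighbours can be merged. -/
noncomputable def compress (m t : ℕ) (L : List (ℕ × SketchRec)) : List (ℕ × SketchRec) :=
  (exists_merged m t L).choose

/-- Insertion of the arriving item (position `0`) according to the comparisons `o` with the
stored items. -/
def insertPosition (o : List Ordering) (L : List (ℕ × SketchRec)) : List (ℕ × SketchRec) :=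
  L.filter (fun p => o[p.1 - 1]? = some .gt) ++ (0, ⟨totalMass L, 0, 0⟩) ::
    L.filter (fun p => ¬ o[p.1 - 1]? = some .gt)

/-- The new positions and records of class `j` after the arrival of an item with comparisons `o`
with the stored items and `o'` with the constants `2 ^ (-i)`. -/
noncomputable def nextPositions (m : ℕ) (S : ℕ → List SketchRec) (o o' : List Ordering) (j : ℕ) :
    List (ℕ × SketchRec) :=
  if o'[j + 1]? = some .gt ∧ ¬ o'[j]? = some .gt then
    compress m (totalMass (positions S j) + 1) (insertPosition o (positions S j))
  else positions S j

/-- The records of class `j` in the general memory. -/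
noncomputable def decodeRecs (g : List ℕ) (j : ℕ) : List SketchRec :=
  (Function.invFun encodeRecs g).getD j []

/-- The streaming part of the algorithm: a summary of the items of each size class. -/
noncomputable def classAlgCore (k m : ℕ) : ComparisonAlg (List ℕ) where
  consts := (List.range (k + 1)).map fun j => (1 / 2 : ℝ) ^ j
  small := (1 / 2) ^ k
  init := encodeRecs ((List.range k).map fun _ => [])
  select g o o' := (List.range k).flatMap fun j =>
    (nextPositions m (decodeRecs g) o o' j).map Prod.fst
  update g o o' := encodeRecs ((List.range k).map fun j =>
    (nextPositions m (decodeRecs g) o o' j).map Prod.snd)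
  output _ := 0

/-- The algorithm returns the largest number of bins that is necessary for an input with the
same memory. -/
noncomputable def classAlg (k m : ℕ) : ComparisonAlg (List ℕ) :=
  { classAlgCore k m with
    output := fun M => sSup {n | ∃ I, IsBPInput I ∧ (classAlgCore k m).toStreamAlg.run I = M ∧
      binOPT I = n} }

theorem classAlg_run (k m : ℕ) (I : List ℝ) :
    (classAlg k m).toStreamAlg.run I = (classAlgCore k m).toStreamAlg.run I := rfl

theorem decodeRecs_encodeRecs {k j : ℕ} (hj : j < k) (S : ℕ → List SketchRec) :
    decodeRecs (encodeRecs ((List.range k).map S)) j = S j := by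
  unfold decodeRecs
  rw [Function.leftInverse_invFun encodeRecs_injective]
  simp [hj]

/-- The meaning of the memory: `V j` is a summary of the items of class `j`. -/
structure ClassInv (k m : ℕ) (I : List ℝ) (M : Memory (List ℕ)) (V : ℕ → List (ℝ × SketchRec)) :
    Prop where
  items_eq : M.items = (List.range k).flatMap fun j => (V j).map Prod.fst
  gen_eq : M.gen = encodeRecs ((List.range k).map fun j => (V j).map Prod.snd)
  smallSum_eq : M.smallSum = (smallItems k I).sum
  sketch : ∀ j < k, SketchInv m (sizeClass j I) (V j)
  unmergeable : ∀ j < k, ((V j).map Prod.snd).IsChain (Unmergeable m (sizeClass j I).length)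

theorem positions_congr {k j : ℕ} (hj : j < k) {S S' : ℕ → List SketchRec}
    (h : ∀ j < k, S j = S' j) : positions S j = positions S' j := by
  unfold positions
  rw [h j hj, Finset.sum_congr rfl fun i hi => by
    rw [h i ((Finset.mem_range.1 hi).trans hj)]]

/-- The algorithm works on positions and comparison results only. Applying `look`, which replaces a
position by the item found there, turns its insertion and merging into those of the summary. The
clock of a class is its number of items, recovered as the total mass of its records. -/
theorem ClassInv.step {k m : ℕ} {I : List ℝ} {M : Memory (List ℕ)}
    {V : ℕ → List (ℝ × SketchRec)} (h : ClassInv k m I M V) (x : ℝ) :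
    ∃ V', ClassInv k m (I ++ [x]) ((classAlgCore k m).toStreamAlg.step M x) V' := by
  obtain ⟨h1, h2, h3, h4, h5⟩ := h
  obtain ⟨items, gen, smallSum⟩ := M
  simp only at h1 h2 h3
  subst h1 h2 h3
  set items := (List.range k).flatMap fun j => (V j).map Prod.fst with hitems
  set S := fun j => (V j).map Prod.snd with hS
  let look : ℕ → ℝ := fun i => ((x :: items)[i]?).getD 0
  set o := items.map (cmp x) with ho
  set o' := ((List.range (k + 1)).map fun j => (1 / 2 : ℝ) ^ j).map (cmp x) with ho'
  let P : ℕ → List (ℕ × SketchRec) :=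
    nextPositions m (decodeRecs (encodeRecs ((List.range k).map S))) o o'
  have hpos : ∀ j < k, positions (decodeRecs (encodeRecs ((List.range k).map S))) j
      = positions S j := fun j hj =>
    positions_congr hj fun i hi => decodeRecs_encodeRecs hi S
  have hlook : ∀ j < k, (positions S j).map (fun p => (look p.1, p.2)) = V j := fun j hj =>
    positions_map hj x
  have hvalid : ∀ j < k, ∀ p ∈ positions S j,
      (x :: items)[p.1]? = some (look p.1) ∧ o[p.1 - 1]? = some (cmp x (look p.1)) := by
    intro j hj p hp
    obtain ⟨i, hi, hi'⟩ := mem_positions hj hp x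
    constructor
    · rw [hi, List.getElem?_cons_succ, ← hi]
      exact hi'
    · rw [ho, List.getElem?_map, hi, Nat.add_sub_cancel, ← hi]
      rw [hi']
      rfl
  have hgt : ∀ j < k, ∀ p ∈ positions S j, (o[p.1 - 1]? = some .gt ↔ look p.1 < x) := by
    intro j hj p hp
    rw [(hvalid j hj p hp).2, Option.some_inj, cmp_eq_gt_iff]
  have hconst : ∀ j ≤ k, (o'[j]? = some .gt ↔ (1 / 2 : ℝ) ^ j < x) := by
    intro j hj
    have : o'[j]? = some (cmp x ((1 / 2 : ℝ) ^ j)) := by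
      simp [ho', List.getElem?_map, List.getElem?_range (Nat.lt_succ_of_le hj)]
    rw [this, Option.some_inj, cmp_eq_gt_iff]
  have hclass : ∀ j < k, ((o'[j + 1]? = some .gt ∧ ¬ o'[j]? = some .gt) ↔
      (1 / 2 : ℝ) ^ (j + 1) < x ∧ x ≤ (1 / 2 : ℝ) ^ j) := by
    intro j hj
    rw [hconst (j + 1) hj, hconst j hj.le, not_lt]
  have hinsert : ∀ j < k, (insertPosition o (positions S j)).map (fun p => (look p.1, p.2))
      = sketchInsert x (totalMass (positions S j)) (V j) := by
    intro j hj
    unfold insertPosition sketchInsert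
    rw [List.map_append, List.map_cons, ← hlook j hj, List.filter_map, List.filter_map]
    have e1 : (positions S j).filter (fun p => o[p.1 - 1]? = some .gt)
        = (positions S j).filter ((fun y : ℝ × SketchRec => decide (y.1 < x)) ∘
          fun p : ℕ × SketchRec => (look p.1, p.2)) :=
      List.filter_congr fun p hp => by simp [hgt j hj p hp]
    have e2 : (positions S j).filter (fun p => ¬ o[p.1 - 1]? = some .gt)
        = (positions S j).filter ((fun y : ℝ × SketchRec => decide (¬ y.1 < x)) ∘
          fun p : ℕ × SketchRec => (look p.1, p.2)) :=
      List.filter_congr fun p hp => by simp [hgt j hj p hp]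
    rw [e1, e2]
    rfl
  have hmass : ∀ j < k, totalMass (positions S j) = (sizeClass j I).length := by
    intro j hj
    rw [← (h4 j hj).mass_eq, ← hlook j hj, totalMass_map]
  have hPvalid : ∀ j < k, ∀ p ∈ P j, (x :: items)[p.1]? = some (look p.1) := by
    intro j hj p hp
    simp only [P, nextPositions, hpos j hj] at hp
    split_ifs at hp with hc
    · obtain ⟨p', hp', hpp⟩ := exists_fst_of_merged (exists_merged m _ _).choose_spec.1 hp
      rw [← hpp]
      unfold insertPosition at hp'
      rcases List.mem_append.1 hp' with hp' | hp'
      · exact (hvalid j hj p' (List.mem_of_mem_filter hp')).1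
      · rcases List.mem_cons.1 hp' with rfl | hp'
        · simp [look]
        · exact (hvalid j hj p' (List.mem_of_mem_filter hp')).1
    · exact (hvalid j hj p hp).1
  have hspec : ∀ j < k, SketchInv m (sizeClass j (I ++ [x]))
      ((P j).map fun p => (look p.1, p.2)) ∧
      ((P j).map Prod.snd).IsChain (Unmergeable m (sizeClass j (I ++ [x])).length) := by
    intro j hj
    simp only [P, nextPositions, hpos j hj]
    split_ifs with hc
    · have hcls : sizeClass j (I ++ [x]) = sizeClass j I ++ [x] := by
        unfold sizeClass
        rw [List.filter_append]
        congr 1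
        have := (hclass j hj).1 hc
        rw [List.filter_singleton, decide_eq_true this, cond_true]
      have hlen : totalMass (positions S j) + 1 = (sizeClass j (I ++ [x])).length := by
        rw [hcls, hmass j hj, List.length_append, List.length_singleton]
      have hsp := (exists_merged m (totalMass (positions S j) + 1)
        (insertPosition o (positions S j))).choose_spec
      rw [← hlen]
      refine ⟨?_, hsp.2⟩
      have hins := (h4 j hj).insert x
      rw [← hmass j hj, ← hinsert j hj, ← hcls] at hins
      refine hins.merge ?_
      rw [← hlen]
      exact hsp.1.lift _ fun _ _ hstep => hstep.map look
    · have hcls : sizeClass j (I ++ [x]) = sizeClass j I := by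
        unfold sizeClass
        rw [List.filter_append, List.filter_singleton,
          decide_eq_false fun h => hc ((hclass j hj).2 h), cond_false, List.append_nil]
      rw [hcls, hlook j hj]
      refine ⟨h4 j hj, ?_⟩
      have h6 := h5 j hj
      rw [← hlook j hj, List.map_map] at h6
      exact h6
  refine ⟨fun j => (P j).map fun p => (look p.1, p.2), ?_, ?_, ?_, fun j hj => (hspec j hj).1,
    fun j hj => ?_⟩
  · change ((List.range k).flatMap fun j => (P j).map Prod.fst).filterMap
      (fun i => (x :: items)[i]?) = _
    rw [List.filterMap_flatMap]
    refine List.flatMap_congr fun j hj => ?_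
    rw [List.filterMap_map, List.map_map]
    rw [← List.filterMap_eq_map]
    refine List.filterMap_congr fun p hp => ?_
    exact hPvalid j (List.mem_range.1 hj) p hp
  · change encodeRecs ((List.range k).map fun j => (P j).map Prod.snd) = _
    congr 1
    refine List.map_congr_left fun j _ => ?_
    rw [List.map_map]
    rfl
  · change (if x ≤ (1 / 2 : ℝ) ^ k then (smallItems k I).sum + x else (smallItems k I).sum) = _
    unfold smallItems
    rw [List.filter_append, List.sum_append, List.filter_singleton]
    by_cases hx : x ≤ (1 / 2 : ℝ) ^ k
    · rw [if_pos hx, decide_eq_true hx]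
      simp
    · rw [if_neg hx, decide_eq_false hx]
      simp
  · have := (hspec j hj).2
    rw [List.map_map]
    exact this

theorem exists_classInv (k m : ℕ) (I : List ℝ) :
    ∃ V, ClassInv k m I ((classAlgCore k m).toStreamAlg.run I) V := by
  induction I using List.reverseRecOn with
  | nil =>
    refine ⟨fun _ => [], ?_, rfl, rfl, fun j _ => SketchInv.nil m, fun j _ => List.IsChain.nil⟩
    change [] = _
    simp
  | append_singleton I x ih =>
    obtain ⟨V, hV⟩ := ih
    obtain ⟨V', hV'⟩ := hV.step x
    refine ⟨V', ?_⟩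
    unfold StreamAlg.run at hV' ⊢
    rw [List.foldl_append]
    exact hV'

theorem ClassInv.eq_of_memory_eq {k m : ℕ} {I I' : List ℝ} {M : Memory (List ℕ)}
    {V V' : ℕ → List (ℝ × SketchRec)} (h : ClassInv k m I M V) (h' : ClassInv k m I' M V') {j : ℕ}
    (hj : j < k) : V j = V' j := by
  have h1 : ∀ j < k, (V j).map Prod.snd = (V' j).map Prod.snd := fun j hj => by
    have := encodeRecs_injective (h.gen_eq.symm.trans h'.gen_eq)
    exact List.map_inj_left.1 this j (List.mem_range.2 hj)
  have e := positions_map (V := V) hj 0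
  have e' := positions_map (V := V') hj 0
  rw [← h.items_eq, positions_congr hj h1] at e
  rw [← h'.items_eq] at e'
  exact e.symm.trans e'

/-- Inputs that lead to the same memory need about the same number of bins. -/
theorem binOPT_le_of_run_eq {I I' : List ℝ} (hI : IsBPInput I) (hI' : IsBPInput I') {k m : ℕ}
    {ε : ℝ} (hε : 0 < ε) (hε1 : ε ≤ 1 / 2) (hk : (1 / 2 : ℝ) ^ k ≤ ε / 4) (hm : 16 ≤ ε * m)
    (h : (classAlgCore k m).toStreamAlg.run I' = (classAlgCore k m).toStreamAlg.run I) :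
    (binOPT I' : ℝ) ≤ (1 + ε) * binOPT I + (k + 3) := by
  obtain ⟨V, hV⟩ := exists_classInv k m I
  obtain ⟨V', hV'⟩ := exists_classInv k m I'
  rw [h] at hV'
  refine binOPT_le_of_similar hI hI' hε hε1 hk hm (hV'.smallSum_eq.symm.trans hV.smallSum_eq)
    fun j hj q => ?_
  have hs := hV.sketch j hj
  have hs' := hV'.sketch j hj
  rw [← hV.eq_of_memory_eq hV' hj] at hs'
  -- One summary serves both inputs, each with error `N / m`, so their ranks differ by at most `2 *
  -- N / m`.
  have h1 := (hs.rank_bounds q).2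
  have h2 := (hs'.rank_bounds q).1
  have h3 : (sizeClass j I').length = (sizeClass j I).length := hs'.mass_eq.symm.trans hs.mass_eq
  have h4 := congrArg (m * ·) (countLe_add_streamRank (sizeClass j I) q)
  have h5 := congrArg (m * ·) (countLe_add_streamRank (sizeClass j I') q)
  simp only [mul_add] at h4 h5
  rw [h3] at h2 h5
  omega

/-- The actual input is among those over which the supremum is taken, so the output is no less than
its optimum; `binOPT_le_of_run_eq` bounds all competitors, with the constant `k + 3` as the additive
term. -/
theorem classAlg_isAsymptoticApprox {k m : ℕ} {ε : ℝ} (hε : 0 < ε) (hε1 : ε ≤ 1 / 2)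
    (hk : (1 / 2 : ℝ) ^ k ≤ ε / 4) (hm : 16 ≤ ε * m) :
    (classAlg k m).toStreamAlg.IsAsymptoticApprox (1 + ε) := by
  refine ⟨fun _ => k + 3, ?_, fun I hI => ?_⟩
  · rw [isLittleO_const_left]
    exact Or.inr (tendsto_norm_atTop_atTop.comp tendsto_natCast_atTop_atTop)
  · set T := {n | ∃ J, IsBPInput J ∧
      (classAlgCore k m).toStreamAlg.run J = (classAlgCore k m).toStreamAlg.run I ∧ binOPT J = n}
      with hT
    have hout : (classAlg k m).toStreamAlg.output ((classAlg k m).toStreamAlg.run I) = sSup T := rfl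
    have hmem : binOPT I ∈ T := ⟨I, hI, rfl, rfl⟩
    have hbound : ∀ n ∈ T, (n : ℝ) ≤ (1 + ε) * binOPT I + (k + 3) := by
      rintro n ⟨J, hJ, hrun, rfl⟩
      exact binOPT_le_of_run_eq hI hJ hε hε1 hk hm hrun
    have hbdd : BddAbove T := ⟨⌊(1 + ε) * binOPT I + (k + 3)⌋₊, fun n hn =>
      Nat.le_floor (hbound n hn)⟩
    rw [hout]
    exact ⟨le_csSup hbdd hmem, hbound _ (Nat.sSup_mem ⟨_, hmem⟩ hbdd)⟩

/-! ### The number and the size of the memory words -/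

theorem le_totalMass {α : Type} {L : List (α × SketchRec)} {x : α × SketchRec} (hx : x ∈ L) :
    x.2.mass ≤ totalMass L :=
  List.single_le_sum (fun _ _ => Nat.zero_le _) _ (List.mem_map_of_mem hx)

theorem length_le_totalMass {α : Type} (L : List (α × SketchRec)) : L.length ≤ totalMass L := by
  induction L with
  | nil => simp
  | cons x L ih =>
    rw [totalMass_cons, List.length_cons]
    unfold mass
    omega

theorem classAlg_word_le {k m : ℕ} {I : List ℝ} {w : ℕ}
    (hw : w ∈ ((classAlg k m).toStreamAlg.run I).gen) : w ≤ I.length := by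
  obtain ⟨V, hV⟩ := exists_classInv k m I
  rw [classAlg_run, hV.gen_eq] at hw
  obtain ⟨l, hl, hw⟩ := mem_encodeRecs hw
  obtain ⟨j, hj, rfl⟩ := List.mem_map.1 hl
  have hs := hV.sketch j (List.mem_range.1 hj)
  have hlen : (sizeClass j I).length ≤ I.length := List.length_filter_le _ _
  have hmass := hs.mass_eq
  rcases hw with rfl | ⟨r, hr, hw⟩
  · have := length_le_totalMass (V j)
    rw [List.length_map]
    omega
  · obtain ⟨x, hx, rfl⟩ := List.mem_map.1 hr
    have h1 := le_totalMass hx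
    have h2 := hs.left_le x hx
    have h3 : x.2.time ≤ (sizeClass j I).length := (Nat.le_add_left _ _).trans h2
    unfold mass at h1
    rcases hw with rfl | rfl | rfl <;> omega

/-- A record costs four words: its item and three numbers. The remaining `2 * k + 2` words are the
constants, the lengths of the blocks and the sum. A class has at most `2 ^ k * OPT ≤ m * OPT` items,
so only `log (OPT + 2)` enters. -/
theorem classAlg_space {k m : ℕ} (hm : 2 ^ k ≤ m) {I : List ℝ} (hI : IsBPInput I) :
    (((classAlg k m).consts.length + ((classAlg k m).toStreamAlg.run I).items.length +
      ((classAlg k m).toStreamAlg.run I).gen.length + 1 : ℕ) : ℝ)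
      ≤ 2 * k + 2 + 4 * (k * (1 + 2 * m * (1 + Real.log (binOPT I + 2)))) := by
  obtain ⟨V, hV⟩ := exists_classInv k m I
  have hitems : ((classAlg k m).toStreamAlg.run I).items.length
      = ((List.range k).map fun j => (V j).length).sum := by
    rw [classAlg_run, hV.items_eq, List.length_flatMap]
    simp
  have hgen : ((classAlg k m).toStreamAlg.run I).gen.length
      = k + 3 * ((List.range k).map fun j => (V j).length).sum := by
    rw [classAlg_run, hV.gen_eq, length_encodeRecs, List.map_map]
    simp [Function.comp_def]
  have hconsts : (classAlg k m).consts.length = k + 1 := by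
    simp [classAlg, classAlgCore]
  have hm0 : 0 < m := lt_of_lt_of_le (by positivity) hm
  have hbound : ∀ j < k, ((V j).length : ℝ) ≤ 1 + 2 * m * (1 + Real.log (binOPT I + 2)) := by
    intro j hj
    have hO : (0 : ℝ) ≤ binOPT I := Nat.cast_nonneg _
    refine (hV.sketch j hj).length_le hm0 (hV.unmergeable j hj) (by linarith) ?_
    refine (hI.length_sizeClass_le hj).trans ?_
    have : (2 ^ k : ℝ) ≤ m := by exact_mod_cast hm
    gcongr
    linarith
  have hsum : ((((List.range k).map fun j => (V j).length).sum : ℕ) : ℝ)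
      ≤ k * (1 + 2 * m * (1 + Real.log (binOPT I + 2))) := by
    rw [Nat.cast_list_sum, List.map_map]
    have := List.sum_le_card_nsmul ((List.range k).map (Nat.cast ∘ fun j => (V j).length))
      (1 + 2 * m * (1 + Real.log (binOPT I + 2))) (by
        intro y hy
        obtain ⟨j, hj, rfl⟩ := List.mem_map.1 hy
        exact hbound j (List.mem_range.1 hj))
    rw [nsmul_eq_mul, List.length_map, List.length_range] at this
    exact this
  rw [hitems, hgen, hconsts]
  generalize ((List.range k).map fun j => (V j).length).sum = s at hsum
  push_cast
  linarith

/-- `2 ^ k` is the least power of two that is at least `⌈4 / ε⌉`, hence below `8 / ε + 2`. From `2 ^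
k ≤ 16 / ε` and `2 ≤ 1 / ε` one gets `k * log 2 ≤ 5 * log (1 / ε)`, and `5 / log 2 < 8`. -/
theorem exists_class_parameters {ε : ℝ} (hε : 0 < ε) (hε1 : ε ≤ 1 / 2) :
    ∃ k : ℕ, 1 ≤ k ∧ (1 / 2 : ℝ) ^ k ≤ ε / 4 ∧ (2 : ℝ) ^ k ≤ 10 / ε ∧
      (k : ℝ) ≤ 8 * Real.log (1 / ε) := by
  set c := ⌈4 / ε⌉₊ with hc
  have h8 : 8 ≤ 4 / ε := by
    rw [le_div_iff₀ hε]; linarith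
  have hc1 : 4 / ε ≤ c := Nat.le_ceil _
  have hc2 : (c : ℝ) < 4 / ε + 1 := Nat.ceil_lt_add_one (by positivity)
  have hc8 : 8 ≤ c := by
    have : (8 : ℝ) ≤ c := h8.trans hc1
    exact_mod_cast this
  set k := Nat.clog 2 c with hk
  have hk1 : c ≤ 2 ^ k := Nat.le_pow_clog (by norm_num) c
  have hk2 : 2 ^ k.pred < c := Nat.pow_pred_clog_lt_self (by norm_num) (by omega)
  have hk0 : 1 ≤ k := by
    by_contra! h
    have : k = 0 := by omega
    rw [this] at hk1
    omega
  have hk1' : 4 / ε ≤ (2 : ℝ) ^ k := hc1.trans (by exact_mod_cast hk1)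
  have hpow : (2 : ℝ) ^ k ≤ 10 / ε := by
    have h1 : (2 : ℝ) ^ k = 2 * 2 ^ (k - 1) := by
      rw [← pow_succ', Nat.sub_add_cancel hk0]
    have h2 : (2 : ℝ) ^ (k - 1) < c := by exact_mod_cast hk2
    have h3 : 10 / ε = 2 * (4 / ε) + 2 * (1 / ε) := by ring
    have h4 : 1 ≤ 1 / ε := by
      rw [le_div_iff₀ hε]; linarith
    linarith
  refine ⟨k, hk0, ?_, hpow, ?_⟩
  · rw [one_div, inv_pow, inv_le_comm₀ (by positivity) (by positivity), inv_div]
    exact hk1'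
  · have h1 := Real.log_le_log (by positivity) hpow
    have h2 : 10 / ε ≤ 2 ^ 4 * (1 / ε) := by
      rw [mul_one_div]
      gcongr
      norm_num
    have h3 := Real.log_le_log (by positivity) h2
    rw [Real.log_mul (by positivity) (by positivity), Real.log_pow] at h3
    rw [Real.log_pow] at h1
    have h4 : Real.log 2 ≤ Real.log (1 / ε) :=
      Real.log_le_log (by norm_num) (by rw [le_div_iff₀ hε]; linarith)
    have h5 := Real.log_two_gt_d9
    push_cast at h3
    nlinarith [Nat.cast_nonneg (α := ℝ) k]

/-- The summary algorithm is optimal up to a factor of `O(log (1 / ε))`. -/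
theorem exists_comparisonAlg {ε : ℝ} (hε : 0 < ε) (hε1 : ε ≤ 1 / 2) :
    ∃ A : ComparisonAlg (List ℕ), A.small ≤ ε ∧
      A.toStreamAlg.IsAsymptoticApprox (1 + ε) ∧
      ∀ I : List ℝ, IsBPInput I →
        ((A.consts.length + (A.toStreamAlg.run I).items.length +
            (A.toStreamAlg.run I).gen.length + 1 : ℕ) : ℝ) ≤
          12800 * ((1 / ε) * Real.log (1 / ε) * Real.log ((binOPT I : ℝ) + 2)) ∧
        ∀ w ∈ (A.toStreamAlg.run I).gen, w ≤ I.length := by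
  obtain ⟨k, hk1, hk2, hk3, hk4⟩ := exists_class_parameters hε hε1
  have hk5 : 4 / ε ≤ 2 ^ k := by
    rw [one_div, inv_pow, inv_le_comm₀ (by positivity) (by positivity), inv_div] at hk2
    exact hk2
  -- `m = 4 * 2 ^ k` is at least both `16 / ε` and `2 ^ k`, yet `O(1 / ε)`.
  refine ⟨classAlg k (4 * 2 ^ k), ?_, classAlg_isAsymptoticApprox hε hε1 hk2 ?_, fun I hI =>
    ⟨(classAlg_space (by omega) hI).trans ?_, fun w hw => classAlg_word_le hw⟩⟩
  · change (1 / 2 : ℝ) ^ k ≤ ε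
    linarith
  · rw [div_le_iff₀ hε] at hk5
    push_cast
    linarith
  · set Λ := Real.log ((binOPT I : ℝ) + 2) with hΛ
    -- The `+ 2` under the logarithm keeps `Λ ≥ log 2 > 1/2`, so that additive constants are
    -- absorbed even when the optimum is `0`.
    have hΛ2 : 1 ≤ 2 * Λ := by
      have h1 : Real.log 2 ≤ Λ := Real.log_le_log (by norm_num)
        (by linarith [Nat.cast_nonneg (α := ℝ) (binOPT I)])
      linarith [Real.log_two_gt_d9]
    have hkr : (1 : ℝ) ≤ k := by exact_mod_cast hk1
    push_cast
    have hm1 : (1 : ℝ) ≤ 4 * 2 ^ k := by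
      have : (1 : ℝ) ≤ 2 ^ k := one_le_pow₀ (by norm_num)
      linarith
    have hm2 : (4 * 2 ^ k : ℝ) ≤ 40 / ε := by
      have : 40 / ε = 4 * (10 / ε) := by ring
      linarith
    generalize (4 * 2 ^ k : ℝ) = m at hm1 hm2
    have hΛ0 : 0 ≤ Λ := by linarith
    have e1 : m ≤ m * (2 * Λ) := le_mul_of_one_le_right (by linarith) hΛ2
    have e2 : 1 + 2 * m * (1 + Λ) ≤ 8 * (m * Λ) := by linarith
    have e3 : (k : ℝ) * (1 + 2 * m * (1 + Λ)) ≤ k * (8 * (m * Λ)) :=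
      mul_le_mul_of_nonneg_left e2 (by linarith)
    have e4 : (k : ℝ) * 1 ≤ k * (2 * (m * Λ)) :=
      mul_le_mul_of_nonneg_left (by linarith) (by linarith)
    have e5 : 2 * (k : ℝ) + 2 + 4 * (k * (1 + 2 * m * (1 + Λ))) ≤ 40 * (k * (m * Λ)) := by
      linarith
    refine e5.trans ?_
    have e6 : (k : ℝ) * (m * Λ) ≤ (8 * Real.log (1 / ε)) * ((40 / ε) * Λ) := by
      gcongr
      linarith
    have e7 : 40 * ((8 * Real.log (1 / ε)) * ((40 / ε) * Λ))
        = 12800 * (1 / ε * Real.log (1 / ε) * Λ) := by ring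
    linarith

theorem mainTheorem5 :
    -- a streaming `(1 + ε)`-approximation yields a `4ε`-approximate rank summary, whose memory is
    -- the memory of the algorithm after two copies of each number, and one counter
    (∀ (σ : Type) (A : StreamAlg σ) (ε : ℝ), 0 < ε → A.IsAsymptoticApprox (1 + ε) →
      ∀ l u : ℝ, l < u →
        (A.rankSummary l u).IsApprox (Set.Ioo l u) (4 * ε) ∧
        ∀ a : List ℝ, (A.rankSummary l u).run a =
          (A.run (a.flatMap fun x => [scaleTo l u x, scaleTo l u x]), a.length)) ∧
    -- lower bound on the number of stored items
    (∃ c : ℝ, 0 < c ∧ ∀ ε : ℝ, 0 < ε → ε < 1 / 64 →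
      ∀ (G : Type) (A : ComparisonAlg G), A.small ≤ 1 / 2 →
        A.toStreamAlg.IsAsymptoticApprox (1 + ε) →
        ∀ᶠ n : ℕ in atTop, ∃ I : List ℝ, IsBPInput I ∧ binOPT I = n ∧
          ∃ p : List ℝ, p <+: I ∧
            c * (1 / ε) * Real.log (n : ℝ) ≤ ((A.toStreamAlg.run p).items.length : ℝ)) ∧
    -- an algorithm whose memory is larger only by a factor of `O(log (1 / ε))`; its general memory
    -- consists of integer words of `O(log N)` bits
    (∃ K : ℕ, ∀ ε : ℝ, 0 < ε → ε ≤ 1 / 2 →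
      ∃ A : ComparisonAlg (List ℕ), A.small ≤ ε ∧
        A.toStreamAlg.IsAsymptoticApprox (1 + ε) ∧
        ∀ I : List ℝ, IsBPInput I →
          ((A.consts.length + (A.toStreamAlg.run I).items.length +
              (A.toStreamAlg.run I).gen.length + 1 : ℕ) : ℝ) ≤
            (K : ℝ) * ((1 / ε) * Real.log (1 / ε) * Real.log ((binOPT I : ℝ) + 2)) ∧
          ∀ w ∈ (A.toStreamAlg.run I).gen, w ≤ (I.length + 1) ^ K) := by
  refine ⟨fun σ A ε hε hA l u hlu =>
      ⟨A.rankSummary_isApprox hε hA hlu, fun a => rankSummary_run A l u a⟩,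
    ⟨1 / 64, by norm_num, fun ε h0 h1 G A hs hA => ComparisonAlg.exists_large_memory h0 h1 hs hA⟩,
    ?_⟩
  -- One constant serves as factor and as exponent. It is kept opaque because the exponent only has
  -- to be nonzero.
  obtain ⟨K, hK⟩ : ∃ K : ℕ, K = 12800 := ⟨_, rfl⟩
  refine ⟨K, fun ε hε hε1 => ?_⟩
  obtain ⟨A, hsmall, happrox, hA⟩ := exists_comparisonAlg hε hε1
  refine ⟨A, hsmall, happrox, fun I hI => ⟨?_, fun w hw => ?_⟩⟩
  · refine (hA I hI).1.trans_eq ?_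
    rw [hK]
    norm_num
  · exact (((hA I hI).2 w hw).trans (Nat.le_succ _)).trans
      (Nat.le_self_pow (by omega) _)
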